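/- **Conventions.** $\mathbb K$ is a field of characteristic $0$ and $S$ is a set of colors. $\Sigma$ is the set of isomorphism classes of finite connected oriented graphs without loops (multiple edges allowed, at least one edge) whose edges carry pairwise different colors from $S$; $\sigma\mapsto\sigma^*$ inverts all orientations. A *film surface* $\Omega$ is a finite nonempty two-dimensional CW-complex with the following properties: it is glued from closed oriented colored disks (polygons) along a finite loopless graph $\Delta$, the boundary of each disk being embedded in $\Delta$ and these boundaries covering $\Delta$; disks of one connected component have different colors; the vertices of each component carry a cyclic order, in which the oriented boundary of each disk meets its vertices; and for each division of the vertices of a component into two nonempty cyclic intervals there is a *graph-cut* realizing it, i.e. a connected graph $\gamma\subset\Omega$ avoiding the vertices, meeting each disk in at most one chord, and dividing the component into two connected parts with these sets of vertices. The graph of a vertex $q$ is its link, whose edges (corners of disks) have the colors of the disks and are oriented from the incoming to the outgoing boundary edge; its class is $\sigma_q\in\Sigma$. For $\sigma_1,\dots,\sigma_n\in\Sigma$ let $\Omega(\sigma_1,\dots,\sigma_n)$ be the connected film surface with vertices $q_1,\dots,q_n$ in this cyclic order and $\sigma_{q_i}=\sigma_i$, if there is one (it is then unique up to isomorphism); otherwise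 write $\Omega(\sigma_1,\dots,\sigma_n)=\emptyset$. Let $\{B_\sigma\}_{\sigma\in\Sigma}$ be finite-dimensional vector spaces over $\mathbb K$, and $V_\Omega=\bigotimes_q B_{\sigma_q}$ over the vertices $q$ of $\Omega$. A *Film Topological Field Theory* on $\{B_\sigma\}$ consists of tensors $K_\sigma\in B_\sigma\otimes B_{\sigma^*}$ and linear forms $\Phi_\Omega:V_\Omega\to\mathbb K$ for all film surfaces such that: 1. $\Phi_{\Omega'}(\phi_*x)=\Phi_\Omega(x)$ for isomorphisms $\phi:\Omega\to\Omega'$ (preserving cyclic orders, orientations of disks and colors); 2. for a film surface with exactly two vertices, with graphs $\sigma_1,\sigma_2$, the form $(x',x'')\mapsto\Phi_\Omega(x'_{q_1}\otimes x''_{q_2})$ on $B_{\sigma_1}\times B_{\sigma_2}$ is non-degenerate; 3. $\Phi_{\Omega[\gamma]}(x\otimes K_\sigma)=\Phi_\Omega(x)$ for graph-cuts $\gamma$ of connected $\Omega$, where $\Omega[\gamma]$ is obtained by cutting along $\gamma$ and contracting the two copies of $\gamma$ to new vertices $q_+,q_-$ (in either labelling), and $\sigma=\sigma_{q_+}=\sigma_{q_-}^*$;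 4. $\Phi_{\Omega'\sqcup\Omega''}(x'\otimes x'')=\Phi_{\Omega'}(x')\Phi_{\Omega''}(x'')$. A *graph-Frobenius algebra* on $\{B_\sigma\}$ is the space $B_\star=\bigoplus_{\sigma\in\Sigma}B_\sigma$ with a symmetric non-degenerate bilinear form $(\cdot,\cdot)$ and a cyclically invariant trilinear form $(\cdot,\cdot,\cdot)$, i.e. $(x,y)=(y,x)$ and $(x,y,z)=(y,z,x)$, such that $(B_{\sigma_1},B_{\sigma_2})=0$ for $\sigma_1\ne\sigma_2^*$, $(B_{\sigma_1},B_{\sigma_2},B_{\sigma_3})=0$ if $\Omega(\sigma_1,\sigma_2,\sigma_3)=\emptyset$, and, whenever $\Omega(\sigma_1,\sigma_2,\sigma_3,\sigma_4)\neq\emptyset$ and $x_k\in B_{\sigma_k}$, $$\sum_{i,j}(x_1,x_2,b^{s}_i)F_s^{ij}(b^{s^*}_j,x_3,x_4)=\sum_{i,j}(x_4,x_1,b^{t}_i)F_t^{ij}(b^{t^*}_j,x_2,x_3),$$ where $s,t\in\Sigma$ are the classes for which $\Omega(\sigma_1,\sigma_2,s)$, $\Omega(s^*,\sigma_3,\sigma_4)$,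 $\Omega(\sigma_4,\sigma_1,t)$, $\Omega(t^*,\sigma_2,\sigma_3)$ are nonempty. Here $\{b^\sigma_i\}$ is a basis of $B_\sigma$ and $(F_\sigma^{ij})$ is the inverse of the Gram matrix: $\sum_jF_\sigma^{ij}(b_j^{\sigma^*},b_k^{\sigma})=\delta_{ik}$. Say that a theory $\Phi$ *generates* a graph-Frobenius algebra on the same $\{B_\sigma\}$ if $(x',x'')=\Phi_{\Omega(\sigma_1,\sigma_2)}(x'_{q_1}\otimes x''_{q_2})$ and $(x',x'',x''')=\Phi_{\Omega(\sigma_1,\sigma_2,\sigma_3)}(x'_{q_1}\otimes x''_{q_2}\otimes x'''_{q_3})$ for all elements of the respective $B_{\sigma_i}$ whenever these surfaces exist. **Theorem 3.2.** (a) Every graph-Frobenius algebra on $\{B_\sigma\}$ is generated by exactly one Film Topological Field Theory $\Phi$ on $\{B_\sigma\}$. For every choice of bases, all $x^i\in B_{\sigma_i}$ and every film surface $\Omega(\sigma_1,\dots,\sigma_n)$ with $n\ge3$, $$\Phi_{\Omega(\sigma_1,\dots,\sigma_n)}(x^1_{q_1}\otimes\dots\otimes x^n_{q_n})=\sum_{s_1,\dots,s_{n-3}\in\Sigma}\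 \sum_{i_1,j_1,\dots,i_{n-3},j_{n-3}}(x^1,x^2,b^{s_1}_{i_1})F_{s_1}^{i_1j_1}(b^{s_1^*}_{j_1},x^3,b^{s_2}_{i_2})F_{s_2}^{i_2j_2}\cdots F_{s_{n-3}}^{i_{n-3}j_{n-3}}(b^{s_{n-3}^*}_{j_{n-3}},x^{n-1},x^n),$$ which for $n=3$ reads $(x^1,x^2,x^3)$; for $n=2$ the value is $(x^1,x^2)$. (b) Every Film Topological Field Theory on $\{B_\sigma\}$ generates exactly one graph-Frobenius algebra on $\{B_\sigma\}$. (c) Consequently, "generates" induces a bijection between isomorphism classes of Film Topological Field Theories and isomorphism classes of graph-Frobenius algebras (isomorphisms being families of linear isomorphisms $B_\sigma\to B'_\sigma$ preserving the tensors $K_\sigma$ and all $\Phi_\Omega$, respectively the bilinear and trilinear forms). -/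

import Mathlib

open scoped TensorProduct DirectSum

universe u v w

namespace Film

theorem eqvGen_lift {α β : Type*} {r : α → α → Prop} {s : β → β → Prop} (f : α → β)
    (h : ∀ a b, r a b → Relation.EqvGen s (f a) (f b)) {a b : α} (hab : Relation.EqvGen r a b) :
    Relation.EqvGen s (f a) (f b) := by
  induction hab with
  | rel a b hab => exact h a b hab
  | refl a => exact .refl _
  | symm a b _ ih => exact .symm _ _ ih
  | trans a b c _ _ ih1 ih2 => exact .trans _ _ _ ih1 ih2

/-- A connected regular (that is, loopless) oriented graph with at least one edge, whose edges carry
pairwise different colors from `S`.  Multiple edges are allowed. -/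
structure ColoredGraph (S : Type w) where
  V : Type
  E : Type
  finV : Finite V
  finE : Finite E
  nonemptyE : Nonempty E
  src : E → V
  tgt : E → V
  color : E → S
  src_ne_tgt : ∀ e, src e ≠ tgt e
  color_injective : Function.Injective color
  connected : ∀ v w, Relation.EqvGen (fun a b => ∃ e, src e = a ∧ tgt e = b) v w

namespace ColoredGraph

variable {S : Type w}

/-- Isomorphisms of oriented colored graphs preserve the orientations and the colors. -/
structure Iso (G H : ColoredGraph S) where
  onV : G.V ≃ H.V
  onE : G.E ≃ H.E
  map_src : ∀ e, onV (G.src e) = H.src (onE e)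
  map_tgt : ∀ e, onV (G.tgt e) = H.tgt (onE e)
  map_color : ∀ e, H.color (onE e) = G.color e

/-- The isomorphism relation on oriented colored graphs. -/
instance setoid (S : Type w) : Setoid (ColoredGraph S) where
  r G H := Nonempty (Iso G H)
  iseqv :=
    { refl := fun G => ⟨⟨Equiv.refl _, Equiv.refl _, fun _ => rfl, fun _ => rfl, fun _ => rfl⟩⟩
      symm := by
        rintro G H ⟨f⟩
        refine ⟨⟨f.onV.symm, f.onE.symm, fun e => ?_, fun e => ?_, fun e => ?_⟩⟩
        · rw [Equiv.symm_apply_eq, f.map_src, Equiv.apply_symm_apply]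
        · rw [Equiv.symm_apply_eq, f.map_tgt, Equiv.apply_symm_apply]
        · rw [← f.map_color, Equiv.apply_symm_apply]
      trans := by
        rintro G H I ⟨f⟩ ⟨g⟩
        refine ⟨⟨f.onV.trans g.onV, f.onE.trans g.onE, fun e => ?_, fun e => ?_, fun e => ?_⟩⟩
        · simp [f.map_src, g.map_src]
        · simp [f.map_tgt, g.map_tgt]
        · simp [f.map_color, g.map_color] }

/-- Inversion of all orientations. -/
def reverse (G : ColoredGraph S) : ColoredGraph S where
  V := G.V
  E := G.E
  finV := G.finV
  finE := G.finE
  nonemptyE := G.nonemptyE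
  src := G.tgt
  tgt := G.src
  color := G.color
  src_ne_tgt e := (G.src_ne_tgt e).symm
  color_injective := G.color_injective
  connected v w := eqvGen_lift id
    (fun _ _ ⟨e, h1, h2⟩ => .symm _ _ (.rel _ _ ⟨e, h2, h1⟩)) (G.connected v w)

/-- A color and orientation preserving map that is bijective on vertices and surjective on edges is an
isomorphism (it is injective on edges since the colors of the edges are different). -/
theorem equiv_of_map {G H : ColoredGraph S} (f : G.V → H.V) (g : G.E → H.E)
    (hf : Function.Bijective f) (hg : Function.Surjective g)
    (hs : ∀ e, f (G.src e) = H.src (g e)) (ht : ∀ e, f (G.tgt e) = H.tgt (g e))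
    (hc : ∀ e, H.color (g e) = G.color e) : G ≈ H := by
  have hgi : Function.Injective g := fun a b h => by
    apply G.color_injective
    rw [← hc, ← hc, h]
  exact ⟨⟨Equiv.ofBijective f hf, Equiv.ofBijective g ⟨hgi, hg⟩, hs, ht, hc⟩⟩

end ColoredGraph

/-- The set of isomorphism classes of connected oriented colored graphs. -/
def GraphClass (S : Type w) : Type (max 1 w) := Quotient (ColoredGraph.setoid S)

noncomputable instance (S : Type w) : DecidableEq (GraphClass S) := Classical.decEq _

/-- The involution on classes of oriented colored graphs that inverts the orientations. -/
def GraphClass.star {S : Type w} : GraphClass S → GraphClass S :=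
  Quotient.map ColoredGraph.reverse (by
    rintro G H ⟨f⟩
    exact ⟨⟨f.onV, f.onE, f.map_tgt, f.map_src, f.map_color⟩⟩)

/-- The cells of a finite regular two-dimensional CW-complex with colored oriented disks, together
with a ternary relation on its vertices.  `V`, `E` are the vertices and edges of the graph `Δ`, `D` is
the set of closed oriented disks, and `C` is the set of all sides of the disks (seen as polygons).
The gluing map sends the side `c` of the disk `disk c` to the edge `edge c`; traversed along the
orientation of the disk, this side runs from the vertex `src c` to the vertex `tgt c`. -/
structure SurfaceData (S : Type w) where
  V : Type
  E : Type
  D : Type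
  C : Type
  ends : E → Sym2 V
  disk : C → D
  edge : C → E
  src : C → V
  tgt : C → V
  color : D → S
  /-- `cyc x y z`: one meets `x`, `y`, `z` in this cyclic order (they are pairwise different). -/
  cyc : V → V → V → Prop

namespace SurfaceData

variable {S : Type w} (X : SurfaceData S)

/-- Two vertices lie in the same connected component. -/
def Joined : X.V → X.V → Prop := Relation.EqvGen fun v w => ∃ e, X.ends e = s(v, w)

/-- The side `c'` follows the side `c` on the boundary of a disk. -/
def Next (c c' : X.C) : Prop := X.disk c = X.disk c' ∧ X.tgt c = X.src c'

/-- A division of the vertices into two groups (given by `χ`) is compatible with the cyclic order if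
the two groups do not interlace, so that on each component the groups are cyclic intervals. -/
def Compatible (χ : X.V → Bool) : Prop :=
  ∀ a b a' b', χ a = χ a' → χ b = χ b' → χ a ≠ χ b → X.cyc a b a' → ¬ X.cyc a' b' a

/-- The edge `e` joins the two groups of the division `χ`, that is, it crosses the cut. -/
def Crosses (χ : X.V → Bool) (e : X.E) : Prop := ∃ v w, X.ends e = s(v, w) ∧ χ v ≠ χ w

/-- The adjacency relation of the graph `γ` that divides the vertices according to `χ`.  Its vertices
are the points of intersection with the edges of `Δ` that cross the cut, and its edges are chords of
disks, one for each disk that has vertices in both groups; the chord joins the two sides of the disk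
that cross the cut. -/
def CutAdj (χ : X.V → Bool) (e e' : X.E) : Prop :=
  X.Crosses χ e ∧ X.Crosses χ e' ∧ ∃ c c', X.disk c = X.disk c' ∧ X.edge c = e ∧ X.edge c' = e'

/-- On each component, the division `χ` is realized by a graph-cut: the graph that
divides the vertices according to `χ` is connected and each of the two parts of the component is
connected. -/
structure IsGraphCut (χ : X.V → Bool) : Prop where
  graph_connected : ∀ e e', X.Crosses χ e → X.Crosses χ e' →
    (∀ v ∈ X.ends e, ∀ w ∈ X.ends e', X.Joined v w) → Relation.EqvGen (X.CutAdj χ) e e'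
  parts_connected : ∀ v w, X.Joined v w → χ v = χ w →
    Relation.EqvGen (fun a b => χ a = χ v ∧ χ b = χ v ∧ ∃ e, X.ends e = s(a, b)) v w

end SurfaceData

/-- Film surfaces: finite nonempty colored cyclic complexes. -/
structure FilmSurface (S : Type w) extends SurfaceData S where
  finV : Finite V
  finE : Finite E
  finD : Finite D
  finC : Finite C
  nonemptyV : Nonempty V
  /-- the graph `Δ` is regular -/
  ends_not_isDiag : ∀ e, ¬ (ends e).IsDiag
  /-- the gluing map is compatible with the incidence of sides and vertices -/
  ends_edge : ∀ c, ends (edge c) = s(src c, tgt c)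
  /-- the sides of a disk form one circle -/
  circle : ∀ c c', disk c = disk c' → Relation.TransGen toSurfaceData.Next c c'
  /-- the gluing map is a homeomorphism of the boundary of each disk onto its image -/
  src_inj : ∀ c c', disk c = disk c' → src c = src c' → c = c'
  tgt_inj : ∀ c c', disk c = disk c' → tgt c = tgt c' → c = c'
  edge_inj : ∀ c c', disk c = disk c' → edge c = edge c' → c = c'
  disk_surj : Function.Surjective disk
  /-- the gluing map is onto `Δ` -/
  edge_surj : Function.Surjective edge
  src_surj : Function.Surjective src
  /-- `cyc` is a strict cyclic order on the set of vertices of each component -/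
  cyc_rotate : ∀ x y z, cyc x y z → cyc y z x
  cyc_asymm : ∀ x y z, cyc x y z → ¬ cyc z y x
  cyc_trans : ∀ x y z t, cyc x y z → cyc x z t → cyc x y t
  cyc_total : ∀ x y z, toSurfaceData.Joined x y → toSurfaceData.Joined y z →
    x ≠ y → y ≠ z → x ≠ z → cyc x y z ∨ cyc z y x
  cyc_joined : ∀ x y z, cyc x y z → toSurfaceData.Joined x y
  /-- the boundary of each disk meets its vertices in the cyclic order -/
  cyc_disk : ∀ c c', disk c = disk c' → ¬ cyc (src c) (src c') (tgt c)
  /-- different disks of the same component have different colors -/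
  color_inj : ∀ c c', toSurfaceData.Joined (src c) (src c') →
    color (disk c) = color (disk c') → disk c = disk c'
  /-- each division of the vertices compatible with the cyclic order is realized by a graph-cut -/
  cyclic : ∀ χ, toSurfaceData.Compatible χ → toSurfaceData.IsGraphCut χ

namespace FilmSurface

variable {S : Type w} (X : FilmSurface S)

/-- A film surface is connected if any two vertices are joined by a path in `Δ`. -/
def Connected : Prop := ∀ v w, X.Joined v w

variable {X}

theorem joined_refl (v : X.V) : X.Joined v v := .refl v

theorem Joined.symm {v w : X.V} (h : X.Joined v w) : X.Joined w v := Relation.EqvGen.symm _ _ h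

theorem Joined.trans {v w x : X.V} (h : X.Joined v w) (h' : X.Joined w x) : X.Joined v x :=
  Relation.EqvGen.trans _ _ _ h h'

theorem src_ne_tgt (c : X.C) : X.src c ≠ X.tgt c := by
  have h := X.ends_not_isDiag (X.edge c)
  rw [X.ends_edge] at h
  simpa using h

theorem joined_side (c : X.C) : X.Joined (X.src c) (X.tgt c) := .rel _ _ ⟨_, X.ends_edge c⟩

theorem next_joined {c c' : X.C} (h : X.Next c c') : X.Joined (X.src c) (X.src c') := by
  have h1 := joined_side c
  rwa [h.2] at h1

theorem exists_next (c : X.C) : ∃ c', X.Next c c' := by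
  obtain ⟨c', h, -⟩ := Relation.TransGen.head'_iff.1 (X.circle c c rfl)
  exact ⟨c', h⟩

theorem exists_prev (c : X.C) : ∃ c', X.Next c' c := by
  obtain ⟨c', -, h⟩ := Relation.TransGen.tail'_iff.1 (X.circle c c rfl)
  exact ⟨c', h⟩

theorem joined_disk {c c' : X.C} (h : X.disk c = X.disk c') : X.Joined (X.src c) (X.src c') := by
  have h0 := X.circle c c' h
  clear h
  induction h0 with
  | single h => exact next_joined h
  | tail _ h ih => exact Joined.trans ih (next_joined h)

theorem cyc_rotate₂ {x y z : X.V} (h : X.cyc x y z) : X.cyc z x y :=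
  X.cyc_rotate _ _ _ (X.cyc_rotate _ _ _ h)

theorem cyc_ne₁ {x y z : X.V} (h : X.cyc x y z) : x ≠ y := by
  rintro rfl
  exact X.cyc_asymm _ _ _ (X.cyc_rotate _ _ _ h) (X.cyc_rotate _ _ _ h)

theorem cyc_ne₂ {x y z : X.V} (h : X.cyc x y z) : y ≠ z := cyc_ne₁ (X.cyc_rotate _ _ _ h)

theorem cyc_ne₃ {x y z : X.V} (h : X.cyc x y z) : x ≠ z := (cyc_ne₁ (cyc_rotate₂ h)).symm

/-- A disk with vertices on both sides of a division has a side that enters a given part. -/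
theorem exists_entry (χ : X.V → Bool) {a z : X.C} (hd : X.disk a = X.disk z)
    (h : χ (X.tgt a) ≠ χ (X.src z)) :
    ∃ c, X.disk c = X.disk z ∧ χ (X.src c) = χ (X.tgt a) ∧ χ (X.tgt c) ≠ χ (X.tgt a) := by
  have h0 := X.circle a z hd
  have key : ∀ y, Relation.TransGen X.Next a y → X.disk y = X.disk z →
      χ (X.tgt a) ≠ χ (X.src y) →
      ∃ c, X.disk c = X.disk z ∧ χ (X.src c) = χ (X.tgt a) ∧ χ (X.tgt c) ≠ χ (X.tgt a) := by
    intro y hy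
    induction hy with
    | single h => intro _ h'; exact absurd (congrArg χ h.2) h'
    | @tail b c hb hbc ih =>
      intro hc h'
      by_cases h1 : χ (X.tgt a) = χ (X.src b)
      · refine ⟨b, hbc.1.trans hc, h1.symm, ?_⟩
        rw [hbc.2]
        exact fun h2 => h' h2.symm
      · exact ih (hbc.1.trans hc) h1
  exact key z h0 rfl h

/-- Every edge joining two vertices is covered by a side. -/
theorem exists_side {e : X.E} {v w : X.V} (h : X.ends e = s(v, w)) :
    ∃ c, X.edge c = e ∧ (X.src c = v ∧ X.tgt c = w ∨ X.src c = w ∧ X.tgt c = v) := by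
  obtain ⟨c, rfl⟩ := X.edge_surj e
  rw [X.ends_edge] at h
  refine ⟨c, rfl, ?_⟩
  simpa using h

/-- The graph of a vertex `q`: the link of `q`.  Its vertices are the edges of `Δ` at `q`, and its
edges are the corners of disks at `q`, a corner being a pair of consecutive sides of a disk, the first
ending at `q` and the second starting at `q`.  The boundary orientation of the rest of the
disk runs from the first side to the second one. -/
def vertexGraph (X : FilmSurface S) (q : X.V) : ColoredGraph S where
  V := {e : X.E // q ∈ X.ends e}
  E := {p : X.C × X.C // X.disk p.1 = X.disk p.2 ∧ X.tgt p.1 = q ∧ X.src p.2 = q}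
  finV := by have := X.finE; infer_instance
  finE := by have := X.finC; infer_instance
  nonemptyE := by
    obtain ⟨c, hc⟩ := X.src_surj q
    obtain ⟨c', h⟩ := exists_prev c
    exact ⟨⟨(c', c), h.1, h.2.trans hc, hc⟩⟩
  src p := ⟨X.edge p.1.1, by rw [X.ends_edge, p.2.2.1]; simp⟩
  tgt p := ⟨X.edge p.1.2, by rw [X.ends_edge, p.2.2.2]; simp⟩
  color p := X.color (X.disk p.1.1)
  src_ne_tgt := by
    rintro ⟨⟨c', c⟩, h1, h2, h3⟩ h
    have h : X.edge c' = X.edge c := congrArg Subtype.val h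
    have h4 : c' = c := X.edge_inj _ _ h1 h
    exact src_ne_tgt c (h3.trans (h4 ▸ h2.symm))
  color_injective := by
    rintro ⟨⟨c, c'⟩, h1, h2, h3⟩ ⟨⟨d, d'⟩, k1, k2, k3⟩ h
    have hd : X.disk c' = X.disk d' := by
      apply X.color_inj
      · simp only at h3 k3
        rw [h3, k3]
        exact joined_refl _
      · simp only at h1 k1 h
        rw [← h1, ← k1, h]
    have e1 : c' = d' := X.src_inj _ _ hd (h3.trans k3.symm)
    have e2 : c = d := X.tgt_inj _ _ (h1.trans (hd.trans k1.symm)) (h2.trans k2.symm)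
    subst e1 e2
    rfl
  connected := by
    classical
    have hcomp : X.Compatible (fun v => decide (v = q)) := by
      intro a b a' b' h1 h2 h3 h4 h5
      simp only [decide_eq_decide, ne_eq] at h1 h2 h3
      have k1 : a ≠ a' := cyc_ne₃ h4
      have k2 : b ≠ b' := fun h => X.cyc_asymm _ _ _ h4 (h ▸ h5)
      grind
    have hcut := (X.cyclic _ hcomp).graph_connected
    have hcross : ∀ e, X.Crosses (fun v => decide (v = q)) e ↔ q ∈ X.ends e := by
      intro e
      constructor
      · rintro ⟨v, w, h, h'⟩
        rw [h]
        simp only [ne_eq, decide_eq_decide, Sym2.mem_iff] at h' ⊢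
        grind
      · intro h
        obtain ⟨w, h⟩ := Sym2.mem_iff_exists.1 h
        refine ⟨q, w, h, ?_⟩
        have := X.ends_not_isDiag e
        rw [h] at this
        simp only [Sym2.mk_isDiag_iff] at this
        simp [Ne.symm this]
    rintro ⟨e, he⟩ ⟨e', he'⟩
    have hj : ∀ v ∈ X.ends e, X.Joined v q := by
      intro v hv
      obtain ⟨w, h⟩ := Sym2.mem_iff_exists.1 he
      rw [h] at hv
      rcases Sym2.mem_iff.1 hv with rfl | rfl
      · exact joined_refl _
      · exact Joined.symm (.rel _ _ ⟨e, h⟩)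
    have hj' : ∀ v ∈ X.ends e', X.Joined v q := by
      intro v hv
      obtain ⟨w, h⟩ := Sym2.mem_iff_exists.1 he'
      rw [h] at hv
      rcases Sym2.mem_iff.1 hv with rfl | rfl
      · exact joined_refl _
      · exact Joined.symm (.rel _ _ ⟨e', h⟩)
    have h := hcut e e' ((hcross e).2 he) ((hcross e').2 he')
      (fun v hv w hw => Joined.trans (hj v hv) (Joined.symm (hj' w hw)))
    let k : X.E → {e : X.E // q ∈ X.ends e} := fun a => if ha : q ∈ X.ends a then ⟨a, ha⟩ else ⟨e, he⟩
    have hk : ∀ a (ha : q ∈ X.ends a), k a = ⟨a, ha⟩ := fun a ha => dif_pos ha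
    rw [← hk e he, ← hk e' he']
    refine eqvGen_lift k (fun a b hab => ?_) h
    obtain ⟨h1, h2, c, c', hd, hc, hc'⟩ := hab
    rw [hcross] at h1 h2
    rw [hk a h1, hk b h2]
    by_cases hcc : c = c'
    · subst hcc hc hc'
      exact .refl _
    subst hc hc'
    rw [X.ends_edge, Sym2.mem_iff] at h1 h2
    have hs : ¬ (q = X.src c ∧ q = X.src c') := fun h => hcc (X.src_inj _ _ hd (h.1.symm.trans h.2))
    have ht : ¬ (q = X.tgt c ∧ q = X.tgt c') := fun h => hcc (X.tgt_inj _ _ hd (h.1.symm.trans h.2))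
    rcases h1 with h1 | h1
    · have h3 : q = X.tgt c' := by tauto
      exact .symm _ _ (.rel _ _ ⟨⟨(c', c), hd.symm, h3.symm, h1.symm⟩, rfl, rfl⟩)
    · have h3 : q = X.src c' := by tauto
      exact .rel _ _ ⟨⟨(c, c'), hd, h1.symm, h3.symm⟩, rfl, rfl⟩

/-- The class in `Σ` of the graph of the vertex `q`. -/
def cls (X : FilmSurface S) (q : X.V) : GraphClass S :=
  Quotient.mk (ColoredGraph.setoid S) (X.vertexGraph q)

/-- Homeomorphisms of film surfaces, up to isotopy: bijections of the cells that preserve the gluing,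
the orientations of the disks, the colors and the cyclic orders. -/
structure Iso (X Y : FilmSurface S) where
  onV : X.V ≃ Y.V
  onE : X.E ≃ Y.E
  onD : X.D ≃ Y.D
  onC : X.C ≃ Y.C
  map_ends : ∀ e, Y.ends (onE e) = (X.ends e).map onV
  map_disk : ∀ c, Y.disk (onC c) = onD (X.disk c)
  map_edge : ∀ c, Y.edge (onC c) = onE (X.edge c)
  map_src : ∀ c, Y.src (onC c) = onV (X.src c)
  map_tgt : ∀ c, Y.tgt (onC c) = onV (X.tgt c)
  map_color : ∀ d, Y.color (onD d) = X.color d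
  map_cyc : ∀ x y z, Y.cyc (onV x) (onV y) (onV z) ↔ X.cyc x y z

/-- An isomorphism carries vertex graphs to isomorphic vertex graphs. -/
theorem Iso.cls_eq {X Y : FilmSurface S} (φ : Iso X Y) (q : X.V) : Y.cls (φ.onV q) = X.cls q := by
  symm
  apply Quotient.sound
  have hm : ∀ e, φ.onV q ∈ Y.ends (φ.onE e) ↔ q ∈ X.ends e := by
    intro e
    rw [φ.map_ends, Sym2.mem_map]
    simp
  refine ColoredGraph.equiv_of_map
    (G := X.vertexGraph q) (H := Y.vertexGraph (φ.onV q))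
    (fun e => ⟨φ.onE e.1, (hm _).2 e.2⟩)
    (fun p => ⟨(φ.onC p.1.1, φ.onC p.1.2), by
      rw [φ.map_disk, φ.map_disk, p.2.1], by
      rw [φ.map_tgt, p.2.2.1], by
      rw [φ.map_src, p.2.2.2]⟩)
    ⟨?_, ?_⟩ ?_ ?_ ?_ ?_
  · rintro ⟨e, he⟩ ⟨e', he'⟩ h
    have h : φ.onE e = φ.onE e' := congrArg Subtype.val h
    exact Subtype.ext (φ.onE.injective h)
  · rintro ⟨e, he⟩
    obtain ⟨e, rfl⟩ := φ.onE.surjective e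
    exact ⟨⟨e, (hm _).1 he⟩, rfl⟩
  · rintro ⟨⟨c, c'⟩, h1, h2, h3⟩
    obtain ⟨c, rfl⟩ := φ.onC.surjective c
    obtain ⟨c', rfl⟩ := φ.onC.surjective c'
    simp only [φ.map_disk, φ.map_tgt, φ.map_src, EmbeddingLike.apply_eq_iff_eq] at h1 h2 h3
    exact ⟨⟨(c, c'), h1, h2, h3⟩, rfl⟩
  · intro p
    exact Subtype.ext (φ.map_edge _).symm
  · intro p
    exact Subtype.ext (φ.map_edge _).symm
  · intro p
    change Y.color (Y.disk (φ.onC p.1.1)) = X.color (X.disk p.1.1)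
    rw [φ.map_disk, φ.map_color]

/-- The cells of the disjoint union of two film surfaces. -/
def unionData (X Y : FilmSurface S) : SurfaceData S where
  V := X.V ⊕ Y.V
  E := X.E ⊕ Y.E
  D := X.D ⊕ Y.D
  C := X.C ⊕ Y.C
  ends := Sum.elim (fun e => (X.ends e).map Sum.inl) (fun e => (Y.ends e).map Sum.inr)
  disk := Sum.map X.disk Y.disk
  edge := Sum.map X.edge Y.edge
  src := Sum.map X.src Y.src
  tgt := Sum.map X.tgt Y.tgt
  color := Sum.elim X.color Y.color
  cyc
    | .inl x, .inl y, .inl z => X.cyc x y z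
    | .inr x, .inr y, .inr z => Y.cyc x y z
    | _, _, _ => False

section union

variable (X Y : FilmSurface S)

theorem ends_exists (e : X.E) : ∃ v w, X.ends e = s(v, w) := by
  induction h : X.ends e using Sym2.ind with
  | _ v w => exact ⟨v, w, rfl⟩

theorem union_adj_side {v w} (h : ∃ e, (unionData X Y).ends e = s(v, w)) :
    (∃ a b, v = .inl a ∧ w = .inl b ∧ ∃ e, X.ends e = s(a, b)) ∨
      (∃ a b, v = .inr a ∧ w = .inr b ∧ ∃ e, Y.ends e = s(a, b)) := by
  obtain ⟨e | e, he⟩ := h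
  · left
    obtain ⟨a, b, h⟩ := ends_exists X e
    simp only [unionData, Sum.elim_inl, h, Sym2.map_mk] at he
    rcases Sym2.eq_iff.1 he with ⟨rfl, rfl⟩ | ⟨rfl, rfl⟩
    · exact ⟨a, b, rfl, rfl, e, h⟩
    · exact ⟨b, a, rfl, rfl, e, by rw [h, Sym2.eq_swap]⟩
  · right
    obtain ⟨a, b, h⟩ := ends_exists Y e
    simp only [unionData, Sum.elim_inr, h, Sym2.map_mk] at he
    rcases Sym2.eq_iff.1 he with ⟨rfl, rfl⟩ | ⟨rfl, rfl⟩
    · exact ⟨a, b, rfl, rfl, e, h⟩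
    · exact ⟨b, a, rfl, rfl, e, by rw [h, Sym2.eq_swap]⟩

theorem union_joined {v w} (h : (unionData X Y).Joined v w) :
    (∃ a b, v = .inl a ∧ w = .inl b ∧ X.Joined a b) ∨
      (∃ a b, v = .inr a ∧ w = .inr b ∧ Y.Joined a b) := by
  induction h with
  | rel v w h =>
    rcases union_adj_side X Y h with ⟨a, b, rfl, rfl, hj⟩ | ⟨a, b, rfl, rfl, hj⟩
    · exact .inl ⟨a, b, rfl, rfl, .rel _ _ hj⟩
    · exact .inr ⟨a, b, rfl, rfl, .rel _ _ hj⟩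
  | refl v =>
    rcases v with v | v
    · exact .inl ⟨v, v, rfl, rfl, .refl _⟩
    · exact .inr ⟨v, v, rfl, rfl, .refl _⟩
  | symm v w _ ih =>
    rcases ih with ⟨a, b, rfl, rfl, hj⟩ | ⟨a, b, rfl, rfl, hj⟩
    · exact .inl ⟨b, a, rfl, rfl, hj.symm⟩
    · exact .inr ⟨b, a, rfl, rfl, hj.symm⟩
  | trans u v w _ _ ih1 ih2 =>
    rcases ih1 with ⟨a, b, rfl, rfl, hj⟩ | ⟨a, b, rfl, rfl, hj⟩
    · rcases ih2 with ⟨c, d, h1, rfl, h'⟩ | ⟨c, d, h1, rfl, h'⟩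
      · cases h1
        exact .inl ⟨_, _, rfl, rfl, Joined.trans hj h'⟩
      · cases h1
    · rcases ih2 with ⟨c, d, h1, rfl, h'⟩ | ⟨c, d, h1, rfl, h'⟩
      · cases h1
      · cases h1
        exact .inr ⟨_, _, rfl, rfl, Joined.trans hj h'⟩

theorem union_joined_inl {a b} : (unionData X Y).Joined (.inl a) (.inl b) ↔ X.Joined a b := by
  constructor
  · intro h
    rcases union_joined X Y h with ⟨_, _, h1, h2, h⟩ | ⟨_, _, h1, h2, h⟩
    · cases h1; cases h2; exact h
    · cases h1
  · exact eqvGen_lift _ fun a b ⟨e, he⟩ => .rel _ _ ⟨.inl e, by simp [unionData, he]⟩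

theorem union_joined_inr {a b} : (unionData X Y).Joined (.inr a) (.inr b) ↔ Y.Joined a b := by
  constructor
  · intro h
    rcases union_joined X Y h with ⟨_, _, h1, h2, h⟩ | ⟨_, _, h1, h2, h⟩
    · cases h1
    · cases h1; cases h2; exact h
  · exact eqvGen_lift _ fun a b ⟨e, he⟩ => .rel _ _ ⟨.inr e, by simp [unionData, he]⟩

theorem union_not_joined {a b} : ¬ (unionData X Y).Joined (.inl a) (.inr b) := by
  intro h
  rcases union_joined X Y h with ⟨_, _, h1, h2, h⟩ | ⟨_, _, h1, h2, h⟩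
  · cases h2
  · cases h1

theorem union_not_joined' {a b} : ¬ (unionData X Y).Joined (.inr a) (.inl b) := fun h =>
  union_not_joined X Y (Relation.EqvGen.symm _ _ h)

theorem union_crosses_inl {χ : (unionData X Y).V → Bool} {e : X.E} :
    (unionData X Y).Crosses χ (.inl e) ↔ X.Crosses (fun v => χ (.inl v)) e := by
  constructor
  · rintro ⟨v, w, h, h'⟩
    obtain ⟨a, b, hab⟩ := ends_exists X e
    simp only [unionData, Sum.elim_inl, hab, Sym2.map_mk] at h
    rcases Sym2.eq_iff.1 h with ⟨rfl, rfl⟩ | ⟨rfl, rfl⟩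
    · exact ⟨a, b, hab, h'⟩
    · exact ⟨a, b, hab, h'.symm⟩
  · rintro ⟨a, b, hab, h⟩
    exact ⟨.inl a, .inl b, by simp [unionData, hab], h⟩

theorem union_crosses_inr {χ : (unionData X Y).V → Bool} {e : Y.E} :
    (unionData X Y).Crosses χ (.inr e) ↔ Y.Crosses (fun v => χ (.inr v)) e := by
  constructor
  · rintro ⟨v, w, h, h'⟩
    obtain ⟨a, b, hab⟩ := ends_exists Y e
    simp only [unionData, Sum.elim_inr, hab, Sym2.map_mk] at h
    rcases Sym2.eq_iff.1 h with ⟨rfl, rfl⟩ | ⟨rfl, rfl⟩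
    · exact ⟨a, b, hab, h'⟩
    · exact ⟨a, b, hab, h'.symm⟩
  · rintro ⟨a, b, hab, h⟩
    exact ⟨.inr a, .inr b, by simp [unionData, hab], h⟩

theorem union_cyclic (χ : (unionData X Y).V → Bool) (hχ : (unionData X Y).Compatible χ) :
    (unionData X Y).IsGraphCut χ := by
  have hX := X.cyclic (fun v => χ (.inl v))
    (fun a b a' b' h1 h2 h3 => hχ (.inl a) (.inl b) (.inl a') (.inl b') h1 h2 h3)
  have hY := Y.cyclic (fun v => χ (.inr v))
    (fun a b a' b' h1 h2 h3 => hχ (.inr a) (.inr b) (.inr a') (.inr b') h1 h2 h3)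
  constructor
  · rintro (e | e) (e' | e') h1 h2 h3
    · rw [union_crosses_inl] at h1 h2
      refine eqvGen_lift Sum.inl ?_ (hX.graph_connected e e' h1 h2 ?_)
      · rintro a b ⟨k1, k2, c, c', k3, rfl, rfl⟩
        exact .rel _ _ ⟨(union_crosses_inl X Y).2 k1, (union_crosses_inl X Y).2 k2, .inl c, .inl c',
          congrArg Sum.inl k3, rfl, rfl⟩
      · intro v hv w hw
        exact (union_joined_inl X Y).1 (h3 (.inl v) (Sym2.mem_map.2 ⟨v, hv, rfl⟩) (.inl w)
          (Sym2.mem_map.2 ⟨w, hw, rfl⟩))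
    · obtain ⟨a, b, hab⟩ := ends_exists X e
      obtain ⟨a', b', hab'⟩ := ends_exists Y e'
      exact absurd (h3 (.inl a) (Sym2.mem_map.2 ⟨a, by simp [hab], rfl⟩) (.inr a')
          (Sym2.mem_map.2 ⟨a', by simp [hab'], rfl⟩))
        (union_not_joined X Y)
    · obtain ⟨a, b, hab⟩ := ends_exists Y e
      obtain ⟨a', b', hab'⟩ := ends_exists X e'
      exact absurd (h3 (.inr a) (Sym2.mem_map.2 ⟨a, by simp [hab], rfl⟩) (.inl a')
          (Sym2.mem_map.2 ⟨a', by simp [hab'], rfl⟩))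
        (union_not_joined' X Y)
    · rw [union_crosses_inr] at h1 h2
      refine eqvGen_lift Sum.inr ?_ (hY.graph_connected e e' h1 h2 ?_)
      · rintro a b ⟨k1, k2, c, c', k3, rfl, rfl⟩
        exact .rel _ _ ⟨(union_crosses_inr X Y).2 k1, (union_crosses_inr X Y).2 k2, .inr c, .inr c',
          congrArg Sum.inr k3, rfl, rfl⟩
      · intro v hv w hw
        exact (union_joined_inr X Y).1 (h3 (.inr v) (Sym2.mem_map.2 ⟨v, hv, rfl⟩) (.inr w)
          (Sym2.mem_map.2 ⟨w, hw, rfl⟩))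
  · intro v w h hvw
    rcases union_joined X Y h with ⟨a, b, rfl, rfl, hj⟩ | ⟨a, b, rfl, rfl, hj⟩
    · refine eqvGen_lift Sum.inl ?_ (hX.parts_connected a b hj hvw)
      rintro a b ⟨k1, k2, e, he⟩
      exact .rel _ _ ⟨k1, k2, .inl e, by simp [unionData, he]⟩
    · refine eqvGen_lift Sum.inr ?_ (hY.parts_connected a b hj hvw)
      rintro a b ⟨k1, k2, e, he⟩
      exact .rel _ _ ⟨k1, k2, .inr e, by simp [unionData, he]⟩

/-- The disjoint union of two film surfaces. -/
def union : FilmSurface S where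
  toSurfaceData := unionData X Y
  finV := by have := X.finV; have := Y.finV; exact inferInstanceAs (Finite (X.V ⊕ Y.V))
  finE := by have := X.finE; have := Y.finE; exact inferInstanceAs (Finite (X.E ⊕ Y.E))
  finD := by have := X.finD; have := Y.finD; exact inferInstanceAs (Finite (X.D ⊕ Y.D))
  finC := by have := X.finC; have := Y.finC; exact inferInstanceAs (Finite (X.C ⊕ Y.C))
  nonemptyV := by have := X.nonemptyV; exact inferInstanceAs (Nonempty (X.V ⊕ Y.V))
  ends_not_isDiag := by
    rintro (e | e)
    · have := X.ends_not_isDiag e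
      obtain ⟨a, b, hab⟩ := ends_exists X e
      simpa [unionData, hab] using this
    · have := Y.ends_not_isDiag e
      obtain ⟨a, b, hab⟩ := ends_exists Y e
      simpa [unionData, hab] using this
  ends_edge := by
    rintro (c | c) <;> simp [unionData, ends_edge]
  circle := by
    rintro (c | c) (c' | c') h
    · refine Relation.TransGen.lift (p := (unionData X Y).Next) Sum.inl (fun a b h => ?_) _ _
        (X.circle c c' (Sum.inl.inj h))
      exact ⟨congrArg Sum.inl h.1, congrArg Sum.inl h.2⟩
    · cases h
    · cases h
    · refine Relation.TransGen.lift (p := (unionData X Y).Next) Sum.inr (fun a b h => ?_) _ _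
        (Y.circle c c' (Sum.inr.inj h))
      exact ⟨congrArg Sum.inr h.1, congrArg Sum.inr h.2⟩
  src_inj := by
    rintro (c | c) (c' | c') h h'
    · exact congrArg Sum.inl (X.src_inj _ _ (Sum.inl.inj h) (Sum.inl.inj h'))
    · cases h
    · cases h
    · exact congrArg Sum.inr (Y.src_inj _ _ (Sum.inr.inj h) (Sum.inr.inj h'))
  tgt_inj := by
    rintro (c | c) (c' | c') h h'
    · exact congrArg Sum.inl (X.tgt_inj _ _ (Sum.inl.inj h) (Sum.inl.inj h'))
    · cases h
    · cases h
    · exact congrArg Sum.inr (Y.tgt_inj _ _ (Sum.inr.inj h) (Sum.inr.inj h'))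
  edge_inj := by
    rintro (c | c) (c' | c') h h'
    · exact congrArg Sum.inl (X.edge_inj _ _ (Sum.inl.inj h) (Sum.inl.inj h'))
    · cases h
    · cases h
    · exact congrArg Sum.inr (Y.edge_inj _ _ (Sum.inr.inj h) (Sum.inr.inj h'))
  disk_surj := Sum.map_surjective.2 ⟨X.disk_surj, Y.disk_surj⟩
  edge_surj := Sum.map_surjective.2 ⟨X.edge_surj, Y.edge_surj⟩
  src_surj := Sum.map_surjective.2 ⟨X.src_surj, Y.src_surj⟩
  cyc_rotate := by
    rintro (x | x) (y | y) (z | z) h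
    · exact X.cyc_rotate _ _ _ h
    · exact h.elim
    · exact h.elim
    · exact h.elim
    · exact h.elim
    · exact h.elim
    · exact h.elim
    · exact Y.cyc_rotate _ _ _ h
  cyc_asymm := by
    rintro (x | x) (y | y) (z | z) h
    · exact X.cyc_asymm _ _ _ h
    · exact h.elim
    · exact h.elim
    · exact h.elim
    · exact h.elim
    · exact h.elim
    · exact h.elim
    · exact Y.cyc_asymm _ _ _ h
  cyc_trans := by
    rintro (x | x) (y | y) (z | z) t h
    · rcases t with t | t
      · exact X.cyc_trans _ _ _ _ h
      · exact fun h => h.elim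
    · exact h.elim
    · exact h.elim
    · exact h.elim
    · exact h.elim
    · exact h.elim
    · exact h.elim
    · rcases t with t | t
      · exact fun h => h.elim
      · exact Y.cyc_trans _ _ _ _ h
  cyc_total := by
    intro x y z h1 h2 k1 k2 k3
    rcases union_joined X Y h1 with ⟨a, b, rfl, rfl, hj⟩ | ⟨a, b, rfl, rfl, hj⟩
    · rcases union_joined X Y h2 with ⟨b', c, h3, rfl, h'⟩ | ⟨b', c, h3, rfl, h'⟩
      · cases h3
        exact X.cyc_total a b c hj h' (fun h => k1 (congrArg _ h)) (fun h => k2 (congrArg _ h))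
          (fun h => k3 (congrArg _ h))
      · cases h3
    · rcases union_joined X Y h2 with ⟨b', c, h3, rfl, h'⟩ | ⟨b', c, h3, rfl, h'⟩
      · cases h3
      · cases h3
        exact Y.cyc_total a b c hj h' (fun h => k1 (congrArg _ h)) (fun h => k2 (congrArg _ h))
          (fun h => k3 (congrArg _ h))
  cyc_joined := by
    rintro (x | x) (y | y) (z | z) h
    · exact (union_joined_inl X Y).2 (X.cyc_joined _ _ _ h)
    · exact h.elim
    · exact h.elim
    · exact h.elim
    · exact h.elim
    · exact h.elim
    · exact h.elim
    · exact (union_joined_inr X Y).2 (Y.cyc_joined _ _ _ h)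
  cyc_disk := by
    rintro (c | c) (c' | c') h
    · exact X.cyc_disk c c' (Sum.inl.inj h)
    · cases h
    · cases h
    · exact Y.cyc_disk c c' (Sum.inr.inj h)
  color_inj := by
    rintro (c | c) (c' | c') h h'
    · exact congrArg Sum.inl (X.color_inj c c' ((union_joined_inl X Y).1 h) h')
    · exact absurd h (union_not_joined X Y)
    · exact absurd h (union_not_joined' X Y)
    · exact congrArg Sum.inr (Y.color_inj c c' ((union_joined_inr X Y).1 h) h')
  cyclic := union_cyclic X Y

theorem union_cls_inl (q : X.V) : (union X Y).cls (Sum.inl q) = X.cls q := by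
  symm
  apply Quotient.sound
  refine ColoredGraph.equiv_of_map
    (G := X.vertexGraph q) (H := (union X Y).vertexGraph (Sum.inl q))
    (fun e => ⟨.inl e.1, Sym2.mem_map.2 ⟨q, e.2, rfl⟩⟩)
    (fun p => ⟨(.inl p.1.1, .inl p.1.2), congrArg Sum.inl p.2.1, congrArg Sum.inl p.2.2.1,
      congrArg Sum.inl p.2.2.2⟩)
    ⟨?_, ?_⟩ ?_ (fun _ => rfl) (fun _ => rfl) (fun _ => rfl)
  · rintro ⟨e, he⟩ ⟨e', he'⟩ h
    exact Subtype.ext (Sum.inl.inj (congrArg Subtype.val h))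
  · rintro ⟨e | e, he⟩
    · obtain ⟨v, hv, h⟩ := Sym2.mem_map.1 he
      cases h
      exact ⟨⟨e, hv⟩, rfl⟩
    · obtain ⟨v, hv, h⟩ := Sym2.mem_map.1 he
      cases h
  · rintro ⟨⟨c | c, c' | c'⟩, h1, h2, h3⟩
    · exact ⟨⟨(c, c'), Sum.inl.inj h1, Sum.inl.inj h2, Sum.inl.inj h3⟩, rfl⟩
    · cases h1
    · cases h1
    · cases h2

theorem union_cls_inr (q : Y.V) : (union X Y).cls (Sum.inr q) = Y.cls q := by
  symm
  apply Quotient.sound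
  refine ColoredGraph.equiv_of_map
    (G := Y.vertexGraph q) (H := (union X Y).vertexGraph (Sum.inr q))
    (fun e => ⟨.inr e.1, Sym2.mem_map.2 ⟨q, e.2, rfl⟩⟩)
    (fun p => ⟨(.inr p.1.1, .inr p.1.2), congrArg Sum.inr p.2.1, congrArg Sum.inr p.2.2.1,
      congrArg Sum.inr p.2.2.2⟩)
    ⟨?_, ?_⟩ ?_ (fun _ => rfl) (fun _ => rfl) (fun _ => rfl)
  · rintro ⟨e, he⟩ ⟨e', he'⟩ h
    exact Subtype.ext (Sum.inr.inj (congrArg Subtype.val h))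
  · rintro ⟨e | e, he⟩
    · obtain ⟨v, hv, h⟩ := Sym2.mem_map.1 he
      cases h
    · obtain ⟨v, hv, h⟩ := Sym2.mem_map.1 he
      cases h
      exact ⟨⟨e, hv⟩, rfl⟩
  · rintro ⟨⟨c | c, c' | c'⟩, h1, h2, h3⟩
    · cases h2
    · cases h1
    · cases h1
    · exact ⟨⟨(c, c'), Sum.inr.inj h1, Sum.inr.inj h2, Sum.inr.inj h3⟩, rfl⟩

end union

section cut

variable (X : FilmSurface S)

/-- A graph-cut of a connected film surface, up to isotopy: a division of the vertices into two
nonempty groups that is compatible with the cyclic order (in a film surface each such division is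
realized by a graph-cut, and the graph is determined by the division up to isotopy).  The value `true`
marks the `+` side and the value `false` the `-` side of the cut. -/
structure GraphCut where
  side : X.V → Bool
  side_surjective : Function.Surjective side
  compatible : X.Compatible side

variable {X}

namespace GraphCut

variable (γ : GraphCut X)

/-- The contraction of the part of the surface off the side `b` to the new vertex `q_b`. -/
def contract (b : Bool) (v : X.V) : X.V ⊕ Bool := if γ.side v = b then .inl v else .inr b

/-- The side of the cut on which a vertex lies after the cut. -/
def sideOf : X.V ⊕ Bool → Bool := Sum.elim γ.side id

/-- A vertex of `X` on the side `b`. -/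
noncomputable def rep (b : Bool) : X.V := (γ.side_surjective b).choose

theorem side_rep (b : Bool) : γ.side (γ.rep b) = b := (γ.side_surjective b).choose_spec

/-- Each new vertex `q_b` is placed in the cyclic order at the position of a contracted vertex. -/
noncomputable def place : X.V ⊕ Bool → X.V := Sum.elim id fun b => γ.rep (!b)

/-- The cells of the surface obtained by cutting along `γ` and contracting both copies
of `γ` to points.  Each edge and each side of a disk with an end on the side `b` gives an edge or a
side of the piece `b`, whose ends off the side `b` are replaced by `q_b`; each disk with a vertex on
the side `b` gives a disk of the piece `b`. -/
noncomputable def cutData : SurfaceData S where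
  V := X.V ⊕ Bool
  E := {p : X.E × Bool // ∃ v ∈ X.ends p.1, γ.side v = p.2}
  D := {p : X.D × Bool // ∃ c, X.disk c = p.1 ∧ γ.side (X.src c) = p.2}
  C := {p : X.C × Bool // γ.side (X.src p.1) = p.2 ∨ γ.side (X.tgt p.1) = p.2}
  ends p := (X.ends p.1.1).map (γ.contract p.1.2)
  disk p := ⟨(X.disk p.1.1, p.1.2), by
    rcases p.2 with h | h
    · exact ⟨p.1.1, rfl, h⟩
    · obtain ⟨c', h'⟩ := exists_next p.1.1
      exact ⟨c', h'.1.symm, h'.2 ▸ h⟩⟩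
  edge p := ⟨(X.edge p.1.1, p.1.2), by
    rcases p.2 with h | h
    · exact ⟨_, by rw [X.ends_edge]; simp, h⟩
    · exact ⟨_, by rw [X.ends_edge]; simp, h⟩⟩
  src p := γ.contract p.1.2 (X.src p.1.1)
  tgt p := γ.contract p.1.2 (X.tgt p.1.1)
  color p := X.color p.1.1
  cyc x y z := γ.sideOf x = γ.sideOf y ∧ γ.sideOf y = γ.sideOf z ∧
    X.cyc (γ.place x) (γ.place y) (γ.place z)

theorem contract_of_eq {b : Bool} {v : X.V} (h : γ.side v = b) : γ.contract b v = .inl v := if_pos h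

theorem contract_of_ne {b : Bool} {v : X.V} (h : γ.side v ≠ b) : γ.contract b v = .inr b := if_neg h

theorem sideOf_contract (b : Bool) (v : X.V) : γ.sideOf (γ.contract b v) = b := by
  by_cases h : γ.side v = b
  · rw [γ.contract_of_eq h]; exact h
  · rw [γ.contract_of_ne h]; rfl

theorem exists_contract (x : X.V ⊕ Bool) : ∃ v, γ.contract (γ.sideOf x) v = x := by
  rcases x with v | b
  · exact ⟨v, γ.contract_of_eq rfl⟩
  · refine ⟨γ.rep (!b), γ.contract_of_ne ?_⟩
    rw [side_rep]
    simp [sideOf]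

theorem place_inj {x y : X.V ⊕ Bool} (h : γ.sideOf x = γ.sideOf y) (h' : γ.place x = γ.place y) :
    x = y := by
  rcases x with v | b <;> rcases y with w | c
  · exact congrArg _ h'
  · exfalso
    have h2 := congrArg γ.side h'
    simp only [sideOf, place, Sum.elim_inl, Sum.elim_inr, id, side_rep] at h h2
    rw [h] at h2
    simp at h2
  · exfalso
    have h2 := congrArg γ.side h'
    simp only [sideOf, place, Sum.elim_inl, Sum.elim_inr, id, side_rep] at h h2
    rw [h] at h2
    simp at h2
  · exact congrArg _ h

/-- Four vertices in cyclic order do not alternate between the sides. -/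
theorem no_cross {a b a' b' : X.V} (h1 : γ.side a = γ.side a') (h2 : γ.side b = γ.side b')
    (h3 : γ.side a ≠ γ.side b) (h4 : X.cyc a b a') (h5 : X.cyc a' b' a) : False :=
  γ.compatible a b a' b' h1 h2 h3 h4 h5

theorem cyc_move (hX : X.Connected) {x r y z : X.V} (h1 : γ.side x = γ.side r)
    (h2 : γ.side y = γ.side z)
    (h3 : γ.side x ≠ γ.side y) (h : X.cyc r y z) : X.cyc x y z := by
  have hxy : x ≠ y := fun h => h3 (congrArg _ h)
  have hxz : x ≠ z := fun h => h3 ((congrArg _ h).trans h2.symm)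
  rcases X.cyc_total x y z (hX _ _) (hX _ _) hxy (cyc_ne₂ h) hxz with h' | h'
  · exact h'
  · -- `z, r, y` and `y, x, z`
    exact (γ.no_cross (a := z) (b := r) (a' := y) (b' := x) h2.symm h1.symm
      (by rw [← h1, ← h2]; exact h3.symm) (cyc_rotate₂ h) (X.cyc_rotate _ _ _ h')).elim

theorem side_of_place_contract {b : Bool} {x : X.V} :
    γ.side (γ.place (γ.contract b x)) = γ.side x := by
  by_cases h : γ.side x = b
  · rw [γ.contract_of_eq h]; rfl
  · rw [γ.contract_of_ne h]
    simp only [place, Sum.elim_inr, side_rep]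
    cases b <;> cases hx : γ.side x <;> simp_all

/-- The order of contracted vertices comes from the order of the vertices. -/
theorem cyc_of_contract (hX : X.Connected) {b : Bool} {x y z : X.V}
    (h : X.cyc (γ.place (γ.contract b x)) (γ.place (γ.contract b y)) (γ.place (γ.contract b z))) :
    X.cyc x y z := by
  have hx := γ.side_of_place_contract (b := b) (x := x)
  have hy := γ.side_of_place_contract (b := b) (x := y)
  have hz := γ.side_of_place_contract (b := b) (x := z)
  have key : ∀ {u v : X.V}, γ.side u ≠ b → γ.side v ≠ b → γ.contract b u = γ.contract b v :=
    fun hu hv => by rw [γ.contract_of_ne hu, γ.contract_of_ne hv]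
  by_cases h1 : γ.side x = b
  · by_cases h2 : γ.side y = b
    · by_cases h3 : γ.side z = b
      · rwa [γ.contract_of_eq h1, γ.contract_of_eq h2, γ.contract_of_eq h3] at h
      · have h' := cyc_rotate₂ h
        rw [γ.contract_of_eq h1, γ.contract_of_eq h2] at h'
        refine X.cyc_rotate _ _ _ (γ.cyc_move hX hz.symm (h1.trans h2.symm) ?_ h')
        rw [h1]; exact h3
    · by_cases h3 : γ.side z = b
      · have h' := X.cyc_rotate _ _ _ h
        rw [γ.contract_of_eq h1, γ.contract_of_eq h3] at h'
        refine cyc_rotate₂ (γ.cyc_move hX hy.symm (h3.trans h1.symm) ?_ h')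
        rw [h3]; exact h2
      · exact absurd (congrArg γ.place (key h2 h3)) (cyc_ne₂ h)
  · by_cases h2 : γ.side y = b
    · by_cases h3 : γ.side z = b
      · rw [γ.contract_of_eq h2, γ.contract_of_eq h3] at h
        refine γ.cyc_move hX hx.symm (h2.trans h3.symm) ?_ h
        rw [h2]; exact h1
      · exact absurd (congrArg γ.place (key h1 h3)) (cyc_ne₃ h)
    · exact absurd (congrArg γ.place (key h1 h2)) (cyc_ne₁ h)

theorem contract_cyc (hX : X.Connected) {b : Bool} {x y z : X.V} (h : X.cyc x y z)
    (h1 : γ.contract b x ≠ γ.contract b y) (h2 : γ.contract b y ≠ γ.contract b z)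
    (h3 : γ.contract b x ≠ γ.contract b z) :
    γ.cutData.cyc (γ.contract b x) (γ.contract b y) (γ.contract b z) := by
  have hs : ∀ u v, γ.sideOf (γ.contract b u) = γ.sideOf (γ.contract b v) := fun u v => by
    rw [sideOf_contract, sideOf_contract]
  refine ⟨hs _ _, hs _ _, ?_⟩
  rcases X.cyc_total _ _ _ (hX _ _) (hX _ _)
    (fun h => h1 (γ.place_inj (hs _ _) h)) (fun h => h2 (γ.place_inj (hs _ _) h))
    (fun h => h3 (γ.place_inj (hs _ _) h)) with h' | h'
  · exact h'
  · exact absurd (γ.cyc_of_contract hX h') (X.cyc_asymm _ _ _ h)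

theorem joined_contract (b : Bool) {v w : X.V} (h : X.Joined v w) :
    γ.cutData.Joined (γ.contract b v) (γ.contract b w) := by
  refine eqvGen_lift (γ.contract b) (fun v w hvw => ?_) h
  obtain ⟨e, he⟩ := hvw
  by_cases h1 : ∃ u ∈ X.ends e, γ.side u = b
  · refine .rel _ _ ⟨⟨(e, b), h1⟩, ?_⟩
    change (X.ends e).map _ = _
    rw [he]; rfl
  · push Not at h1
    rw [γ.contract_of_ne (h1 v (by rw [he]; simp)), γ.contract_of_ne (h1 w (by rw [he]; simp))]
    exact .refl _

theorem sideOf_joined {x y : X.V ⊕ Bool} (h : γ.cutData.Joined x y) : γ.sideOf x = γ.sideOf y := by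
  induction h with
  | rel x y h =>
    obtain ⟨⟨⟨e, b⟩, he⟩, h⟩ := h
    obtain ⟨v, w, hvw⟩ := ends_exists X e
    replace h : (X.ends e).map (γ.contract b) = s(x, y) := h
    rw [hvw, Sym2.map_mk] at h
    rcases Sym2.eq_iff.1 h with ⟨rfl, rfl⟩ | ⟨rfl, rfl⟩ <;>
      rw [sideOf_contract, sideOf_contract]
  | refl x => rfl
  | symm x y _ ih => exact ih.symm
  | trans x y z _ _ ih1 ih2 => exact ih1.trans ih2

theorem joined_iff (hX : X.Connected) {x y : X.V ⊕ Bool} :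
    γ.cutData.Joined x y ↔ γ.sideOf x = γ.sideOf y := by
  refine ⟨γ.sideOf_joined, fun h => ?_⟩
  obtain ⟨v, hv⟩ := γ.exists_contract x
  obtain ⟨w, hw⟩ := γ.exists_contract y
  rw [← hv, ← hw, h]
  exact γ.joined_contract _ (hX _ _)

/-- Two sides of a disk that enter (or leave) the same side of the cut coincide. -/
theorem entry_unique (hX : X.Connected) {c c' : X.C} (h : X.disk c = X.disk c')
    (h1 : γ.side (X.src c) = γ.side (X.src c')) (h2 : γ.side (X.tgt c) = γ.side (X.tgt c'))
    (h3 : γ.side (X.src c) ≠ γ.side (X.tgt c)) : c = c' := by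
  by_contra hne
  have hs : X.src c ≠ X.src c' := fun h' => hne (X.src_inj _ _ h h')
  have k1 : X.src c' ≠ X.tgt c := fun h' => h3 (h1.trans (congrArg _ h'))
  have k2 : X.src c ≠ X.tgt c' := fun h' => h3 ((congrArg _ h').trans h2.symm)
  have e1 := (X.cyc_total (X.src c) (X.src c') (X.tgt c) (hX _ _) (hX _ _) hs k1
    (src_ne_tgt c)).resolve_left (X.cyc_disk _ _ h)
  have e2 := (X.cyc_total (X.src c') (X.src c) (X.tgt c') (hX _ _) (hX _ _) hs.symm k2
    (src_ne_tgt c')).resolve_left (X.cyc_disk _ _ h.symm)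
  exact γ.no_cross h1 h2 h3 (cyc_rotate₂ e1) (cyc_rotate₂ e2)

theorem circle_of_cyc (Y : SurfaceData S) [Finite Y.C] (hnext : ∀ c, ∃ c', Y.Next c c')
    (hne : ∀ c, Y.src c ≠ Y.tgt c)
    (hsrc : ∀ c c', Y.disk c = Y.disk c' → Y.src c = Y.src c' → c = c')
    (hrot : ∀ x y z, Y.cyc x y z → Y.cyc y z x)
    (hasymm : ∀ x y z, Y.cyc x y z → ¬ Y.cyc z y x)
    (htrans : ∀ x y z t, Y.cyc x y z → Y.cyc x z t → Y.cyc x y t)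
    (htotal : ∀ c c' c'', Y.disk c = Y.disk c' → Y.disk c' = Y.disk c'' → Y.src c ≠ Y.src c' →
      Y.src c' ≠ Y.src c'' → Y.src c ≠ Y.src c'' →
      Y.cyc (Y.src c) (Y.src c') (Y.src c'') ∨ Y.cyc (Y.src c'') (Y.src c') (Y.src c))
    (hdisk : ∀ c c', Y.disk c = Y.disk c' → ¬ Y.cyc (Y.src c) (Y.src c') (Y.tgt c))
    (c c' : Y.C) (h : Y.disk c = Y.disk c') : Relation.TransGen Y.Next c c' := by
  by_contra hc
  have hR : ∀ a, Relation.TransGen Y.Next c a → Y.disk c = Y.disk a := by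
    intro a ha
    induction ha with
    | single h => exact h.1
    | tail _ h ih => exact ih.trans h.1
  let r : Y.C → Y.C → Prop := fun a b => Y.cyc (Y.src c') (Y.src b) (Y.src a)
  have : IsTrans Y.C r := ⟨fun a b d h1 h2 => htrans _ _ _ _ h2 h1⟩
  have : Std.Irrefl r := ⟨fun a h => hasymm _ _ _ (hrot _ _ _ h) (hrot _ _ _ (hrot _ _ _
    (hrot _ _ _ h)) |> fun h' => by
      have h1 := hrot _ _ _ h
      have h2 := hrot _ _ _ h1
      exact (hasymm _ _ _ h2 h2).elim)⟩
  have hwf : WellFounded r := Finite.wellFounded_of_trans_of_irrefl r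
  obtain ⟨a0, ha0⟩ := hnext c
  obtain ⟨m, hm, hmin⟩ := hwf.has_min {a | Relation.TransGen Y.Next c a} ⟨a0, .single ha0⟩
  obtain ⟨a, ha⟩ := hnext m
  have haR : Relation.TransGen Y.Next c a := .tail hm ha
  have hcm : Y.disk c' = Y.disk m := h.symm.trans (hR m hm)
  have n1 : Y.src c' ≠ Y.src m := fun h' => hc (by rwa [hsrc c' m hcm h'])
  have n2 : Y.src c' ≠ Y.src a := fun h' => hc (by rwa [hsrc c' a (hcm.trans ha.1) h'])
  have n3 : Y.src m ≠ Y.src a := by rw [← ha.2]; exact hne m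
  rcases htotal c' m a hcm ha.1 n1 n3 n2 with h1 | h1
  · exact hmin a haR h1
  · apply hdisk m c' hcm.symm
    rw [ha.2]
    exact hrot _ _ _ h1

theorem cut_next (c : γ.cutData.C) : ∃ c', γ.cutData.Next c c' := by
  obtain ⟨⟨c, b⟩, hc⟩ := c
  by_cases h : γ.side (X.tgt c) = b
  · obtain ⟨c', h'⟩ := exists_next c
    refine ⟨⟨(c', b), .inl (h'.2 ▸ h)⟩, Subtype.ext (Prod.ext h'.1 rfl), ?_⟩
    exact congrArg (γ.contract b) h'.2
  · have h1 : γ.side (X.src c) = b := hc.resolve_right h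
    obtain ⟨c', k1, k2, k3⟩ := exists_entry γ.side (a := c) (z := c) rfl (by rw [h1]; exact h)
    have k4 : γ.side (X.tgt c') = b := by
      generalize γ.side (X.tgt c') = u at *
      generalize γ.side (X.tgt c) = v at *
      revert h k3
      cases u <;> cases v <;> cases b <;> simp
    refine ⟨⟨(c', b), .inr k4⟩, Subtype.ext (Prod.ext k1.symm rfl), ?_⟩
    change γ.contract b (X.tgt c) = γ.contract b (X.src c')
    rw [γ.contract_of_ne h, γ.contract_of_ne (by rw [k2]; exact h)]

theorem cut_src_inj (hX : X.Connected) (c c' : γ.cutData.C)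
    (h : γ.cutData.disk c = γ.cutData.disk c') (h' : γ.cutData.src c = γ.cutData.src c') :
    c = c' := by
  obtain ⟨⟨c, b⟩, hc⟩ := c
  obtain ⟨⟨c', b'⟩, hc'⟩ := c'
  obtain ⟨h1, rfl⟩ := Prod.mk.inj (congrArg Subtype.val h)
  have h2 : c = c' := by
    replace h' : γ.contract b (X.src c) = γ.contract b (X.src c') := h'
    replace h1 : X.disk c = X.disk c' := h1
    replace hc : γ.side (X.src c) = b ∨ γ.side (X.tgt c) = b := hc
    replace hc' : γ.side (X.src c') = b ∨ γ.side (X.tgt c') = b := hc'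
    by_cases k : γ.side (X.src c) = b <;> by_cases k' : γ.side (X.src c') = b
    · rw [γ.contract_of_eq k, γ.contract_of_eq k'] at h'
      exact X.src_inj _ _ h1 (Sum.inl.inj h')
    · rw [γ.contract_of_eq k, γ.contract_of_ne k'] at h'
      cases h'
    · rw [γ.contract_of_ne k, γ.contract_of_eq k'] at h'
      cases h'
    · have e := hc.resolve_left k
      have e' := hc'.resolve_left k'
      refine γ.entry_unique hX h1 ?_ (e.trans e'.symm) (by rw [e]; exact k)
      rw [Bool.eq_not_of_ne k, Bool.eq_not_of_ne k']
  exact Subtype.ext (Prod.ext h2 rfl)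

theorem cut_tgt_inj (hX : X.Connected) (c c' : γ.cutData.C)
    (h : γ.cutData.disk c = γ.cutData.disk c') (h' : γ.cutData.tgt c = γ.cutData.tgt c') :
    c = c' := by
  obtain ⟨⟨c, b⟩, hc⟩ := c
  obtain ⟨⟨c', b'⟩, hc'⟩ := c'
  obtain ⟨h1, rfl⟩ := Prod.mk.inj (congrArg Subtype.val h)
  have h2 : c = c' := by
    replace h' : γ.contract b (X.tgt c) = γ.contract b (X.tgt c') := h'
    replace h1 : X.disk c = X.disk c' := h1
    replace hc : γ.side (X.src c) = b ∨ γ.side (X.tgt c) = b := hc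
    replace hc' : γ.side (X.src c') = b ∨ γ.side (X.tgt c') = b := hc'
    by_cases k : γ.side (X.tgt c) = b <;> by_cases k' : γ.side (X.tgt c') = b
    · rw [γ.contract_of_eq k, γ.contract_of_eq k'] at h'
      exact X.tgt_inj _ _ h1 (Sum.inl.inj h')
    · rw [γ.contract_of_eq k, γ.contract_of_ne k'] at h'
      cases h'
    · rw [γ.contract_of_ne k, γ.contract_of_eq k'] at h'
      cases h'
    · have e := hc.resolve_right k
      have e' := hc'.resolve_right k'
      refine γ.entry_unique hX h1 (e.trans e'.symm) ?_ (by rw [e]; exact fun h => k h.symm)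
      rw [Bool.eq_not_of_ne k, Bool.eq_not_of_ne k']
  exact Subtype.ext (Prod.ext h2 rfl)

theorem cut_src_ne_tgt (c : γ.cutData.C) : γ.cutData.src c ≠ γ.cutData.tgt c := by
  obtain ⟨⟨c, b⟩, hc⟩ := c
  change γ.contract b (X.src c) ≠ γ.contract b (X.tgt c)
  replace hc : γ.side (X.src c) = b ∨ γ.side (X.tgt c) = b := hc
  by_cases k : γ.side (X.src c) = b <;> by_cases k' : γ.side (X.tgt c) = b
  · rw [γ.contract_of_eq k, γ.contract_of_eq k']
    exact fun h => src_ne_tgt c (Sum.inl.inj h)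
  · rw [γ.contract_of_eq k, γ.contract_of_ne k']
    exact Sum.inl_ne_inr
  · rw [γ.contract_of_ne k, γ.contract_of_eq k']
    exact Sum.inr_ne_inl
  · exact absurd hc (by tauto)

theorem cut_ends_edge (c : γ.cutData.C) :
    γ.cutData.ends (γ.cutData.edge c) = s(γ.cutData.src c, γ.cutData.tgt c) := by
  change (X.ends (X.edge c.1.1)).map _ = _
  rw [X.ends_edge]
  rfl

theorem cut_edge_surj : Function.Surjective γ.cutData.edge := by
  rintro ⟨⟨e, b⟩, he⟩
  obtain ⟨c, rfl⟩ := X.edge_surj e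
  refine ⟨⟨(c, b), ?_⟩, rfl⟩
  obtain ⟨v, hv, h⟩ := he
  rw [X.ends_edge, Sym2.mem_iff] at hv
  rcases hv with rfl | rfl
  · exact .inl h
  · exact .inr h

theorem exists_entry_side (hX : X.Connected) (b : Bool) :
    ∃ c, γ.side (X.src c) ≠ b ∧ γ.side (X.tgt c) = b := by
  by_contra hno
  push Not at hno
  -- no side enters the part `b`, so no side leaves it either
  have hside : ∀ c, γ.side (X.src c) = γ.side (X.tgt c) := by
    intro c
    by_cases h1 : γ.side (X.src c) = b
    · by_contra h2
      obtain ⟨c', k1, k2, k3⟩ := exists_entry γ.side (a := c) (z := c) rfl (fun h => h2 h.symm)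
      have k4 : γ.side (X.tgt c) ≠ b := by rw [← h1]; exact fun h => h2 h.symm
      refine hno c' (by rw [k2]; exact k4) ?_
      rw [Bool.eq_not_of_ne k3, Bool.eq_not_of_ne k4, Bool.not_not]
    · rw [Bool.eq_not_of_ne h1, Bool.eq_not_of_ne (hno c h1)]
  have hconst : ∀ v w, X.Joined v w → γ.side v = γ.side w := by
    intro v w h
    induction h with
    | rel v w h =>
      obtain ⟨e, he⟩ := h
      obtain ⟨c, -, ⟨rfl, rfl⟩ | ⟨rfl, rfl⟩⟩ := exists_side he
      · exact hside c
      · exact (hside c).symm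
    | refl v => rfl
    | symm v w _ ih => exact ih.symm
    | trans u v w _ _ ih1 ih2 => exact ih1.trans ih2
  have := hconst (γ.rep true) (γ.rep false) (hX _ _)
  rw [side_rep, side_rep] at this
  cases this

theorem cut_src_surj (hX : X.Connected) : Function.Surjective γ.cutData.src := by
  rintro (v | b)
  · obtain ⟨c, rfl⟩ := X.src_surj v
    exact ⟨⟨(c, γ.side (X.src c)), .inl rfl⟩, γ.contract_of_eq rfl⟩
  · obtain ⟨c, h1, h2⟩ := γ.exists_entry_side hX b
    exact ⟨⟨(c, b), .inr h2⟩, γ.contract_of_ne h1⟩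

/-- A division of the vertices of a piece of the cut surface gives a division of the vertices
of the original surface. -/
theorem compatible_contract (hX : X.Connected) {χ : γ.cutData.V → Bool}
    (hχ : γ.cutData.Compatible χ) (b : Bool) :
    X.Compatible (fun v => χ (γ.contract b v)) := by
  intro a d a' d' h1 h2 h3 h4 h5
  have hne : ∀ {u v : X.V}, γ.side u ≠ b → γ.side v ≠ b → γ.contract b u = γ.contract b v :=
    fun hu hv => by rw [γ.contract_of_ne hu, γ.contract_of_ne hv]
  have heq : ∀ {u v : X.V}, u ≠ v → γ.contract b u = γ.contract b v →
      γ.side u ≠ b ∧ γ.side v ≠ b := by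
    intro u v huv h
    by_cases k : γ.side u = b <;> by_cases k' : γ.side v = b
    · rw [γ.contract_of_eq k, γ.contract_of_eq k'] at h
      exact absurd (Sum.inl.inj h) huv
    · rw [γ.contract_of_eq k, γ.contract_of_ne k'] at h
      cases h
    · rw [γ.contract_of_ne k, γ.contract_of_eq k'] at h
      cases h
    · exact ⟨k, k'⟩
  simp only at h1 h2 h3
  have c1 : γ.contract b a ≠ γ.contract b d := fun h => h3 (congrArg χ h)
  have c2 : γ.contract b d ≠ γ.contract b a' := fun h => h3 (h1.trans (congrArg χ h.symm))
  have c3 : γ.contract b a' ≠ γ.contract b d' := fun h => h3 (by rw [h1, h2]; exact congrArg χ h)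
  have c4 : γ.contract b d' ≠ γ.contract b a := fun h => h3 (by rw [h2]; exact congrArg χ h.symm)
  have c5 : γ.contract b a ≠ γ.contract b a' := by
    intro h
    obtain ⟨k1, k2⟩ := heq (cyc_ne₃ h4) h
    have k3 : γ.side d = b := by
      by_contra k
      exact c1 (hne k1 k)
    have k4 : γ.side d' = b := by
      by_contra k
      exact c4 (hne k k1)
    exact γ.no_cross (by rw [Bool.eq_not_of_ne k1, Bool.eq_not_of_ne k2]) (k3.trans k4.symm)
      (by rw [k3]; exact k1) h4 h5
  exact hχ _ _ _ _ h1 h2 h3 (γ.contract_cyc hX h4 c1 c2 c5) (γ.contract_cyc hX h5 c3 c4 c5.symm)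

theorem cut_cyclic (hX : X.Connected) (χ : γ.cutData.V → Bool) (hχ : γ.cutData.Compatible χ) :
    γ.cutData.IsGraphCut χ := by
  have hcut := fun b => X.cyclic _ (γ.compatible_contract hX hχ b)
  have hcross : ∀ e b he, γ.cutData.Crosses χ ⟨(e, b), he⟩ ↔
      X.Crosses (fun v => χ (γ.contract b v)) e := by
    intro e b he
    constructor
    · rintro ⟨x, y, h, h'⟩
      obtain ⟨v, w, hvw⟩ := ends_exists X e
      replace h : (X.ends e).map (γ.contract b) = s(x, y) := h
      rw [hvw, Sym2.map_mk] at h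
      rcases Sym2.eq_iff.1 h with ⟨rfl, rfl⟩ | ⟨rfl, rfl⟩
      · exact ⟨v, w, hvw, h'⟩
      · exact ⟨v, w, hvw, h'.symm⟩
    · rintro ⟨v, w, h, h'⟩
      refine ⟨γ.contract b v, γ.contract b w, ?_, h'⟩
      change (X.ends e).map (γ.contract b) = _
      rw [h]
      rfl
  have hmeet : ∀ e b, X.Crosses (fun v => χ (γ.contract b v)) e →
      ∃ v ∈ X.ends e, γ.side v = b := by
    rintro e b ⟨v, w, h, h'⟩
    by_contra hno
    push Not at hno
    apply h'
    simp only
    rw [γ.contract_of_ne (hno v (by rw [h]; simp)), γ.contract_of_ne (hno w (by rw [h]; simp))]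
  constructor
  · rintro ⟨⟨e, b⟩, he⟩ ⟨⟨e', b'⟩, he'⟩ h1 h2 h3
    have hbb : b = b' := by
      obtain ⟨v, hv, -⟩ := id he
      obtain ⟨w, hw, -⟩ := id he'
      have := γ.sideOf_joined (h3 (γ.contract b v) (Sym2.mem_map.2 ⟨v, hv, rfl⟩)
        (γ.contract b' w) (Sym2.mem_map.2 ⟨w, hw, rfl⟩))
      rwa [sideOf_contract, sideOf_contract] at this
    subst hbb
    rw [hcross] at h1 h2
    have h := (hcut b).graph_connected e e' h1 h2 (fun _ _ _ _ => hX _ _)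
    classical
    let k : X.E → γ.cutData.E := fun a =>
      if ha : ∃ v ∈ X.ends a, γ.side v = b then ⟨(a, b), ha⟩ else ⟨(e, b), he⟩
    have hk : ∀ a (ha : ∃ v ∈ X.ends a, γ.side v = b), k a = ⟨(a, b), ha⟩ := fun a ha => dif_pos ha
    rw [← hk e he, ← hk e' he']
    refine eqvGen_lift k (fun a a' haa => ?_) h
    obtain ⟨k1, k2, c, c', hd, rfl, rfl⟩ := haa
    have m1 := hmeet _ _ k1
    have m2 := hmeet _ _ k2
    rw [hk _ m1, hk _ m2]
    have hC : ∀ c, (∃ v ∈ X.ends (X.edge c), γ.side v = b) →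
        γ.side (X.src c) = b ∨ γ.side (X.tgt c) = b := by
      rintro c ⟨v, hv, h⟩
      rw [X.ends_edge, Sym2.mem_iff] at hv
      rcases hv with rfl | rfl
      · exact .inl h
      · exact .inr h
    exact .rel _ _ ⟨(hcross _ _ _).2 k1, (hcross _ _ _).2 k2, ⟨(c, b), hC c m1⟩, ⟨(c', b), hC c' m2⟩,
      Subtype.ext (Prod.ext hd rfl), rfl, rfl⟩
  · intro x y h hxy
    have hs := γ.sideOf_joined h
    obtain ⟨v, hv⟩ := γ.exists_contract x
    obtain ⟨w, hw⟩ := γ.exists_contract y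
    rw [← hs] at hw
    generalize γ.sideOf x = b at *
    subst hv hw
    refine eqvGen_lift (γ.contract b) ?_ ((hcut b).parts_connected v w (hX _ _) hxy)
    rintro u u' ⟨k1, k2, e, he⟩
    by_cases hm : ∃ t ∈ X.ends e, γ.side t = b
    · refine .rel _ _ ⟨k1, k2, ⟨(e, b), hm⟩, ?_⟩
      change (X.ends e).map _ = _
      rw [he]
      rfl
    · push Not at hm
      rw [γ.contract_of_ne (hm u (by rw [he]; simp)), γ.contract_of_ne (hm u' (by rw [he]; simp))]
      exact .refl _

theorem cut_cyc_disk (hX : X.Connected) (c c' : γ.cutData.C)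
    (h : γ.cutData.disk c = γ.cutData.disk c') :
    ¬ γ.cutData.cyc (γ.cutData.src c) (γ.cutData.src c') (γ.cutData.tgt c) := by
  obtain ⟨⟨c, b⟩, hc⟩ := c
  obtain ⟨⟨c', b'⟩, hc'⟩ := c'
  obtain ⟨h1, rfl⟩ := Prod.mk.inj (congrArg Subtype.val h)
  rintro ⟨-, -, h2⟩
  exact X.cyc_disk c c' h1 (γ.cyc_of_contract hX h2)

theorem cut_cyc_total (x y z : γ.cutData.V) (hX : X.Connected) (h1 : γ.sideOf x = γ.sideOf y)
    (h2 : γ.sideOf y = γ.sideOf z) (n1 : x ≠ y) (n2 : y ≠ z) (n3 : x ≠ z) :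
    γ.cutData.cyc x y z ∨ γ.cutData.cyc z y x := by
  rcases X.cyc_total (γ.place x) (γ.place y) (γ.place z) (hX _ _) (hX _ _)
    (fun h => n1 (γ.place_inj h1 h)) (fun h => n2 (γ.place_inj h2 h))
    (fun h => n3 (γ.place_inj (h1.trans h2) h)) with h | h
  · exact .inl ⟨h1, h2, h⟩
  · exact .inr ⟨h2.symm, h1.symm, h⟩

theorem cut_finC : Finite γ.cutData.C := by
  have := X.finC
  exact inferInstanceAs (Finite {p : X.C × Bool // γ.side (X.src p.1) = p.2 ∨ γ.side (X.tgt p.1) = p.2})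

theorem cut_sideOf_disk {c c' : γ.cutData.C} (h : γ.cutData.disk c = γ.cutData.disk c') :
    γ.sideOf (γ.cutData.src c) = γ.sideOf (γ.cutData.src c') := by
  change γ.sideOf (γ.contract _ _) = γ.sideOf (γ.contract _ _)
  rw [sideOf_contract, sideOf_contract]
  exact congrArg (fun d : γ.cutData.D => d.1.2) h

/-- The film surface obtained from a connected film surface by a cut along `γ` and the contraction of
the two copies of `γ` to the points `q_+` (on the `+` side) and `q_-` (on the `-` side). -/
noncomputable def cut (hX : X.Connected) : FilmSurface S where
  toSurfaceData := γ.cutData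
  finV := by have := X.finV; exact inferInstanceAs (Finite (X.V ⊕ Bool))
  finE := by
    have := X.finE
    exact inferInstanceAs (Finite {p : X.E × Bool // ∃ v ∈ X.ends p.1, γ.side v = p.2})
  finD := by
    have := X.finD
    exact inferInstanceAs
      (Finite {p : X.D × Bool // ∃ c, X.disk c = p.1 ∧ γ.side (X.src c) = p.2})
  finC := γ.cut_finC
  nonemptyV := ⟨(Sum.inr true : X.V ⊕ Bool)⟩
  ends_not_isDiag := by
    intro e
    obtain ⟨c, rfl⟩ := γ.cut_edge_surj e
    rw [γ.cut_ends_edge]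
    exact fun h => γ.cut_src_ne_tgt c (Sym2.mk_isDiag_iff.1 h)
  ends_edge := γ.cut_ends_edge
  circle := by
    have := γ.cut_finC
    refine circle_of_cyc γ.cutData γ.cut_next γ.cut_src_ne_tgt (γ.cut_src_inj hX) ?_ ?_ ?_ ?_
      (γ.cut_cyc_disk hX)
    · rintro x y z ⟨h1, h2, h3⟩
      exact ⟨h2, (h1.trans h2).symm, X.cyc_rotate _ _ _ h3⟩
    · rintro x y z ⟨h1, h2, h3⟩ ⟨-, -, h4⟩
      exact X.cyc_asymm _ _ _ h3 h4
    · rintro x y z t ⟨h1, h2, h3⟩ ⟨h4, h5, h6⟩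
      exact ⟨h1, h2.trans h5, X.cyc_trans _ _ _ _ h3 h6⟩
    · intro c c' c'' h h' n1 n2 n3
      exact γ.cut_cyc_total _ _ _ hX (γ.cut_sideOf_disk h) (γ.cut_sideOf_disk h') n1 n2 n3
  src_inj := γ.cut_src_inj hX
  tgt_inj := γ.cut_tgt_inj hX
  edge_inj := by
    rintro ⟨⟨c, b⟩, hc⟩ ⟨⟨c', b'⟩, hc'⟩ h h'
    obtain ⟨h1, rfl⟩ := Prod.mk.inj (congrArg Subtype.val h)
    obtain ⟨h2, -⟩ := Prod.mk.inj (congrArg Subtype.val h')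
    exact Subtype.ext (Prod.ext (X.edge_inj _ _ h1 h2) rfl)
  disk_surj := by
    rintro ⟨⟨d, b⟩, hd⟩
    obtain ⟨c, h, h'⟩ := id hd
    exact ⟨⟨(c, b), .inl h'⟩, Subtype.ext (Prod.ext h rfl)⟩
  edge_surj := γ.cut_edge_surj
  src_surj := γ.cut_src_surj hX
  cyc_rotate := by
    rintro x y z ⟨h1, h2, h3⟩
    exact ⟨h2, (h1.trans h2).symm, X.cyc_rotate _ _ _ h3⟩
  cyc_asymm := by
    rintro x y z ⟨h1, h2, h3⟩ ⟨-, -, h4⟩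
    exact X.cyc_asymm _ _ _ h3 h4
  cyc_trans := by
    rintro x y z t ⟨h1, h2, h3⟩ ⟨h4, h5, h6⟩
    exact ⟨h1, h2.trans h5, X.cyc_trans _ _ _ _ h3 h6⟩
  cyc_total := fun x y z h1 h2 => γ.cut_cyc_total x y z hX (γ.sideOf_joined h1) (γ.sideOf_joined h2)
  cyc_joined := fun x y z h => (γ.joined_iff hX).2 h.1
  cyc_disk := γ.cut_cyc_disk hX
  color_inj := by
    rintro ⟨⟨c, b⟩, hc⟩ ⟨⟨c', b'⟩, hc'⟩ h h'
    have hb := γ.sideOf_joined h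
    change γ.sideOf (γ.contract _ _) = γ.sideOf (γ.contract _ _) at hb
    rw [sideOf_contract, sideOf_contract] at hb
    exact Subtype.ext (Prod.ext (X.color_inj c c' (hX _ _) h') hb)
  cyclic := γ.cut_cyclic hX

/-- The vertices of the original surface keep their vertex graphs. -/
theorem cut_cls_inl (hX : X.Connected) (q : X.V) :
    (γ.cut hX).cls (Sum.inl q) = X.cls q := by
  symm
  apply Quotient.sound
  have hmem : ∀ (v : X.V) (b : Bool), γ.contract b v = Sum.inl q ↔ v = q ∧ γ.side v = b := by
    intro v b
    by_cases h : γ.side v = b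
    · rw [γ.contract_of_eq h]
      simp [h]
    · rw [γ.contract_of_ne h]
      simp [h]
  refine ColoredGraph.equiv_of_map
    (G := X.vertexGraph q) (H := (γ.cut hX).vertexGraph (Sum.inl q))
    (fun e => ⟨⟨(e.1, γ.side q), q, e.2, rfl⟩, Sym2.mem_map.2 ⟨q, e.2, γ.contract_of_eq rfl⟩⟩)
    (fun p => ⟨(⟨(p.1.1, γ.side q), .inr (by rw [p.2.2.1])⟩,
      ⟨(p.1.2, γ.side q), .inl (by rw [p.2.2.2])⟩), Subtype.ext (Prod.ext p.2.1 rfl),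
      (hmem _ _).2 ⟨p.2.2.1, congrArg _ p.2.2.1⟩, (hmem _ _).2 ⟨p.2.2.2, congrArg _ p.2.2.2⟩⟩)
    ⟨?_, ?_⟩ ?_ (fun _ => rfl) (fun _ => rfl) (fun _ => rfl)
  · rintro ⟨e, he⟩ ⟨e', he'⟩ h
    exact Subtype.ext (congrArg (fun z => z.1.1.1) h)
  · rintro ⟨⟨⟨e, b⟩, he⟩, he'⟩
    obtain ⟨v, hv, h⟩ := Sym2.mem_map.1 he'
    obtain ⟨h1, h2⟩ := (hmem v b).1 h
    exact ⟨⟨e, h1 ▸ hv⟩, Subtype.ext (Subtype.ext (Prod.ext rfl ((congrArg γ.side h1).symm.trans h2)))⟩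
  · rintro ⟨⟨⟨⟨c, b⟩, hc⟩, ⟨⟨c', b'⟩, hc'⟩⟩, h1, h2, h3⟩
    obtain ⟨h2, k2⟩ := (hmem (X.tgt c) b).1 h2
    obtain ⟨h3, k3⟩ := (hmem (X.src c') b').1 h3
    refine ⟨⟨(c, c'), congrArg (fun z => z.1.1) h1, h2, h3⟩, Subtype.ext (Prod.ext
      (Subtype.ext (Prod.ext rfl ?_)) (Subtype.ext (Prod.ext rfl ?_)))⟩
    · exact (congrArg γ.side h2).symm.trans k2
    · exact (congrArg γ.side h3).symm.trans k3

/-- The vertex graphs of the two new vertices differ by the orientations. -/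
theorem cut_cls_inr (hX : X.Connected) :
    (γ.cut hX).cls (Sum.inr false) = ((γ.cut hX).cls (Sum.inr true)).star := by
  symm
  apply Quotient.sound
  have hmem : ∀ (v : X.V) (b b' : Bool), γ.contract b v = Sum.inr b' ↔ b = b' ∧ γ.side v = !b := by
    intro v b b'
    by_cases h : γ.side v = b
    · rw [γ.contract_of_eq h, h]
      simp
    · rw [γ.contract_of_ne h, Bool.eq_not_of_ne h]
      simp
  have hE : ∀ (e : X.E) b he, (Sum.inr b : X.V ⊕ Bool) ∈ (γ.cut hX).ends ⟨(e, b), he⟩ ↔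
      ∃ v ∈ X.ends e, γ.side v = !b := by
    intro e b he
    refine Sym2.mem_map.trans ?_
    simp only [hmem]
    simp
  have hEb : ∀ (e : (γ.cut hX).E) b, (Sum.inr b : X.V ⊕ Bool) ∈ (γ.cut hX).ends e →
      e.1.2 = b ∧ ∃ v ∈ X.ends e.1.1, γ.side v = !b := by
    rintro ⟨⟨e, b⟩, he⟩ b' h
    obtain ⟨v, hv, h⟩ := Sym2.mem_map.1 h
    obtain ⟨rfl, k⟩ := (hmem _ _ _).1 h
    exact ⟨rfl, v, hv, k⟩
  have hflip : ∀ (e : (γ.cut hX).E) b, (Sum.inr b : X.V ⊕ Bool) ∈ (γ.cut hX).ends e →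
      ∃ he, (Sum.inr !b : X.V ⊕ Bool) ∈ (γ.cut hX).ends ⟨(e.1.1, !b), he⟩ := by
    intro e b h
    obtain ⟨h1, h2⟩ := hEb e b h
    refine ⟨h2, (hE _ _ _).2 ?_⟩
    rw [Bool.not_not, ← h1]
    exact e.2
  have hC : ∀ (c : (γ.cut hX).C) b, (γ.cut hX).tgt c = (Sum.inr b : X.V ⊕ Bool) →
      c.1.2 = b ∧ γ.side (X.tgt c.1.1) = (!b) ∧ γ.side (X.src c.1.1) = b := by
    rintro ⟨⟨c, b⟩, hc⟩ b' h
    obtain ⟨rfl, k⟩ := (hmem (X.tgt c) b b').1 h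
    refine ⟨rfl, k, hc.resolve_right ?_⟩
    simp [k]
  have hC' : ∀ (c : (γ.cut hX).C) b, (γ.cut hX).src c = (Sum.inr b : X.V ⊕ Bool) →
      c.1.2 = b ∧ γ.side (X.src c.1.1) = (!b) ∧ γ.side (X.tgt c.1.1) = b := by
    rintro ⟨⟨c, b⟩, hc⟩ b' h
    obtain ⟨rfl, k⟩ := (hmem (X.src c) b b').1 h
    refine ⟨rfl, k, hc.resolve_left ?_⟩
    simp [k]
  refine ColoredGraph.equiv_of_map
    (G := ((γ.cut hX).vertexGraph (Sum.inr true)).reverse)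
    (H := (γ.cut hX).vertexGraph (Sum.inr false))
    (fun e => ⟨⟨(e.1.1.1, false), (hflip e.1 true e.2).1⟩, (hflip e.1 true e.2).2⟩)
    (fun p => ⟨(⟨(p.1.2.1.1, false), .inl (hC' _ _ p.2.2.2).2.1⟩,
      ⟨(p.1.1.1.1, false), .inr (hC _ _ p.2.2.1).2.1⟩),
      Subtype.ext (Prod.ext (congrArg (fun z => z.1.1) p.2.1).symm rfl),
      (hmem _ _ _).2 ⟨rfl, (hC' _ _ p.2.2.2).2.2⟩, (hmem _ _ _).2 ⟨rfl, (hC _ _ p.2.2.1).2.2⟩⟩)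
    ⟨?_, ?_⟩ ?_ (fun _ => rfl) (fun _ => rfl) ?_
  · rintro ⟨⟨⟨e, b⟩, he⟩, k⟩ ⟨⟨⟨e', b'⟩, he'⟩, k'⟩ h
    have h1 : e = e' := congrArg (fun z => z.1.1.1) h
    have h2 : b = true := (hEb _ _ k).1
    have h3 : b' = true := (hEb _ _ k').1
    exact Subtype.ext (Subtype.ext (Prod.ext h1 (h2.trans h3.symm)))
  · rintro ⟨e, h⟩
    obtain ⟨h1, h2⟩ := hflip e false h
    refine ⟨⟨_, h2⟩, Subtype.ext (Subtype.ext (Prod.ext rfl ?_))⟩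
    exact (hEb e false h).1.symm
  · rintro ⟨⟨c, c'⟩, h1, h2, h3⟩
    have k2 := hC _ _ h2
    have k3 := hC' _ _ h3
    refine ⟨⟨(⟨(c'.1.1, true), .inl k3.2.1⟩, ⟨(c.1.1, true), .inr k2.2.1⟩),
      Subtype.ext (Prod.ext (congrArg (fun z => z.1.1) h1).symm rfl),
      (hmem _ _ _).2 ⟨rfl, k3.2.2⟩, (hmem _ _ _).2 ⟨rfl, k2.2.2⟩⟩, ?_⟩
    exact Subtype.ext (Prod.ext (Subtype.ext (Prod.ext rfl k2.1.symm))
      (Subtype.ext (Prod.ext rfl k3.1.symm)))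
  · intro p
    exact congrArg X.color (congrArg (fun z => z.1.1) p.2.1).symm

end GraphCut
end cut
end FilmSurface

section Theory

variable {K : Type u} [Field K] {S : Type w} {B : GraphClass S → Type v}
  [∀ σ, AddCommGroup (B σ)] [∀ σ, Module K (B σ)]

/-- The identification of the spaces attached to equal classes of graphs. -/
def castB {σ τ : GraphClass S} (h : σ = τ) : B σ ≃ₗ[K] B τ := by
  subst h
  exact LinearEquiv.refl K _

variable (K B) in
/-- The vector space attached to a film surface: the tensor product over its vertices `q` of the spaces
attached to the vertex graphs of `q`. -/
abbrev VSpace (X : FilmSurface S) : Type _ := ⨂[K] q : X.V, B (X.cls q)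

/-- The isomorphism of vector spaces induced by an isomorphism of film surfaces. -/
noncomputable def isoMap {X Y : FilmSurface S} (φ : FilmSurface.Iso X Y) :
    VSpace K B X ≃ₗ[K] VSpace K B Y :=
  (PiTensorProduct.reindex K (fun q => B (X.cls q)) φ.onV).trans
    (PiTensorProduct.congr fun q => castB (by
      rw [← φ.cls_eq, Equiv.apply_symm_apply]))

/-- The tensor product over a disjoint union of index sets. -/
noncomputable def sumTensor {ι ι' : Type} (σ : ι ⊕ ι' → GraphClass S) :
    (⨂[K] i, B (σ (.inl i))) ⊗[K] (⨂[K] i, B (σ (.inr i))) ≃ₗ[K] ⨂[K] i, B (σ i) :=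
  PiTensorProduct.tmulEquivDep K fun i => B (σ i)

/-- The isomorphism of vector spaces induced by a disjoint union. -/
noncomputable def unionMap (X Y : FilmSurface S) :
    VSpace K B X ⊗[K] VSpace K B Y ≃ₗ[K] VSpace K B (X.union Y) :=
  (TensorProduct.congr
    (PiTensorProduct.congr fun q => castB (FilmSurface.union_cls_inl X Y q).symm)
    (PiTensorProduct.congr fun q => castB (FilmSurface.union_cls_inr X Y q).symm)).trans
    (sumTensor (ι := X.V) (ι' := Y.V) (X.union Y).cls)

theorem bool_update (σ : Bool → GraphClass S) (x : B (σ true)) (y : B (σ false)) :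
    (fun b => match b with
      | true => x
      | false => y : ∀ b, B (σ b)) = Function.update (Function.update (0 : ∀ b, B (σ b)) true x) false y := by
  funext b
  cases b
  · simp
  · simp

/-- The tensor product of two spaces as a tensor product indexed by `Bool`. -/
noncomputable def boolTensor (σ : Bool → GraphClass S) :
    B (σ true) ⊗[K] B (σ false) →ₗ[K] ⨂[K] b, B (σ b) :=
  TensorProduct.lift <| LinearMap.mk₂ K
    (fun x y => PiTensorProduct.tprod K fun b => match b with
      | true => x
      | false => y)
    (by
      intro x x' y
      simp only [bool_update]
      simp only [Function.update_comm (show true ≠ false by simp), MultilinearMap.map_update_add])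
    (by
      intro c x y
      simp only [bool_update]
      simp only [Function.update_comm (show true ≠ false by simp), MultilinearMap.map_update_smul])
    (by
      intro x y y'
      simp only [bool_update, MultilinearMap.map_update_add])
    (by
      intro c x y
      simp only [bool_update, MultilinearMap.map_update_smul])

/-- The map of vector spaces `x ↦ x ⊗ k` induced by a cut, where `k` is a family of tensors in
`B σ ⊗ B σ*`, and the member of `k` at the vertex graph of `q_+` is used. -/
noncomputable def cutMap (k : ∀ σ : GraphClass S, B σ ⊗[K] B σ.star) {X : FilmSurface S}
    (hX : X.Connected) (γ : X.GraphCut) : VSpace K B X →ₗ[K] VSpace K B (γ.cut hX) :=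
  (sumTensor (ι := X.V) (ι' := Bool) (γ.cut hX).cls).toLinearMap ∘ₗ
    (TensorProduct.mk K _ _).flip
      (boolTensor (fun b => (γ.cut hX).cls (Sum.inr b))
        (LinearMap.lTensor _ (castB (γ.cut_cls_inr hX).symm).toLinearMap
          (k ((γ.cut hX).cls (Sum.inr true))))) ∘ₗ
    (PiTensorProduct.congr fun q => castB (γ.cut_cls_inl hX q).symm).toLinearMap

end Theory

/-- A connected film surface whose vertices are numbered in the cyclic order, with vertex graphs
`σ 0, …, σ (n - 1)`. -/
structure CompatibleSurface {S : Type w} {n : ℕ} (σ : Fin n → GraphClass S) where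
  surface : FilmSurface S
  connected : surface.Connected
  vertex : Fin n ≃ surface.V
  cyc_vertex : ∀ i j k, i < j → j < k → surface.cyc (vertex i) (vertex j) (vertex k)
  cls_vertex : ∀ i, surface.cls (vertex i) = σ i

/-- The tensor `x_1 ⊗ ⋯ ⊗ x_n` with the factor `x_i` at the `i`-th vertex. -/
noncomputable def CompatibleSurface.tensor {K : Type u} [Field K] {S : Type w}
    {B : GraphClass S → Type v} [∀ σ, AddCommGroup (B σ)] [∀ σ, Module K (B σ)] {n : ℕ}
    {σ : Fin n → GraphClass S} (m : CompatibleSurface σ) (x : ∀ i, B (σ i)) :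
    VSpace K B m.surface :=
  PiTensorProduct.tprod K fun q =>
    castB (K := K) (by rw [← m.cls_vertex, Equiv.apply_symm_apply]) (x (m.vertex.symm q))

/-- The family `(x, y)` over the two element index set. -/
def pair {S : Type w} {B : GraphClass S → Type v} {σ₁ σ₂ : GraphClass S} (x : B σ₁) (y : B σ₂) :
    ∀ i, B (![σ₁, σ₂] i) :=
  Fin.cons (α := fun i => B (![σ₁, σ₂] i)) x (Fin.cons (α := fun i => B (![σ₂] i)) y (fun i => i.elim0))

/-- The family `(x, y, z)` over the three element index set. -/
def triple {S : Type w} {B : GraphClass S → Type v} {σ₁ σ₂ σ₃ : GraphClass S}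
    (x : B σ₁) (y : B σ₂) (z : B σ₃) : ∀ i, B (![σ₁, σ₂, σ₃] i) :=
  Fin.cons (α := fun i => B (![σ₁, σ₂, σ₃] i)) x (pair y z)

/-- Film Topological Field Theories with values in the family of vector spaces `B`. -/
structure FilmTFT (K : Type u) [Field K] {S : Type w} (B : GraphClass S → Type v)
    [∀ σ, AddCommGroup (B σ)] [∀ σ, Module K (B σ)] where
  /-- the tensors used for the cuts -/
  copairing : ∀ σ : GraphClass S, B σ ⊗[K] B σ.star
  /-- the linear forms -/
  form : ∀ X : FilmSurface S, VSpace K B X →ₗ[K] K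
  /-- topological invariance -/
  form_iso : ∀ {X Y : FilmSurface S} (φ : FilmSurface.Iso X Y) (x : VSpace K B X),
    form Y (isoMap φ x) = form X x
  /-- non-degeneracy of the bilinear forms of the surfaces with two vertices -/
  nondegenerate_left : ∀ {σ₁ σ₂ : GraphClass S} (m : CompatibleSurface ![σ₁, σ₂]) (x : B σ₁),
    (∀ y : B σ₂, form m.surface (m.tensor (pair x y)) = 0) → x = 0
  nondegenerate_right : ∀ {σ₁ σ₂ : GraphClass S} (m : CompatibleSurface ![σ₁, σ₂]) (y : B σ₂),
    (∀ x : B σ₁, form m.surface (m.tensor (pair x y)) = 0) → y = 0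
  /-- cut invariance -/
  form_cut : ∀ {X : FilmSurface S} (hX : X.Connected) (γ : X.GraphCut) (x : VSpace K B X),
    form (γ.cut hX) (cutMap copairing hX γ x) = form X x
  /-- multiplicativity -/
  form_union : ∀ (X Y : FilmSurface S) (x : VSpace K B X) (y : VSpace K B Y),
    form (X.union Y) (unionMap X Y (x ⊗ₜ[K] y)) = form X x * form Y y

/-- A basis of each of the spaces of the family `B`. -/
abbrev BasisFamily (K : Type u) [Field K] {S : Type w} (B : GraphClass S → Type v)
    [∀ σ, AddCommGroup (B σ)] [∀ σ, Module K (B σ)] : Type _ :=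
  ∀ σ, Module.Basis (Fin (Module.finrank K (B σ))) K (B σ)

/-- A matrix for each `σ`, with rows indexed by the basis of `B σ` and columns indexed by the basis
of `B σ*`. -/
abbrev MatrixFamily (K : Type u) [Field K] {S : Type w} (B : GraphClass S → Type v)
    [∀ σ, AddCommGroup (B σ)] [∀ σ, Module K (B σ)] : Type _ :=
  ∀ σ : GraphClass S,
    Matrix (Fin (Module.finrank K (B σ))) (Fin (Module.finrank K (B σ.star))) K

section Algebra

variable {K : Type u} [Field K] {S : Type w} {B : GraphClass S → Type v}
  [∀ σ, AddCommGroup (B σ)] [∀ σ, Module K (B σ)]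

/-- The homogeneous element of the direct sum given by an element of `B σ`. -/
noncomputable def incl {σ : GraphClass S} (x : B σ) : ⨁ σ, B σ := DirectSum.of B σ x

variable (K) in
/-- `F σ` is inverse to the Gram matrix of the pairing of the bases of `B σ*` and `B σ`. -/
def IsInverseGram (p : (⨁ σ, B σ) →ₗ[K] (⨁ σ, B σ) →ₗ[K] K) (b : BasisFamily K B)
    (F : MatrixFamily K B) : Prop :=
  ∀ σ, F σ * Matrix.of (fun j i => p (incl (b σ.star j)) (incl (b σ i))) = 1 ∧
    Matrix.of (fun j i => p (incl (b σ.star j)) (incl (b σ i))) * F σ = 1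

end Algebra

/-- Graph-Frobenius algebra structures on the direct sum of the family of spaces `B`. -/
structure GraphFrobenius (K : Type u) [Field K] {S : Type w} (B : GraphClass S → Type v)
    [∀ σ, AddCommGroup (B σ)] [∀ σ, Module K (B σ)] where
  /-- the bilinear form -/
  bil : (⨁ σ, B σ) →ₗ[K] (⨁ σ, B σ) →ₗ[K] K
  /-- the trilinear form -/
  tri : (⨁ σ, B σ) →ₗ[K] (⨁ σ, B σ) →ₗ[K] (⨁ σ, B σ) →ₗ[K] K
  bil_symm : ∀ x y, bil x y = bil y x
  tri_cyclic : ∀ x y z, tri x y z = tri y z x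
  bil_eq_zero : ∀ {σ₁ σ₂ : GraphClass S} (x : B σ₁) (y : B σ₂), σ₁ ≠ σ₂.star →
    bil (incl x) (incl y) = 0
  nondegenerate : bil.Nondegenerate
  tri_eq_zero : ∀ {σ₁ σ₂ σ₃ : GraphClass S} (x : B σ₁) (y : B σ₂) (z : B σ₃),
    IsEmpty (CompatibleSurface ![σ₁, σ₂, σ₃]) → tri (incl x) (incl y) (incl z) = 0
  /-- If there is a film surface with the vertex graphs `σ₁, σ₂, σ₃, σ₄`, if `s` is the class of its
  graph-cut that separates `1, 2` from `3, 4`, and `t` is the class of its graph-cut that separates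
  `4, 1` from `2, 3`, then the contractions along `s` and `t` agree. -/
  assoc : ∀ {σ₁ σ₂ σ₃ σ₄ s t : GraphClass S},
    Nonempty (CompatibleSurface ![σ₁, σ₂, σ₃, σ₄]) →
    Nonempty (CompatibleSurface ![σ₁, σ₂, s]) → Nonempty (CompatibleSurface ![s.star, σ₃, σ₄]) →
    Nonempty (CompatibleSurface ![σ₄, σ₁, t]) → Nonempty (CompatibleSurface ![t.star, σ₂, σ₃]) →
    ∀ (b : BasisFamily K B) (F : MatrixFamily K B), IsInverseGram K bil b F →
    ∀ (x₁ : B σ₁) (x₂ : B σ₂) (x₃ : B σ₃) (x₄ : B σ₄),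
      ∑ i, ∑ j, tri (incl x₁) (incl x₂) (incl (b s i)) * F s i j *
          tri (incl (b s.star j)) (incl x₃) (incl x₄) =
        ∑ i, ∑ j, tri (incl x₄) (incl x₁) (incl (b t i)) * F t i j *
          tri (incl (b t.star j)) (incl x₂) (incl x₃)

section Correspondence

variable {K : Type u} [Field K] {S : Type w} {B : GraphClass S → Type v}
  [∀ σ, AddCommGroup (B σ)] [∀ σ, Module K (B σ)]

/-- The contraction of trilinear forms along a chain of inverse Gram matrices: the value at
`x_1` and `[x_2, …, x_n]` is the sum over `s_1, …, s_{n-3}` in `Σ` and over all indices of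
`(x_1, x_2, b_{i_1}) F^{i_1 j_1} (b_{j_1}, x_3, b_{i_2}) F^{i_2 j_2} ⋯ (b_{j_{n-3}}, x_{n-1}, x_n)`,
where `b_{i_k}` runs over the basis of `B s_k` and `b_{j_k}` over the basis of `B s_k*`.
For `n = 3` this is `(x_1, x_2, x_3)`, and for `n = 2` we put the bilinear form `(x_1, x_2)`. -/
noncomputable def GraphFrobenius.chain (G : GraphFrobenius K B) (b : BasisFamily K B)
    (F : MatrixFamily K B) : (⨁ σ, B σ) → List (⨁ σ, B σ) → K
  | x, [y] => G.bil x y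
  | x, [y, z] => G.tri x y z
  | x, y :: z :: w :: l => ∑ᶠ s : GraphClass S, ∑ i, ∑ j,
      G.tri x y (incl (b s i)) * F s i j * G.chain b F (incl (b s.star j)) (z :: w :: l)
  | _, [] => 0

/-- The bilinear and trilinear forms of `G` are the values of the theory `T` on the
connected film surfaces with two and three vertices. -/
structure FilmTFT.Generates (T : FilmTFT K B) (G : GraphFrobenius K B) : Prop where
  bil_eq : ∀ {σ₁ σ₂ : GraphClass S} (m : CompatibleSurface ![σ₁, σ₂]) (x : B σ₁) (y : B σ₂),
    G.bil (incl x) (incl y) = T.form m.surface (m.tensor (pair x y))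
  tri_eq : ∀ {σ₁ σ₂ σ₃ : GraphClass S} (m : CompatibleSurface ![σ₁, σ₂, σ₃])
    (x : B σ₁) (y : B σ₂) (z : B σ₃),
    G.tri (incl x) (incl y) (incl z) = T.form m.surface (m.tensor (triple x y z))

end Correspondence

/-- A Film Topological Field Theory together with its family of finite-dimensional spaces. -/
structure BundledTFT (K : Type u) [Field K] (S : Type w) where
  B : GraphClass S → Type v
  [addCommGroup : ∀ σ, AddCommGroup (B σ)]
  [module : ∀ σ, Module K (B σ)]
  [finite : ∀ σ, FiniteDimensional K (B σ)]
  theory : FilmTFT K B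

attribute [instance] BundledTFT.addCommGroup BundledTFT.module BundledTFT.finite

/-- A graph-Frobenius algebra together with its family of finite-dimensional spaces. -/
structure BundledGF (K : Type u) [Field K] (S : Type w) where
  B : GraphClass S → Type v
  [addCommGroup : ∀ σ, AddCommGroup (B σ)]
  [module : ∀ σ, Module K (B σ)]
  [finite : ∀ σ, FiniteDimensional K (B σ)]
  algebra : GraphFrobenius K B

attribute [instance] BundledGF.addCommGroup BundledGF.module BundledGF.finite

/-- Isomorphisms of Film Topological Field Theories: families of linear isomorphisms that carry
the linear forms and the tensors of the first theory to those of the second one. -/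
structure BundledTFT.Iso {K : Type u} [Field K] {S : Type w} (T T' : BundledTFT.{u, v, w} K S) where
  map : ∀ σ, T.B σ ≃ₗ[K] T'.B σ
  form_map : ∀ (X : FilmSurface S) (x : VSpace K T.B X),
    T'.theory.form X (PiTensorProduct.congr (fun q => map (X.cls q)) x) = T.theory.form X x
  copairing_map : ∀ σ, TensorProduct.congr (map σ) (map σ.star) (T.theory.copairing σ) =
    T'.theory.copairing σ

/-- Isomorphisms of graph-Frobenius algebras: graded linear isomorphisms that preserve the
bilinear and the trilinear form. -/
structure BundledGF.Iso {K : Type u} [Field K] {S : Type w} (G G' : BundledGF.{u, v, w} K S) where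
  map : ∀ σ, G.B σ ≃ₗ[K] G'.B σ
  bil_map : ∀ {σ₁ σ₂ : GraphClass S} (x : G.B σ₁) (y : G.B σ₂),
    G'.algebra.bil (incl (map σ₁ x)) (incl (map σ₂ y)) = G.algebra.bil (incl x) (incl y)
  tri_map : ∀ {σ₁ σ₂ σ₃ : GraphClass S} (x : G.B σ₁) (y : G.B σ₂) (z : G.B σ₃),
    G'.algebra.tri (incl (map σ₁ x)) (incl (map σ₂ y)) (incl (map σ₃ z)) =
      G.algebra.tri (incl x) (incl y) (incl z)

instance BundledTFT.setoid (K : Type u) [Field K] (S : Type w) :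
    Setoid (BundledTFT.{u, v, w} K S) where
  r T T' := Nonempty (BundledTFT.Iso T T')
  iseqv :=
    { refl := fun T => ⟨⟨fun _ => LinearEquiv.refl K _, fun X x => by
        congr 1
        induction x using PiTensorProduct.induction_on with
        | smul_tprod r x => simp
        | add x y hx hy => rw [map_add, hx, hy], fun σ => by simp⟩⟩
      symm := by
        rintro T T' ⟨f⟩
        refine ⟨⟨fun σ => (f.map σ).symm, fun X x => ?_, fun σ => ?_⟩⟩
        · rw [← f.form_map X]
          congr 1
          exact (PiTensorProduct.congr fun q => f.map (X.cls q)).apply_symm_apply x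
        · rw [← f.copairing_map]
          exact (TensorProduct.congr (f.map σ) (f.map σ.star)).symm_apply_apply _
      trans := by
        rintro T T' T'' ⟨f⟩ ⟨g⟩
        refine ⟨⟨fun σ => (f.map σ).trans (g.map σ), fun X x => ?_, fun σ => ?_⟩⟩
        · rw [← f.form_map X, ← g.form_map X]
          congr 1
          induction x using PiTensorProduct.induction_on with
          | smul_tprod r x => simp
          | add x y hx hy => rw [map_add, map_add, map_add, hx, hy]
        · rw [← g.copairing_map, ← f.copairing_map, TensorProduct.congr_trans]
          rfl }

instance BundledGF.setoid (K : Type u) [Field K] (S : Type w) :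
    Setoid (BundledGF.{u, v, w} K S) where
  r G G' := Nonempty (BundledGF.Iso G G')
  iseqv :=
    { refl := fun G => ⟨⟨fun _ => LinearEquiv.refl K _, fun _ _ => rfl, fun _ _ _ => rfl⟩⟩
      symm := by
        rintro G G' ⟨f⟩
        refine ⟨⟨fun σ => (f.map σ).symm, fun x y => ?_, fun x y z => ?_⟩⟩
        · rw [← f.bil_map]
          simp
        · rw [← f.tri_map]
          simp
      trans := by
        rintro G G' G'' ⟨f⟩ ⟨g⟩
        refine ⟨⟨fun σ => (f.map σ).trans (g.map σ), fun x y => ?_, fun x y z => ?_⟩⟩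
        · rw [← f.bil_map, ← g.bil_map]
          rfl
        · rw [← f.tri_map, ← g.tri_map]
          rfl }

end Film

/-!
A film surface is determined by very little combinatorial data.  The graph of a vertex, and more
generally the graph that cuts off a cyclic interval `J` of the vertices of a component, is recorded by
its half-edge relation `FilmSurface.sideRel X J`: which of the sides of disks crossing the border of `J`
lie on a common edge.  A class of colored graphs is determined by this relation
(`GraphClass.incidence_injective`), and every cyclic interval has a class (`IsArc.exists_class`).  Hence
all identities between classes of graphs become identities between relations read off the same surface.
Contracting consecutive intervals of vertices gives new surfaces
(`FilmSurface.exists_compatibleSurface`), and connected surfaces are determined by their vertex graphs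
and their cyclic order (`FilmSurface.exists_iso`).

*From an algebra to a theory.*  For each class `s` the trilinear form and the non-degenerate bilinear
form of a graph-Frobenius algebra give a product with values in `B s*`.  In the product
along an interval of the vertices of a component all degrees are prescribed by the graphs that cut the
partial intervals off.  If a component is divided into four intervals, their contraction is a surface
with four vertices, so that the associativity condition applies; hence the product of an interval does
not depend on bracketing (`GraphFrobenius.prod_append`).  The value of a component is the pairing of the
products of two complementary intervals; it does not depend on their choice
(`GraphFrobenius.val_append`, `GraphFrobenius.val_eq`), which gives at once the independence of the
starting vertex and the cut invariance (`GraphFrobenius.form_cut`).  The tensors of the theory are the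
copairings of the bilinear form.

*The chain formula.*  It expands these products in bases (`GraphFrobenius.chain_eq_bil`).  The sums in
the formula run over all classes.  Two vertex graphs of a surface with three vertices do not determine
the third one, but they do once its colors are bounded (`third_class_unique`); in a non-vanishing chain
the colors of each entry occur among the following entries, and this leaves a single class.

*Uniqueness.*  In the surface with the vertex graphs `σ` and `σ*` a cut shows that the tensors of a
theory are inverse to its bilinear form (`FilmTFT.contract₂_copairing`).  The forms are then determined
by induction on the number of vertices: surfaces with at least four vertices can be cut into smaller
ones (`FilmTFT.Generates.form_eq`).

*From a theory to an algebra.*  The forms of an algebra are the values of the theory on the surfaces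
with two and three vertices; its associativity compares two cuts of a surface with four vertices
(`FilmTFT.form_eq_sum`, `FilmTFT.algebra`).

*Isomorphism classes.*  Both constructions are natural for graded isomorphisms
(`BundledTFT.Iso.algebra`, `BundledGF.Iso.theory`) and inverse to each other.
-/

namespace Film

/-! ### Half-edges of colored graphs -/

section HalfEdges

variable {S : Type w}

namespace ColoredGraph

/-- The end of an edge: the target for `true` and the source for `false`. -/
def endpt (G : ColoredGraph S) (b : Bool) (e : G.E) : G.V := bif b then G.tgt e else G.src e

/-- The half-edge relation of a colored graph.  A half-edge is given by the color of its edge and by a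
Boolean that tells the target (`true`) from the source (`false`); two half-edges are related if they
belong to the graph and sit at the same vertex. -/
def incidence (G : ColoredGraph S) (h h' : S × Bool) : Prop :=
  ∃ e e', G.color e = h.1 ∧ G.color e' = h'.1 ∧ G.endpt h.2 e = G.endpt h'.2 e'

theorem exists_endpt (G : ColoredGraph S) (v : G.V) : ∃ b e, G.endpt b e = v := by
  have key : ∀ a b, Relation.EqvGen (fun a b => ∃ e, G.src e = a ∧ G.tgt e = b) a b →
      a = b ∨ ((∃ t e, G.endpt t e = a) ∧ (∃ t e, G.endpt t e = b)) := by
    intro a b h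
    induction h with
    | rel a b h =>
      obtain ⟨e, rfl, rfl⟩ := h
      exact .inr ⟨⟨false, e, rfl⟩, ⟨true, e, rfl⟩⟩
    | refl a => exact .inl rfl
    | symm a b _ ih => exact ih.imp Eq.symm And.symm
    | trans a b c _ _ ih1 ih2 =>
      rcases ih1 with rfl | h1
      · exact ih2
      · rcases ih2 with rfl | h2
        · exact .inr h1
        · exact .inr ⟨h1.1, h2.2⟩
  obtain ⟨e⟩ := G.nonemptyE
  rcases key v (G.src e) (G.connected v _) with h | h
  · exact ⟨false, e, h.symm⟩
  · exact h.1

theorem incidence_color_iff (G : ColoredGraph S) (c : S) (b : Bool) :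
    G.incidence (c, b) (c, b) ↔ ∃ e, G.color e = c :=
  ⟨fun ⟨e, _, h, _⟩ => ⟨e, h⟩, fun ⟨e, h⟩ => ⟨e, e, h, h, rfl⟩⟩

/-- Since the graph is connected, has an edge, and its edges have different colors, it is determined
up to isomorphism by its half-edge relation. -/
theorem equiv_of_incidence {G H : ColoredGraph S} (h : G.incidence = H.incidence) : G ≈ H := by
  have hc : ∀ e : G.E, ∃ e' : H.E, H.color e' = G.color e := fun e => by
    rw [← H.incidence_color_iff _ true, ← h, G.incidence_color_iff]
    exact ⟨e, rfl⟩
  choose g hg using hc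
  have hgs : Function.Surjective g := fun e' => by
    obtain ⟨e, he⟩ : ∃ e, G.color e = H.color e' := by
      rw [← G.incidence_color_iff _ true, h, H.incidence_color_iff]
      exact ⟨e', rfl⟩
    exact ⟨e, H.color_injective ((hg e).trans he)⟩
  have hend : ∀ b e b' e', G.endpt b e = G.endpt b' e' ↔
      H.endpt b (g e) = H.endpt b' (g e') := by
    intro b e b' e'
    have h1 : G.incidence (G.color e, b) (G.color e', b') ↔ G.endpt b e = G.endpt b' e' := by
      constructor
      · rintro ⟨a, a', k, k', k''⟩
        rwa [G.color_injective k, G.color_injective k'] at k''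
      · exact fun k => ⟨e, e', rfl, rfl, k⟩
    have h2 : H.incidence (G.color e, b) (G.color e', b') ↔
        H.endpt b (g e) = H.endpt b' (g e') := by
      constructor
      · rintro ⟨a, a', k, k', k''⟩
        rwa [H.color_injective (k.trans (hg e).symm), H.color_injective (k'.trans (hg e').symm)]
          at k''
      · exact fun k => ⟨g e, g e', hg e, hg e', k⟩
    rw [← h1, h, h2]
  choose t e hte using G.exists_endpt
  refine equiv_of_map (fun v => H.endpt (t v) (g (e v))) g ⟨?_, ?_⟩ hgs ?_ ?_ hg
  · intro v w hvw
    rw [← hte v, ← hte w]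
    exact (hend _ _ _ _).2 hvw
  · intro w
    obtain ⟨b, e', rfl⟩ := H.exists_endpt w
    obtain ⟨a, rfl⟩ := hgs e'
    refine ⟨G.endpt b a, ?_⟩
    exact (hend _ _ _ _).1 (hte _)
  · exact fun a => (hend _ _ false a).1 (hte _)
  · exact fun a => (hend _ _ true a).1 (hte _)

theorem incidence_eq_of_equiv {G H : ColoredGraph S} (h : G ≈ H) : G.incidence = H.incidence := by
  have key : ∀ {G H : ColoredGraph S}, G ≈ H → ∀ a b, G.incidence a b → H.incidence a b := by
    rintro G H ⟨f⟩ a b ⟨e, e', h1, h2, h3⟩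
    have hf : ∀ b e, f.onV (G.endpt b e) = H.endpt b (f.onE e) := by
      rintro (_ | _) e
      · exact f.map_src e
      · exact f.map_tgt e
    refine ⟨f.onE e, f.onE e', (f.map_color e).trans h1, (f.map_color e').trans h2, ?_⟩
    rw [← hf, ← hf, h3]
  funext a b
  exact propext ⟨key h a b, key (Setoid.symm h) a b⟩

end ColoredGraph

namespace GraphClass

/-- The half-edge relation of a class of colored graphs; see `ColoredGraph.incidence`. -/
def incidence (σ : GraphClass S) : S × Bool → S × Bool → Prop :=
  Quotient.lift ColoredGraph.incidence (fun _ _ => ColoredGraph.incidence_eq_of_equiv) σ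

theorem incidence_injective {σ τ : GraphClass S} (h : σ.incidence = τ.incidence) : σ = τ := by
  induction σ using Quotient.ind
  induction τ using Quotient.ind
  exact Quotient.sound (ColoredGraph.equiv_of_incidence h)

theorem incidence_symm (σ : GraphClass S) {h h' : S × Bool} (hh : σ.incidence h h') :
    σ.incidence h' h := by
  induction σ using Quotient.ind
  obtain ⟨e, e', h1, h2, h3⟩ := hh
  exact ⟨e', e, h2, h1, h3.symm⟩

theorem incidence_trans (σ : GraphClass S) {h h' h'' : S × Bool} (k : σ.incidence h h')
    (k' : σ.incidence h' h'') : σ.incidence h h'' := by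
  induction σ using Quotient.ind with | _ G
  obtain ⟨e, e', h1, h2, h3⟩ := k
  obtain ⟨a, a', k1, k2, k3⟩ := k'
  obtain rfl : e' = a := G.color_injective (h2.trans k1.symm)
  exact ⟨e, a', h1, k2, h3.trans k3⟩

theorem star_star (σ : GraphClass S) : σ.star.star = σ := by
  induction σ using Quotient.ind
  rfl

theorem star_injective {σ τ : GraphClass S} (h : σ.star = τ.star) : σ = τ := by
  rw [← star_star σ, h, star_star]

theorem incidence_star (σ : GraphClass S) (h h' : S × Bool) :
    σ.star.incidence h h' ↔ σ.incidence (h.1, !h.2) (h'.1, !h'.2) := by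
  induction σ using Quotient.ind with | _ G
  have hr : ∀ b e, G.reverse.endpt b e = G.endpt (!b) e := by rintro (_ | _) e <;> rfl
  change G.reverse.incidence h h' ↔ G.incidence _ _
  unfold ColoredGraph.incidence
  simp only [hr]
  rfl

/-- The set of colors of the edges. -/
def colors (σ : GraphClass S) : Set S := {c | σ.incidence (c, true) (c, true)}

theorem mem_colors_iff (σ : GraphClass S) (c : S) (b : Bool) :
    c ∈ σ.colors ↔ σ.incidence (c, b) (c, b) := by
  induction σ using Quotient.ind with | _ G
  exact (G.incidence_color_iff c true).trans (G.incidence_color_iff c b).symm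

theorem colors_star (σ : GraphClass S) : σ.star.colors = σ.colors := by
  ext c
  rw [mem_colors_iff _ _ true, incidence_star, ← mem_colors_iff]

theorem colors_nonempty (σ : GraphClass S) : σ.colors.Nonempty := by
  induction σ using Quotient.ind with | _ G
  obtain ⟨e⟩ := G.nonemptyE
  exact ⟨G.color e, e, e, rfl, rfl, rfl⟩

theorem incidence_colors_left (σ : GraphClass S) {h h' : S × Bool} (hh : σ.incidence h h') :
    h.1 ∈ σ.colors :=
  (mem_colors_iff _ _ h.2).2 (σ.incidence_trans hh (σ.incidence_symm hh))

theorem incidence_colors_right (σ : GraphClass S) {h h' : S × Bool} (hh : σ.incidence h h') :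
    h'.1 ∈ σ.colors := σ.incidence_colors_left (σ.incidence_symm hh)

/-- A nonempty set of half-edges that contains, with each of its members, the other end of the edge
and all half-edges at the same vertex contains everything. -/
theorem forall_colors_of_closed (σ : GraphClass S) (P : S × Bool → Prop)
    (h1 : ∀ h h', σ.incidence h h' → P h → P h') (h2 : ∀ c ∈ σ.colors, ∀ b, P (c, b) → P (c, !b))
    {h : S × Bool} (hσ : h.1 ∈ σ.colors) (hP : P h) {c : S} (hc : c ∈ σ.colors) (b : Bool) :
    P (c, b) := by
  induction σ using Quotient.ind with | _ G
  have key : ∀ a b, Relation.EqvGen (fun a b => ∃ e, G.src e = a ∧ G.tgt e = b) a b →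
      ((∃ t e, G.endpt t e = a ∧ P (G.color e, t)) ↔ ∃ t e, G.endpt t e = b ∧ P (G.color e, t)) := by
    intro a b h
    induction h with
    | rel a b h =>
      obtain ⟨e, rfl, rfl⟩ := h
      have hcol : ∀ t, G.incidence (G.color e, t) (G.color e, t) := fun t =>
        (G.incidence_color_iff _ _).2 ⟨e, rfl⟩
      constructor
      · rintro ⟨t, e', he, hp⟩
        exact ⟨true, e, rfl, h2 _ (hcol true) false (h1 _ _ ⟨e', e, rfl, rfl, he⟩ hp)⟩
      · rintro ⟨t, e', he, hp⟩
        exact ⟨false, e, rfl, h2 _ (hcol true) true (h1 _ _ ⟨e', e, rfl, rfl, he⟩ hp)⟩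
    | refl a => rfl
    | symm a b _ ih => exact ih.symm
    | trans a b c _ _ ih1 ih2 => exact ih1.trans ih2
  obtain ⟨e, -, he, -⟩ := hσ
  obtain ⟨e', -, he', -⟩ := hc
  obtain ⟨c0, t0⟩ := h
  simp only at he he'
  obtain ⟨t, a, ha, hp⟩ := (key _ (G.endpt b e') (G.connected (G.endpt t0 e) _)).1
    ⟨t0, e, rfl, by rw [he]; exact hP⟩
  exact h1 _ _ ⟨a, e', rfl, he', ha⟩ hp

end GraphClass

end HalfEdges

/-! ### Arcs of vertices and their classes -/

namespace FilmSurface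

variable {S : Type w} (X : FilmSurface S)

/-- The side `c` crosses the border of the set `J` of vertices: it leaves `J` for `true` and enters
`J` for `false`. -/
def Crossing (J : Set X.V) (b : Bool) (c : X.C) : Prop :=
  bif b then X.src c ∈ J ∧ X.tgt c ∉ J else X.src c ∉ J ∧ X.tgt c ∈ J

/-- The half-edge relation of the graph that cuts off the set `J` of vertices, oriented as the link of
the vertex to which `J` is contracted: the source of the chord of a disk lies on the side entering `J`,
its target on the side leaving `J`. -/
def sideRel (J : Set X.V) (h h' : S × Bool) : Prop :=
  ∃ c c', X.Crossing J h.2 c ∧ X.Crossing J h'.2 c' ∧ X.color (X.disk c) = h.1 ∧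
    X.color (X.disk c') = h'.1 ∧ X.edge c = X.edge c'

/-- A nonempty proper cyclic interval of the vertices of a component. -/
structure IsArc (J : Set X.V) : Prop where
  joined : ∀ a ∈ J, ∀ b ∈ J, X.Joined a b
  proper : ∃ a ∈ J, ∃ b ∉ J, X.Joined a b
  noncrossing : ∀ a ∈ J, ∀ a' ∈ J, ∀ b ∉ J, ∀ b' ∉ J, X.cyc a b a' → ¬ X.cyc a' b' a

variable {X}

theorem joined_tgt {c c' : X.C} (h : X.disk c = X.disk c') : X.Joined (X.src c) (X.tgt c') :=
  Joined.trans (joined_disk h) (joined_side c')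

theorem cyc_trans' {x y z t : X.V} (h : X.cyc x y z) (h' : X.cyc x z t) : X.cyc y z t := by
  have h1 := X.cyc_rotate _ _ _ h
  have h2 := cyc_rotate₂ h'
  have := X.cyc_trans z t x y (X.cyc_rotate _ _ _ h') (cyc_rotate₂ h)
  exact cyc_rotate₂ this

theorem IsArc.not_alternate {J : Set X.V} (hJ : X.IsArc J) {a b a' b' : X.V} (h1 : a ∈ J ↔ a' ∈ J)
    (h2 : b ∈ J ↔ b' ∈ J) (h3 : ¬ (a ∈ J ↔ b ∈ J)) (h4 : X.cyc a b a') : ¬ X.cyc a' b' a := by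
  intro h5
  by_cases ha : a ∈ J
  · exact hJ.noncrossing a ha a' (h1.1 ha) b (by tauto) b' (by tauto) h4 h5
  · have hb : b ∈ J := by tauto
    refine hJ.noncrossing b hb b' (h2.1 hb) a' (by tauto) a (by tauto) ?_ ?_
    · exact cyc_trans' h4 (cyc_rotate₂ h5)
    · exact cyc_trans' h5 (cyc_rotate₂ h4)

/-- A side of a disk that enters an arc is determined by its disk, and so is the one that leaves. -/
theorem IsArc.crossing_unique {J : Set X.V} (hJ : X.IsArc J) {b : Bool} {c c' : X.C}
    (h : X.disk c = X.disk c') (hc : X.Crossing J b c) (hc' : X.Crossing J b c') : c = c' := by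
  by_contra hne
  have h1 : X.src c ∈ J ↔ X.src c' ∈ J := by
    cases b
    · exact iff_of_false hc.1 hc'.1
    · exact iff_of_true hc.1 hc'.1
  have h2 : X.tgt c ∈ J ↔ X.tgt c' ∈ J := by
    cases b
    · exact iff_of_true hc.2 hc'.2
    · exact iff_of_false hc.2 hc'.2
  have h3 : ¬ (X.src c ∈ J ↔ X.tgt c ∈ J) := by
    cases b
    · exact fun k => hc.1 (k.2 hc.2)
    · exact fun k => hc.2 (k.1 hc.1)
  have hs : X.src c ≠ X.src c' := fun h' => hne (X.src_inj _ _ h h')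
  have k1 : X.src c' ≠ X.tgt c := fun h' => h3 (h1.trans (by rw [h']))
  have k2 : X.src c ≠ X.tgt c' := fun h' => h3 (by rw [h2, h'])
  have e1 := (X.cyc_total (X.src c) (X.src c') (X.tgt c) (joined_disk h) (joined_tgt h.symm) hs k1
    (src_ne_tgt c)).resolve_left (X.cyc_disk _ _ h)
  have e2 := (X.cyc_total (X.src c') (X.src c) (X.tgt c') (joined_disk h.symm) (joined_tgt h)
    hs.symm k2 (src_ne_tgt c')).resolve_left (X.cyc_disk _ _ h.symm)
  exact hJ.not_alternate h1 h2 h3 (cyc_rotate₂ e1) (cyc_rotate₂ e2)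

theorem exists_crossing_of_disk {J : Set X.V} {a z : X.C} (hd : X.disk a = X.disk z)
    (h1 : X.src a ∈ J) (h2 : X.src z ∉ J) (b : Bool) :
    ∃ c, X.disk c = X.disk z ∧ X.Crossing J b c := by
  classical
  obtain ⟨a', ha⟩ := exists_prev a
  obtain ⟨z', hz⟩ := exists_prev z
  cases b
  · obtain ⟨c, k1, k2, k3⟩ := exists_entry (fun v => decide (v ∈ J)) (a := z') (z := a)
      (hz.1.trans hd.symm) (by rw [hz.2]; simp [h1, h2])
    refine ⟨c, k1.trans hd, ?_⟩
    simp only [hz.2, h2, decide_false, decide_eq_false_iff_not, ne_eq, not_not]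
      at k2 k3
    exact ⟨k2, k3⟩
  · obtain ⟨c, k1, k2, k3⟩ := exists_entry (fun v => decide (v ∈ J)) (a := a') (z := z)
      (ha.1.trans hd) (by rw [ha.2]; simp [h1, h2])
    refine ⟨c, k1, ?_⟩
    simp only [ha.2, h1, decide_true, decide_eq_true_eq, ne_eq] at k2 k3
    exact ⟨k2, k3⟩

theorem crossing_other {J : Set X.V} {b : Bool} {c : X.C} (hc : X.Crossing J b c) (b' : Bool) :
    ∃ c', X.disk c' = X.disk c ∧ X.Crossing J b' c' := by
  obtain ⟨d, hd⟩ := exists_next c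
  cases b
  · have h2 := hc.2
    rw [hd.2] at h2
    obtain ⟨c', h, h'⟩ := exists_crossing_of_disk hd.1.symm h2 hc.1 b'
    exact ⟨c', h, h'⟩
  · have h2 := hc.2
    rw [hd.2] at h2
    obtain ⟨c', h, h'⟩ := exists_crossing_of_disk hd.1 hc.1 h2 b'
    exact ⟨c', h.trans hd.1.symm, h'⟩

theorem crossing_joined {J : Set X.V} (hJ : X.IsArc J) {b : Bool} {c : X.C} (hc : X.Crossing J b c)
    {a : X.V} (ha : a ∈ J) : X.Joined a (X.src c) ∧ X.Joined a (X.tgt c) := by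
  cases b
  · have h := hJ.joined a ha _ hc.2
    exact ⟨Joined.trans h (Joined.symm (joined_side c)), h⟩
  · have h := hJ.joined a ha _ hc.1
    exact ⟨h, Joined.trans h (joined_side c)⟩

/-- The class of the graph that cuts off an arc: the link of the vertex to which a graph-cut along the
arc contracts it. -/
theorem IsArc.exists_class {J : Set X.V} (hJ : X.IsArc J) :
    ∃ σ : GraphClass S, σ.incidence = X.sideRel J := by
  classical
  obtain ⟨a₀, ha₀, b₀, hb₀, hab⟩ := hJ.proper
  have hcomp : X.Compatible (fun v => decide (v ∈ J)) := by
    intro a b a' b' h1 h2 h3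
    simp only [decide_eq_decide, ne_eq] at h1 h2 h3
    exact hJ.not_alternate h1 h2 h3
  have hcut := (X.cyclic _ hcomp).graph_connected
  have hcross : ∀ e, X.Crosses (fun v => decide (v ∈ J)) e →
      ∃ b c, X.Crossing J b c ∧ X.edge c = e := by
    rintro e ⟨v, w, h, h'⟩
    simp only [ne_eq, decide_eq_decide] at h'
    obtain ⟨c, rfl, ⟨rfl, rfl⟩ | ⟨rfl, rfl⟩⟩ := exists_side h
    · by_cases h1 : X.src c ∈ J
      · exact ⟨true, c, ⟨h1, by tauto⟩, rfl⟩
      · exact ⟨false, c, ⟨h1, by tauto⟩, rfl⟩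
    · by_cases h1 : X.src c ∈ J
      · exact ⟨true, c, ⟨h1, by tauto⟩, rfl⟩
      · exact ⟨false, c, ⟨h1, by tauto⟩, rfl⟩
  have hcross' : ∀ b c, X.Crossing J b c → X.Crosses (fun v => decide (v ∈ J)) (X.edge c) := by
    intro b c hc
    refine ⟨X.src c, X.tgt c, X.ends_edge c, ?_⟩
    cases b
    · simp [hc.1, hc.2]
    · simp [hc.1, hc.2]
  have hends : ∀ e, X.Crosses (fun v => decide (v ∈ J)) e → ∀ v ∈ X.ends e, X.Joined a₀ v := by
    intro e he v hv
    obtain ⟨b, c, hc, rfl⟩ := hcross e he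
    have := crossing_joined hJ hc ha₀
    rw [X.ends_edge, Sym2.mem_iff] at hv
    rcases hv with rfl | rfl
    · exact this.1
    · exact this.2
  let G : ColoredGraph S :=
    { V := {e : X.E // X.Crosses (fun v => decide (v ∈ J)) e}
      E := {p : X.C × X.C // X.disk p.1 = X.disk p.2 ∧ X.Crossing J false p.1 ∧
        X.Crossing J true p.2}
      finV := by have := X.finE; infer_instance
      finE := by have := X.finC; infer_instance
      nonemptyE := by
        -- some edge of the surface leaves the arc, since the component is connected
        have : ∃ e, X.Crosses (fun v => decide (v ∈ J)) e := by
          by_contra hno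
          have hconst : ∀ v w, X.Joined v w → (v ∈ J ↔ w ∈ J) := by
            intro v w h
            induction h with
            | rel v w h =>
              obtain ⟨e, he⟩ := h
              by_contra hne
              exact hno ⟨e, v, w, he, by simpa using hne⟩
            | refl v => rfl
            | symm v w _ ih => exact ih.symm
            | trans u v w _ _ ih1 ih2 => exact ih1.trans ih2
          exact hb₀ ((hconst _ _ hab).1 ha₀)
        obtain ⟨e, he⟩ := this
        obtain ⟨b, c, hc, -⟩ := hcross e he
        obtain ⟨c1, h1, k1⟩ := crossing_other hc false
        obtain ⟨c2, h2, k2⟩ := crossing_other hc true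
        exact ⟨⟨(c1, c2), h1.trans h2.symm, k1, k2⟩⟩
      src := fun p => ⟨X.edge p.1.1, hcross' _ _ p.2.2.1⟩
      tgt := fun p => ⟨X.edge p.1.2, hcross' _ _ p.2.2.2⟩
      color := fun p => X.color (X.disk p.1.1)
      src_ne_tgt := by
        rintro ⟨⟨c, c'⟩, h1, h2, h3⟩ h
        have h4 : c = c' := X.edge_inj _ _ h1 (congrArg Subtype.val h)
        exact h2.1 (h4 ▸ h3.1)
      color_injective := by
        rintro ⟨⟨c, c'⟩, h1, h2, h3⟩ ⟨⟨d, d'⟩, k1, k2, k3⟩ h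
        have hd : X.disk c = X.disk d := X.color_inj _ _
          (Joined.trans (Joined.symm (crossing_joined hJ h2 ha₀).1) (crossing_joined hJ k2 ha₀).1) h
        obtain rfl := hJ.crossing_unique hd h2 k2
        obtain rfl := hJ.crossing_unique (h1.symm.trans k1) h3 k3
        rfl
      connected := by
        rintro ⟨e, he⟩ ⟨e', he'⟩
        have h := hcut e e' he he' (fun v hv w hw =>
          Joined.trans (Joined.symm (hends e he v hv)) (hends e' he' w hw))
        let k : X.E → {e : X.E // X.Crosses (fun v => decide (v ∈ J)) e} :=
          fun a => if ha : X.Crosses (fun v => decide (v ∈ J)) a then ⟨a, ha⟩ else ⟨e, he⟩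
        have hk : ∀ a (ha : X.Crosses (fun v => decide (v ∈ J)) a), k a = ⟨a, ha⟩ :=
          fun a ha => dif_pos ha
        rw [← hk e he, ← hk e' he']
        refine eqvGen_lift k (fun a b hab => ?_) h
        obtain ⟨h1, h2, c, c', hd, rfl, rfl⟩ := hab
        rw [hk _ h1, hk _ h2]
        have hdir : ∀ c, X.Crosses (fun v => decide (v ∈ J)) (X.edge c) →
            X.Crossing J false c ∨ X.Crossing J true c := by
          rintro c ⟨v, w, h, h'⟩
          rw [X.ends_edge] at h
          simp only [ne_eq, decide_eq_decide] at h'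
          rcases Sym2.eq_iff.1 h with ⟨rfl, rfl⟩ | ⟨rfl, rfl⟩
          · by_cases h1 : X.src c ∈ J
            · exact .inr ⟨h1, by tauto⟩
            · exact .inl ⟨h1, by tauto⟩
          · by_cases h1 : X.src c ∈ J
            · exact .inr ⟨h1, by tauto⟩
            · exact .inl ⟨h1, by tauto⟩
        rcases hdir c h1 with k1 | k1 <;> rcases hdir c' h2 with k2 | k2
        · obtain rfl := hJ.crossing_unique hd k1 k2
          exact .refl _
        · exact .rel _ _ ⟨⟨(c, c'), hd, k1, k2⟩, rfl, rfl⟩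
        · exact .symm _ _ (.rel _ _ ⟨⟨(c', c), hd.symm, k2, k1⟩, rfl, rfl⟩)
        · obtain rfl := hJ.crossing_unique hd k1 k2
          exact .refl _ }
  refine ⟨Quotient.mk _ G, ?_⟩
  have hside : ∀ (p : G.E) b, ∃ c, X.Crossing J b c ∧ X.disk c = X.disk p.1.1 ∧
      (G.endpt b p).1 = X.edge c := by
    rintro p (_ | _)
    · exact ⟨p.1.1, p.2.2.1, rfl, rfl⟩
    · exact ⟨p.1.2, p.2.2.2, p.2.1.symm, rfl⟩
  have hedge : ∀ b c, X.Crossing J b c → ∃ p : G.E, X.disk c = X.disk p.1.1 ∧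
      (G.endpt b p).1 = X.edge c := by
    intro b c hc
    obtain ⟨c1, h1, k1⟩ := crossing_other hc false
    obtain ⟨c2, h2, k2⟩ := crossing_other hc true
    refine ⟨⟨(c1, c2), h1.trans h2.symm, k1, k2⟩, h1.symm, ?_⟩
    cases b
    · exact congrArg X.edge (hJ.crossing_unique h1 k1 hc)
    · exact congrArg X.edge (hJ.crossing_unique h2 k2 hc)
  funext h h'
  apply propext
  constructor
  · rintro ⟨p, p', h1, h2, h3⟩
    obtain ⟨c, k1, k2, k3⟩ := hside p h.2
    obtain ⟨c', k1', k2', k3'⟩ := hside p' h'.2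
    refine ⟨c, c', k1, k1', ?_, ?_, ?_⟩
    · rw [k2]; exact h1
    · rw [k2']; exact h2
    · rw [← k3, ← k3', h3]
  · rintro ⟨c, c', k1, k1', h1, h2, h3⟩
    obtain ⟨p, k2, k3⟩ := hedge _ c k1
    obtain ⟨p', k2', k3'⟩ := hedge _ c' k1'
    refine ⟨p, p', ?_, ?_, ?_⟩
    · rw [← h1, k2]
    · rw [← h2, k2']
    · exact Subtype.ext (by rw [k3, k3', h3])

theorem crossing_singleton {q : X.V} {c : X.C} :
    (X.Crossing {q} true c ↔ X.src c = q) ∧ (X.Crossing {q} false c ↔ X.tgt c = q) := by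
  constructor
  · refine ⟨fun h => h.1, fun h => ⟨h, fun h' => src_ne_tgt c (h.trans h'.symm)⟩⟩
  · refine ⟨fun h => h.2, fun h => ⟨fun h' => src_ne_tgt c (h'.trans h.symm), h⟩⟩

/-- The class of a vertex is the class of the arc that consists of this vertex. -/
theorem incidence_cls (X : FilmSurface S) (q : X.V) : (X.cls q).incidence = X.sideRel {q} := by
  have hside : ∀ (p : (X.vertexGraph q).E) b, ∃ c, X.Crossing {q} b c ∧ X.disk c = X.disk p.1.1 ∧
      ((X.vertexGraph q).endpt b p).1 = X.edge c := by
    rintro p (_ | _)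
    · exact ⟨p.1.1, crossing_singleton.2.2 p.2.2.1, rfl, rfl⟩
    · exact ⟨p.1.2, crossing_singleton.1.2 p.2.2.2, p.2.1.symm, rfl⟩
  have hedge : ∀ b c, X.Crossing {q} b c → ∃ p : (X.vertexGraph q).E, X.disk c = X.disk p.1.1 ∧
      ((X.vertexGraph q).endpt b p).1 = X.edge c := by
    rintro (_ | _) c hc
    · obtain ⟨d, hd⟩ := exists_next c
      have h := crossing_singleton.2.1 hc
      exact ⟨⟨(c, d), hd.1, h, hd.2.symm.trans h⟩, rfl, rfl⟩
    · obtain ⟨d, hd⟩ := exists_prev c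
      have h := crossing_singleton.1.1 hc
      exact ⟨⟨(d, c), hd.1, hd.2.trans h, h⟩, hd.1.symm, rfl⟩
  funext h h'
  apply propext
  constructor
  · rintro ⟨p, p', h1, h2, h3⟩
    obtain ⟨c, k1, k2, k3⟩ := hside p h.2
    obtain ⟨c', k1', k2', k3'⟩ := hside p' h'.2
    refine ⟨c, c', k1, k1', ?_, ?_, ?_⟩
    · rw [k2]; exact h1
    · rw [k2']; exact h2
    · rw [← k3, ← k3', h3]
  · rintro ⟨c, c', k1, k1', h1, h2, h3⟩
    obtain ⟨p, k2, k3⟩ := hedge _ c k1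
    obtain ⟨p', k2', k3'⟩ := hedge _ c' k1'
    refine ⟨p, p', ?_, ?_, ?_⟩
    · rw [← h1, k2]; rfl
    · rw [← h2, k2']; rfl
    · exact Subtype.ext (by rw [k3, k3', h3])

/-- Complementary arcs have opposite classes. -/
theorem incidence_star_of_compl {J J' : Set X.V} {σ : GraphClass S} (hσ : σ.incidence = X.sideRel J)
    (h : ∀ c b, X.Crossing J' b c ↔ X.Crossing J (!b) c) : σ.star.incidence = X.sideRel J' := by
  funext k k'
  apply propext
  rw [GraphClass.incidence_star, hσ]
  simp only [sideRel, h]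

end FilmSurface
end Film

namespace Film
namespace FilmSurface

variable {S : Type w}

/-! ### Unions of components -/

/-- An isomorphism of a film surface onto a union of components of another one, recorded on the
vertices and the sides of disks only. -/
structure Emb (X Y : FilmSurface S) where
  onV : X.V → Y.V
  onC : X.C → Y.C
  injective : Function.Injective onV
  map_src : ∀ c, Y.src (onC c) = onV (X.src c)
  map_tgt : ∀ c, Y.tgt (onC c) = onV (X.tgt c)
  map_color : ∀ c, Y.color (Y.disk (onC c)) = X.color (X.disk c)
  edge_iff : ∀ c c', Y.edge (onC c) = Y.edge (onC c') ↔ X.edge c = X.edge c'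
  cyc_iff : ∀ x y z, Y.cyc (onV x) (onV y) (onV z) ↔ X.cyc x y z
  closed : ∀ c, (∃ v, Y.src c = onV v ∨ Y.tgt c = onV v) → ∃ c', onC c' = c

namespace Emb

variable {X Y : FilmSurface S} (f : Emb X Y)

theorem joined {v w : X.V} (h : X.Joined v w) : Y.Joined (f.onV v) (f.onV w) := by
  refine eqvGen_lift f.onV (fun a b hab => ?_) h
  obtain ⟨e, he⟩ := hab
  obtain ⟨c, rfl, ⟨rfl, rfl⟩ | ⟨rfl, rfl⟩⟩ := exists_side he
  · rw [← f.map_src, ← f.map_tgt]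
    exact joined_side _
  · rw [← f.map_src, ← f.map_tgt]
    exact Joined.symm (joined_side _)

theorem exists_of_joined {v : X.V} {b : Y.V} (h : Y.Joined (f.onV v) b) :
    ∃ w, f.onV w = b ∧ X.Joined v w := by
  have key : ∀ a b, Y.Joined a b → (∀ v, f.onV v = a → ∃ w, f.onV w = b ∧ X.Joined v w) ∧
      (∀ v, f.onV v = b → ∃ w, f.onV w = a ∧ X.Joined v w) := by
    intro a b h
    induction h with
    | rel a b h =>
      obtain ⟨e, he⟩ := h
      obtain ⟨c, rfl, ⟨rfl, rfl⟩ | ⟨rfl, rfl⟩⟩ := exists_side he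
      · constructor
        · intro v hv
          obtain ⟨c', rfl⟩ := f.closed c ⟨v, .inl hv.symm⟩
          refine ⟨X.tgt c', (f.map_tgt _).symm, ?_⟩
          rw [f.injective (hv.trans (f.map_src _))]
          exact joined_side _
        · intro v hv
          obtain ⟨c', rfl⟩ := f.closed c ⟨v, .inr hv.symm⟩
          refine ⟨X.src c', (f.map_src _).symm, ?_⟩
          rw [f.injective (hv.trans (f.map_tgt _))]
          exact Joined.symm (joined_side _)
      · constructor
        · intro v hv
          obtain ⟨c', rfl⟩ := f.closed c ⟨v, .inr hv.symm⟩
          refine ⟨X.src c', (f.map_src _).symm, ?_⟩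
          rw [f.injective (hv.trans (f.map_tgt _))]
          exact Joined.symm (joined_side _)
        · intro v hv
          obtain ⟨c', rfl⟩ := f.closed c ⟨v, .inl hv.symm⟩
          refine ⟨X.tgt c', (f.map_tgt _).symm, ?_⟩
          rw [f.injective (hv.trans (f.map_src _))]
          exact joined_side _
    | refl a => exact ⟨fun v hv => ⟨v, hv, joined_refl _⟩, fun v hv => ⟨v, hv, joined_refl _⟩⟩
    | symm a b _ ih => exact ih.symm
    | trans a b c _ _ ih1 ih2 =>
      constructor
      · intro v hv
        obtain ⟨w, hw, h1⟩ := ih1.1 v hv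
        obtain ⟨x, hx, h2⟩ := ih2.1 w hw
        exact ⟨x, hx, Joined.trans h1 h2⟩
      · intro v hv
        obtain ⟨w, hw, h1⟩ := ih2.2 v hv
        obtain ⟨x, hx, h2⟩ := ih1.2 w hw
        exact ⟨x, hx, Joined.trans h1 h2⟩
  exact (key _ _ h).1 v rfl

theorem joined_iff {v w : X.V} : Y.Joined (f.onV v) (f.onV w) ↔ X.Joined v w := by
  refine ⟨fun h => ?_, f.joined⟩
  obtain ⟨w', h1, h2⟩ := f.exists_of_joined h
  rwa [← f.injective h1]

theorem crossing_iff {J : Set X.V} {b : Bool} {c : X.C} :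
    Y.Crossing (f.onV '' J) b (f.onC c) ↔ X.Crossing J b c := by
  cases b <;> simp [Crossing, f.map_src, f.map_tgt, f.injective.mem_set_image]

theorem sideRel_image (J : Set X.V) : Y.sideRel (f.onV '' J) = X.sideRel J := by
  funext h h'
  apply propext
  have hex : ∀ b c, Y.Crossing (f.onV '' J) b c → ∃ c', f.onC c' = c := by
    rintro (_ | _) c hc
    · obtain ⟨v, -, hv⟩ := hc.2
      exact f.closed c ⟨v, .inr hv.symm⟩
    · obtain ⟨v, -, hv⟩ := hc.1
      exact f.closed c ⟨v, .inl hv.symm⟩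
  constructor
  · rintro ⟨c, c', k1, k2, k3, k4, k5⟩
    obtain ⟨c, rfl⟩ := hex _ _ k1
    obtain ⟨c', rfl⟩ := hex _ _ k2
    exact ⟨c, c', f.crossing_iff.1 k1, f.crossing_iff.1 k2, (f.map_color _).symm.trans k3,
      (f.map_color _).symm.trans k4, (f.edge_iff _ _).1 k5⟩
  · rintro ⟨c, c', k1, k2, k3, k4, k5⟩
    exact ⟨f.onC c, f.onC c', f.crossing_iff.2 k1, f.crossing_iff.2 k2, (f.map_color _).trans k3,
      (f.map_color _).trans k4, (f.edge_iff _ _).2 k5⟩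

theorem cls_eq (q : X.V) : Y.cls (f.onV q) = X.cls q := by
  apply GraphClass.incidence_injective
  rw [incidence_cls, incidence_cls, ← f.sideRel_image, Set.image_singleton]

/-- An isomorphism as an embedding. -/
def ofIso (φ : Iso X Y) : Emb X Y where
  onV := φ.onV
  onC := φ.onC
  injective := φ.onV.injective
  map_src := φ.map_src
  map_tgt := φ.map_tgt
  map_color c := by rw [φ.map_disk, φ.map_color]
  edge_iff c c' := by rw [φ.map_edge, φ.map_edge, φ.onE.apply_eq_iff_eq]
  cyc_iff := φ.map_cyc
  closed c _ := φ.onC.surjective c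

variable (X Y) in
/-- The first part of a disjoint union. -/
def inl : Emb X (X.union Y) where
  onV := Sum.inl
  onC := Sum.inl
  injective := Sum.inl_injective
  map_src _ := rfl
  map_tgt _ := rfl
  map_color _ := rfl
  edge_iff _ _ := Sum.inl_injective.eq_iff
  cyc_iff _ _ _ := Iff.rfl
  closed := by
    rintro (c | c) h
    · exact ⟨c, rfl⟩
    · obtain ⟨v, h | h⟩ := h <;> cases h

variable (X Y) in
/-- The second part of a disjoint union. -/
def inr : Emb Y (X.union Y) where
  onV := Sum.inr
  onC := Sum.inr
  injective := Sum.inr_injective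
  map_src _ := rfl
  map_tgt _ := rfl
  map_color _ := rfl
  edge_iff _ _ := Sum.inr_injective.eq_iff
  cyc_iff _ _ _ := Iff.rfl
  closed := by
    rintro (c | c) h
    · obtain ⟨v, h | h⟩ := h <;> cases h
    · exact ⟨c, rfl⟩

end Emb

section restrict

variable (X : FilmSurface S)

/-- A nonempty union of components, as a set of vertices. -/
structure IsClopen (U : Set X.V) : Prop where
  nonempty : U.Nonempty
  closed : ∀ {v w}, X.Joined v w → v ∈ U → w ∈ U

variable {X} {U : Set X.V} (hU : X.IsClopen U)

namespace IsClopen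

include hU in
theorem mem_iff {v w} (h : X.Joined v w) : v ∈ U ↔ w ∈ U := ⟨hU.closed h, hU.closed h.symm⟩

include hU in
theorem tgt_mem {c : X.C} (h : X.src c ∈ U) : X.tgt c ∈ U := hU.closed (joined_side c) h

include hU in
theorem ends_mem {c : X.C} (h : X.src c ∈ U) : ∀ v ∈ X.ends (X.edge c), v ∈ U := by
  intro v hv
  rw [X.ends_edge, Sym2.mem_iff] at hv
  rcases hv with rfl | rfl
  · exact h
  · exact hU.tgt_mem h

end IsClopen

/-- The cells of a union of components. -/
def restrictData : SurfaceData S where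
  V := U
  E := {e : X.E // ∀ v ∈ X.ends e, v ∈ U}
  D := {d : X.D // ∃ c, X.disk c = d ∧ X.src c ∈ U}
  C := {c : X.C // X.src c ∈ U}
  ends e := (X.ends e.1).attachWith e.2
  disk c := ⟨X.disk c.1, c.1, rfl, c.2⟩
  edge c := ⟨X.edge c.1, hU.ends_mem c.2⟩
  src c := ⟨X.src c.1, c.2⟩
  tgt c := ⟨X.tgt c.1, hU.tgt_mem c.2⟩
  color d := X.color d.1
  cyc x y z := X.cyc x.1 y.1 z.1

theorem restrict_ends_iff (e : (restrictData hU).E) (x y : U) :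
    (restrictData hU).ends e = s(x, y) ↔ X.ends e.1 = s(x.1, y.1) := by
  have h := Sym2.attachWith_map_subtypeVal (s := X.ends e.1) e.2
  constructor
  · intro h'
    have h' : (X.ends e.1).attachWith e.2 = s(x, y) := h'
    rw [← h, h']
    rfl
  · intro h'
    apply Sym2.map.injective Subtype.val_injective
    exact h.trans h'

theorem restrict_joined {x y : U} : (restrictData hU).Joined x y ↔ X.Joined x.1 y.1 := by
  constructor
  · refine fun h => eqvGen_lift Subtype.val ?_ h
    rintro a b ⟨e, he⟩
    exact .rel _ _ ⟨e.1, (restrict_ends_iff hU _ _ _).1 he⟩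
  · intro h
    classical
    let k : X.V → U := fun v => if hv : v ∈ U then ⟨v, hv⟩ else x
    have hk : ∀ v (hv : v ∈ U), k v = ⟨v, hv⟩ := fun v hv => dif_pos hv
    have h2 : (restrictData hU).Joined (k x.1) (k y.1) := by
      refine eqvGen_lift k ?_ h
      rintro a b ⟨e, he⟩
      have hab : X.Joined a b := .rel _ _ ⟨e, he⟩
      by_cases ha : a ∈ U
      · have hb := hU.closed hab ha
        have hm : ∀ v ∈ X.ends e, v ∈ U := by
          intro v hv
          rw [he, Sym2.mem_iff] at hv
          rcases hv with rfl | rfl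
          · exact ha
          · exact hb
        refine .rel _ _ ⟨⟨e, hm⟩, (restrict_ends_iff hU ⟨e, hm⟩ _ _).2 ?_⟩
        rw [hk a ha, hk b hb]
        exact he
      · have hb : b ∉ U := fun hb => ha (hU.closed hab.symm hb)
        have : k a = k b := by
          simp only [k, dif_neg ha, dif_neg hb]
        rw [this]
        exact .refl _
    rwa [hk _ x.2, hk _ y.2] at h2

theorem restrict_cyclic (χ : U → Bool) (hχ : (restrictData hU).Compatible χ) :
    (restrictData hU).IsGraphCut χ := by
  classical
  let χ' : X.V → Bool := fun v => if hv : v ∈ U then χ ⟨v, hv⟩ else false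
  have hχ' : ∀ v (hv : v ∈ U), χ' v = χ ⟨v, hv⟩ := fun v hv => dif_pos hv
  have hcomp : X.Compatible χ' := by
    intro a b a' b' h1 h2 h3 h4 h5
    have j1 := X.cyc_joined _ _ _ h4
    have j2 := X.cyc_joined _ _ _ (X.cyc_rotate _ _ _ h4)
    have j3 := X.cyc_joined _ _ _ h5
    by_cases ha : a ∈ U
    · have hb := hU.closed j1 ha
      have ha' := hU.closed j2 hb
      have hb' := hU.closed j3 ha'
      rw [hχ' a ha, hχ' b hb] at h3
      rw [hχ' a ha, hχ' a' ha'] at h1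
      rw [hχ' b hb, hχ' b' hb'] at h2
      exact hχ ⟨a, ha⟩ ⟨b, hb⟩ ⟨a', ha'⟩ ⟨b', hb'⟩ h1 h2 h3 h4 h5
    · have hb : b ∉ U := fun hb => ha (hU.closed j1.symm hb)
      apply h3
      simp only [χ', dif_neg ha, dif_neg hb]
  have hcut := X.cyclic χ' hcomp
  have hcross : ∀ e, (restrictData hU).Crosses χ e ↔ X.Crosses χ' e.1 := by
    rintro ⟨e, hm⟩
    constructor
    · rintro ⟨v, w, h, h'⟩
      refine ⟨v.1, w.1, (restrict_ends_iff hU _ _ _).1 h, ?_⟩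
      rwa [hχ' _ v.2, hχ' _ w.2]
    · rintro ⟨v, w, h, h'⟩
      have hv := hm v (by rw [h]; simp)
      have hw := hm w (by rw [h]; simp)
      refine ⟨⟨v, hv⟩, ⟨w, hw⟩, (restrict_ends_iff hU _ _ _).2 h, ?_⟩
      rwa [← hχ', ← hχ']
  constructor
  · intro e e' h1 h2 h3
    have h := hcut.graph_connected e.1 e'.1 ((hcross _).1 h1) ((hcross _).1 h2) (by
      intro v hv w hw
      refine (restrict_joined hU (x := ⟨v, e.2 v hv⟩) (y := ⟨w, e'.2 w hw⟩)).1 (h3 _ ?_ _ ?_)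
      · obtain ⟨x, h⟩ := Sym2.mem_iff_exists.1 hv
        have hx := e.2 x (by rw [h]; simp)
        rw [(restrict_ends_iff hU e ⟨v, e.2 v hv⟩ ⟨x, hx⟩).2 h]
        exact Sym2.mem_mk_left _ _
      · obtain ⟨x, h⟩ := Sym2.mem_iff_exists.1 hw
        have hx := e'.2 x (by rw [h]; simp)
        rw [(restrict_ends_iff hU e' ⟨w, e'.2 w hw⟩ ⟨x, hx⟩).2 h]
        exact Sym2.mem_mk_left _ _)
    let k : X.E → (restrictData hU).E := fun a => if ha : ∀ v ∈ X.ends a, v ∈ U then ⟨a, ha⟩ else e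
    have hk : ∀ a (ha : ∀ v ∈ X.ends a, v ∈ U), k a = ⟨a, ha⟩ := fun a ha => dif_pos ha
    have h4 : Relation.EqvGen ((restrictData hU).CutAdj χ) (k e.1) (k e'.1) := by
      refine eqvGen_lift k ?_ h
      rintro a b ⟨k1, k2, c, c', hd, rfl, rfl⟩
      have hiff := hU.mem_iff (joined_disk hd)
      by_cases hc : X.src c ∈ U
      · have hc' := hiff.1 hc
        have e1 := hk _ (hU.ends_mem hc)
        have e2 := hk _ (hU.ends_mem hc')
        rw [e1, e2]
        exact .rel _ _ ⟨(hcross _).2 k1, (hcross _).2 k2, ⟨c, hc⟩, ⟨c', hc'⟩, Subtype.ext hd,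
          rfl, rfl⟩
      · have hc' := fun h => hc (hiff.2 h)
        have e1 : k (X.edge c) = e := dif_neg fun h => hc (h _ (by rw [X.ends_edge]; simp))
        have e2 : k (X.edge c') = e := dif_neg fun h => hc' (h _ (by rw [X.ends_edge]; simp))
        rw [e1, e2]
        exact .refl _
    rwa [hk _ e.2, hk _ e'.2] at h4
  · rintro ⟨v, hv⟩ ⟨w, hw⟩ h hvw
    have h := hcut.parts_connected v w ((restrict_joined hU).1 h) (by rwa [hχ' v hv, hχ' w hw])
    let k : X.V → U := fun a => if ha : a ∈ U then ⟨a, ha⟩ else ⟨v, hv⟩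
    have hk : ∀ a (ha : a ∈ U), k a = ⟨a, ha⟩ := fun a ha => dif_pos ha
    rw [← hk v hv, ← hk w hw]
    refine eqvGen_lift k ?_ h
    rintro a b ⟨k1, k2, e, he⟩
    by_cases ha : a ∈ U
    · have hb : b ∈ U := hU.closed (.rel _ _ ⟨e, he⟩) ha
      rw [hχ' v hv] at k1 k2
      rw [hχ' a ha] at k1
      rw [hχ' b hb] at k2
      rw [hk a ha, hk b hb, hk v hv]
      have hm : ∀ v ∈ X.ends e, v ∈ U := by
        intro v hv
        rw [he, Sym2.mem_iff] at hv
        rcases hv with rfl | rfl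
        · exact ha
        · exact hb
      exact .rel _ _ ⟨k1, k2, ⟨e, hm⟩, (restrict_ends_iff hU ⟨e, hm⟩ _ _).2 he⟩
    · have hb : b ∉ U := fun hb => ha (hU.closed (Joined.symm (.rel _ _ ⟨e, he⟩)) hb)
      have : k a = k b := by simp only [k, dif_neg ha, dif_neg hb]
      rw [this]
      exact .refl _

/-- A nonempty union of components of a film surface. -/
def restrict : FilmSurface S where
  toSurfaceData := restrictData hU
  finV := by have := X.finV; exact inferInstanceAs (Finite U)
  finE := by have := X.finE; exact inferInstanceAs (Finite {e : X.E // ∀ v ∈ X.ends e, v ∈ U})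
  finD := by
    have := X.finD
    exact inferInstanceAs (Finite {d : X.D // ∃ c, X.disk c = d ∧ X.src c ∈ U})
  finC := by have := X.finC; exact inferInstanceAs (Finite {c : X.C // X.src c ∈ U})
  nonemptyV := hU.nonempty.to_subtype
  ends_not_isDiag := by
    rintro ⟨e, he⟩
    obtain ⟨c, rfl⟩ := X.edge_surj e
    have h1 : X.src c ∈ U := he _ (by rw [X.ends_edge]; simp)
    rw [(restrict_ends_iff hU ⟨X.edge c, he⟩ ⟨_, h1⟩ ⟨_, hU.tgt_mem h1⟩).2 (X.ends_edge c)]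
    intro h
    exact src_ne_tgt c (congrArg Subtype.val (Sym2.mk_isDiag_iff.1 h))
  ends_edge c := (restrict_ends_iff hU _ _ _).2 (X.ends_edge c.1)
  circle := by
    rintro ⟨c, hc⟩ ⟨c', hc'⟩ h
    have h1 := X.circle c c' (congrArg Subtype.val h)
    clear h
    induction h1 with
    | single h => exact .single ⟨Subtype.ext h.1, Subtype.ext h.2⟩
    | @tail b d hb h ih =>
      have hb' : X.src b ∈ U := by
        refine hU.closed (Joined.symm (next_joined h)) hc'
      exact .tail (ih hb') ⟨Subtype.ext h.1, Subtype.ext h.2⟩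
  src_inj c c' h h' := Subtype.ext (X.src_inj _ _ (congrArg Subtype.val h) (congrArg Subtype.val h'))
  tgt_inj c c' h h' := Subtype.ext (X.tgt_inj _ _ (congrArg Subtype.val h) (congrArg Subtype.val h'))
  edge_inj c c' h h' :=
    Subtype.ext (X.edge_inj _ _ (congrArg Subtype.val h) (congrArg Subtype.val h'))
  disk_surj := by
    rintro ⟨d, c, rfl, hc⟩
    exact ⟨⟨c, hc⟩, rfl⟩
  edge_surj := by
    rintro ⟨e, he⟩
    obtain ⟨c, rfl⟩ := X.edge_surj e
    exact ⟨⟨c, he _ (by rw [X.ends_edge]; simp)⟩, rfl⟩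
  src_surj := by
    rintro ⟨v, hv⟩
    obtain ⟨c, rfl⟩ := X.src_surj v
    exact ⟨⟨c, hv⟩, rfl⟩
  cyc_rotate _ _ _ := X.cyc_rotate _ _ _
  cyc_asymm _ _ _ := X.cyc_asymm _ _ _
  cyc_trans _ _ _ _ := X.cyc_trans _ _ _ _
  cyc_total x y z h1 h2 n1 n2 n3 := X.cyc_total _ _ _ ((restrict_joined hU).1 h1)
    ((restrict_joined hU).1 h2) (fun h => n1 (Subtype.ext h)) (fun h => n2 (Subtype.ext h))
    (fun h => n3 (Subtype.ext h))
  cyc_joined x y z h := (restrict_joined hU).2 (X.cyc_joined _ _ _ h)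
  cyc_disk c c' h := X.cyc_disk _ _ (congrArg Subtype.val h)
  color_inj c c' h h' := Subtype.ext (X.color_inj _ _ ((restrict_joined hU).1 h) h')
  cyclic := restrict_cyclic hU

/-- The inclusion of a union of components. -/
def restrictEmb : Emb (restrict hU) X where
  onV := Subtype.val
  onC := Subtype.val
  injective := Subtype.val_injective
  map_src _ := rfl
  map_tgt _ := rfl
  map_color _ := rfl
  edge_iff _ _ := ⟨fun h => Subtype.ext h, fun h => congrArg Subtype.val h⟩
  cyc_iff _ _ _ := Iff.rfl
  closed := by
    rintro c ⟨v, h | h⟩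
    · exact ⟨⟨c, h ▸ v.2⟩, rfl⟩
    · exact ⟨⟨c, hU.closed (Joined.symm (joined_side c)) (h ▸ v.2)⟩, rfl⟩

variable (hU' : X.IsClopen Uᶜ)

/-- A film surface is the disjoint union of two complementary unions of components. -/
noncomputable def unionRestrictIso : Iso (union (restrict hU) (restrict hU')) X where
  onV := Equiv.ofBijective (Sum.elim Subtype.val Subtype.val : U ⊕ (Uᶜ : Set X.V) → X.V) (by
    constructor
    · rintro (x | x) (y | y) h
      · exact congrArg Sum.inl (Subtype.ext h)
      · replace h : x.1 = y.1 := h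
        exact absurd (h ▸ x.2) y.2
      · replace h : x.1 = y.1 := h
        exact absurd (h ▸ y.2) x.2
      · exact congrArg Sum.inr (Subtype.ext h)
    · intro v
      by_cases hv : v ∈ U
      · exact ⟨.inl ⟨v, hv⟩, rfl⟩
      · exact ⟨.inr ⟨v, hv⟩, rfl⟩)
  onE := Equiv.ofBijective (Sum.elim Subtype.val Subtype.val :
      {e : X.E // ∀ v ∈ X.ends e, v ∈ U} ⊕ {e : X.E // ∀ v ∈ X.ends e, v ∈ Uᶜ} → X.E) (by
    have hne : ∀ e, ∃ v, v ∈ X.ends e := fun e => by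
      obtain ⟨v, w, h⟩ := ends_exists X e
      exact ⟨v, by rw [h]; simp⟩
    constructor
    · rintro (x | x) (y | y) h
      · exact congrArg Sum.inl (Subtype.ext h)
      · obtain ⟨v, hv⟩ := hne x.1
        exact absurd (x.2 v hv) (y.2 v (by rw [← show x.1 = y.1 from h]; exact hv))
      · obtain ⟨v, hv⟩ := hne x.1
        exact absurd (y.2 v (by rw [← show x.1 = y.1 from h]; exact hv)) (x.2 v hv)
      · exact congrArg Sum.inr (Subtype.ext h)
    · intro e
      obtain ⟨c, rfl⟩ := X.edge_surj e
      by_cases hv : X.src c ∈ U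
      · exact ⟨.inl ⟨_, hU.ends_mem hv⟩, rfl⟩
      · exact ⟨.inr ⟨_, hU'.ends_mem hv⟩, rfl⟩)
  onD := Equiv.ofBijective (Sum.elim Subtype.val Subtype.val :
      {d : X.D // ∃ c, X.disk c = d ∧ X.src c ∈ U} ⊕ {d : X.D // ∃ c, X.disk c = d ∧ X.src c ∈ Uᶜ} →
        X.D) (by
    constructor
    · rintro (⟨x, c, h1, h2⟩ | ⟨x, c, h1, h2⟩) (⟨y, c', h3, h4⟩ | ⟨y, c', h3, h4⟩) h
      · exact congrArg Sum.inl (Subtype.ext h)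
      · replace h : x = y := h
        exact absurd (hU.closed (joined_disk (h1.trans (h.trans h3.symm))) h2) h4
      · replace h : x = y := h
        exact absurd (hU.closed (joined_disk (h3.trans (h.symm.trans h1.symm))) h4) h2
      · exact congrArg Sum.inr (Subtype.ext h)
    · intro d
      obtain ⟨c, rfl⟩ := X.disk_surj d
      by_cases hv : X.src c ∈ U
      · exact ⟨.inl ⟨_, c, rfl, hv⟩, rfl⟩
      · exact ⟨.inr ⟨_, c, rfl, hv⟩, rfl⟩)
  onC := Equiv.ofBijective (Sum.elim Subtype.val Subtype.val :
      {c : X.C // X.src c ∈ U} ⊕ {c : X.C // X.src c ∈ Uᶜ} → X.C) (by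
    constructor
    · rintro (x | x) (y | y) h
      · exact congrArg Sum.inl (Subtype.ext h)
      · replace h : x.1 = y.1 := h
        exact absurd (h ▸ x.2) y.2
      · replace h : x.1 = y.1 := h
        exact absurd (h ▸ y.2) x.2
      · exact congrArg Sum.inr (Subtype.ext h)
    · intro c
      by_cases hv : X.src c ∈ U
      · exact ⟨.inl ⟨c, hv⟩, rfl⟩
      · exact ⟨.inr ⟨c, hv⟩, rfl⟩)
  map_ends := by
    rintro (e | e)
    · have h : ∀ z, Sym2.map (Sum.elim Subtype.val Subtype.val : U ⊕ (Uᶜ : Set X.V) → X.V)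
          (Sym2.map Sum.inl z) = Sym2.map Subtype.val z := fun z => Sym2.map_map z
      exact ((h _).trans (Sym2.attachWith_map_subtypeVal e.2)).symm
    · have h : ∀ z, Sym2.map (Sum.elim Subtype.val Subtype.val : U ⊕ (Uᶜ : Set X.V) → X.V)
          (Sym2.map Sum.inr z) = Sym2.map Subtype.val z := fun z => Sym2.map_map z
      exact ((h _).trans (Sym2.attachWith_map_subtypeVal e.2)).symm
  map_disk := by rintro (c | c) <;> rfl
  map_edge := by rintro (c | c) <;> rfl
  map_src := by rintro (c | c) <;> rfl
  map_tgt := by rintro (c | c) <;> rfl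
  map_color := by rintro (c | c) <;> rfl
  map_cyc := by
    have hn : ∀ {x y z : X.V}, X.cyc x y z → (x ∈ U ↔ y ∈ U) ∧ (y ∈ U ↔ z ∈ U) := fun h =>
      ⟨hU.mem_iff (X.cyc_joined _ _ _ h), hU.mem_iff (X.cyc_joined _ _ _ (X.cyc_rotate _ _ _ h))⟩
    rintro (x | x) (y | y) (z | z)
    · exact Iff.rfl
    · exact ⟨fun h => (z.2 ((hn h).2.1 y.2)).elim, fun h => h.elim⟩
    · exact ⟨fun h => (y.2 ((hn h).1.1 x.2)).elim, fun h => h.elim⟩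
    · exact ⟨fun h => (y.2 ((hn h).1.1 x.2)).elim, fun h => h.elim⟩
    · exact ⟨fun h => (x.2 ((hn h).1.2 y.2)).elim, fun h => h.elim⟩
    · exact ⟨fun h => (x.2 ((hn h).1.2 y.2)).elim, fun h => h.elim⟩
    · exact ⟨fun h => (y.2 ((hn h).2.2 z.2)).elim, fun h => h.elim⟩
    · exact Iff.rfl

end restrict

end FilmSurface
end Film

namespace Film
namespace FilmSurface

variable {S : Type w} {X : FilmSurface S}

/-! ### The pieces of a cut surface -/

namespace GraphCut

variable (γ : GraphCut X) (hX : X.Connected)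

/-- Arcs of a piece of the cut surface have the same graphs as the corresponding arcs of the original
surface. -/
theorem sideRel_cut {b : Bool} {K : Set (X.V ⊕ Bool)} {J : Set X.V}
    (h1 : ∀ v, γ.contract b v ∈ K ↔ v ∈ J) (h2 : ∀ v, γ.contract (!b) v ∉ K) :
    (γ.cut hX).sideRel K = X.sideRel J := by
  have hcr : ∀ (c : (γ.cut hX).C) t, (γ.cut hX).Crossing K t c ↔ c.1.2 = b ∧ X.Crossing J t c.1.1 := by
    rintro ⟨⟨c, b'⟩, hc⟩ t
    have key : (γ.cut hX).Crossing K t ⟨(c, b'), hc⟩ ↔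
        bif t then γ.contract b' (X.src c) ∈ K ∧ γ.contract b' (X.tgt c) ∉ K
        else γ.contract b' (X.src c) ∉ K ∧ γ.contract b' (X.tgt c) ∈ K := Iff.rfl
    rw [key]
    by_cases hb : b' = b
    · subst hb
      simp only [h1, true_and]
      rfl
    · obtain rfl : b' = !b := by cases b <;> cases b' <;> simp_all
      simp only [h2, hb, false_and, and_false]
      cases t <;> simp
  funext h h'
  apply propext
  constructor
  · rintro ⟨c, c', k1, k2, k3, k4, k5⟩
    exact ⟨c.1.1, c'.1.1, ((hcr _ _).1 k1).2, ((hcr _ _).1 k2).2, k3, k4,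
      congrArg (fun z => z.1.1) k5⟩
  · rintro ⟨c, c', k1, k2, k3, k4, k5⟩
    -- a side with both ends off the side `b` of the cut does not cross the border of `J`
    have hside : ∀ c t, X.Crossing J t c → γ.side (X.src c) = b ∨ γ.side (X.tgt c) = b := by
      intro c t hc
      by_contra hno
      rw [not_or] at hno
      have e1 := h1 (X.src c)
      have e2 := h1 (X.tgt c)
      rw [γ.contract_of_ne hno.1] at e1
      rw [γ.contract_of_ne hno.2, e1] at e2
      cases t
      · exact hc.1 (e2.2 hc.2)
      · exact hc.2 (e2.1 hc.1)
    refine ⟨⟨(c, b), hside _ _ k1⟩, ⟨(c', b), hside _ _ k2⟩, (hcr _ _).2 ⟨rfl, k1⟩,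
      (hcr _ _).2 ⟨rfl, k2⟩, k3, k4, Subtype.ext (Prod.ext k5 rfl)⟩

/-- The class of the new vertex `q_b` is the class of the contracted part. -/
theorem incidence_cls_cut_inr (b : Bool) :
    ((γ.cut hX).cls (Sum.inr b)).incidence = X.sideRel {v | γ.side v ≠ b} := by
  refine (incidence_cls (γ.cut hX) _).trans
    (γ.sideRel_cut hX (b := b) (K := {Sum.inr b}) (fun v => ?_) (fun v => ?_))
  · by_cases h : γ.side v = b
    · simp [γ.contract_of_eq h, h]
    · simp [γ.contract_of_ne h, h]
  · by_cases h : γ.side v = !b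
    · simp [γ.contract_of_eq h]
    · simp [γ.contract_of_ne h]

/-- The vertices of the piece `b` of the cut surface. -/
theorem isClopen_piece (b : Bool) : (γ.cut hX).IsClopen {x | γ.sideOf x = b} where
  nonempty := ⟨Sum.inr b, rfl⟩
  closed h h' := ((γ.joined_iff hX).1 h).symm.trans h'

/-- One of the two connected pieces of the cut surface. -/
noncomputable def piece (b : Bool) : FilmSurface S := restrict (γ.isClopen_piece hX b)

theorem piece_connected (b : Bool) : (γ.piece hX b).Connected := fun v w =>
  (restrict_joined (γ.isClopen_piece hX b)).2 ((γ.joined_iff hX).2 (v.2.trans w.2.symm))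

/-- The contraction of the surface to one of the pieces. -/
def toPiece (b : Bool) (v : X.V) : (γ.piece hX b).V := ⟨γ.contract b v, γ.sideOf_contract b v⟩

theorem toPiece_surjective (b : Bool) : Function.Surjective (γ.toPiece hX b) := by
  rintro ⟨x, hx⟩
  obtain ⟨v, hv⟩ := γ.exists_contract x
  obtain rfl : γ.sideOf x = b := hx
  exact ⟨v, Subtype.ext hv⟩

theorem sideRel_piece {b : Bool} (K : Set (γ.piece hX b).V) :
    (γ.piece hX b).sideRel K = X.sideRel (γ.toPiece hX b ⁻¹' K) := by
  refine ((restrictEmb (γ.isClopen_piece hX b)).sideRel_image K).symm.trans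
    (γ.sideRel_cut hX (b := b) (fun v => ?_) (fun v => ?_))
  · constructor
    · rintro ⟨x, hx, h⟩
      have : x = γ.toPiece hX b v := Subtype.ext h
      subst this
      exact hx
    · exact fun h => ⟨γ.toPiece hX b v, h, rfl⟩
  · rintro ⟨x, -, h⟩
    have h1 : γ.sideOf x.1 = b := x.2
    have h2 := congrArg γ.sideOf h
    rw [sideOf_contract] at h2
    have h3 : γ.sideOf x.1 = !b := h2
    rw [h1] at h3
    cases b <;> cases h3

end GraphCut

/-! ### Contraction of arcs -/

/-- A division of the vertices of a connected surface into cyclic intervals in cyclic order.  For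
`m = 2` the last condition is not a consequence of the others. -/
structure IsDivision (X : FilmSurface S) {m : ℕ} (p : X.V → Fin m) : Prop where
  surjective : Function.Surjective p
  cyc : ∀ a b c, p a < p b → p b < p c → X.cyc a b c
  noncrossing : ∀ a a' b b', p a = p a' → p b ≠ p a → p b' ≠ p a → X.cyc a b a' → ¬ X.cyc a' b' a

/-- The contraction of all the intervals of a division of a connected film surface. -/
theorem exists_compatibleSurface {m : ℕ} (hm : 2 ≤ m) (X : FilmSurface S) (hX : X.Connected)
    (p : X.V → Fin m) (hp : X.IsDivision p) {σ : Fin m → GraphClass S}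
    (hσ : ∀ i, (σ i).incidence = X.sideRel (p ⁻¹' {i})) : Nonempty (CompatibleSurface σ) := by
  classical
  induction hn : Nat.card X.V using Nat.strong_induction_on generalizing X with
  | _ n ih =>
    by_cases hinj : Function.Injective p
    · let e := Equiv.ofBijective p ⟨hinj, hp.surjective⟩
      have he : ∀ i, p (e.symm i) = i := e.apply_symm_apply
      refine ⟨⟨X, hX, e.symm, fun i j k hij hjk => hp.cyc _ _ _ ?_ ?_, fun i => ?_⟩⟩
      · rwa [he, he]
      · rwa [he, he]
      · apply GraphClass.incidence_injective
        rw [incidence_cls, hσ]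
        congr 1
        ext v
        rw [Set.mem_singleton_iff, Set.mem_preimage, Set.mem_singleton_iff]
        exact Equiv.eq_symm_apply e
    · -- contract an interval with two vertices
      obtain ⟨a, a', haa, hne⟩ : ∃ a a', p a = p a' ∧ a ≠ a' := by
        simpa [Function.Injective] using hinj
      obtain ⟨j, hj⟩ : ∃ j : Fin m, j ≠ p a := by
        have : Nontrivial (Fin m) := Fin.nontrivial_iff_two_le.2 hm
        exact exists_ne _
      obtain ⟨d, rfl⟩ := hp.surjective j
      let γ : GraphCut X :=
        { side := fun v => decide (p v = p a)
          side_surjective := by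
            rintro (_ | _)
            · exact ⟨d, by simpa using hj⟩
            · exact ⟨a, by simp⟩
          compatible := by
            intro x y x' y' h1 h2 h3 h4 h5
            simp only [decide_eq_decide, ne_eq] at h1 h2 h3
            by_cases hx : p x = p a
            · exact hp.noncrossing x x' y y' (hx.trans (h1.1 hx).symm) (by rw [hx]; tauto)
                (by rw [hx]; tauto) h4 h5
            · have hy : p y = p a := by tauto
              exact hp.noncrossing y y' x' x (hy.trans (h2.1 hy).symm) (by rw [hy]; tauto)
                (by rw [hy]; tauto) (cyc_trans' h4 (cyc_rotate₂ h5))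
                (cyc_trans' h5 (cyc_rotate₂ h4)) }
      have hγ : ∀ v, γ.side v = false ↔ p v ≠ p a := fun v => by simp [γ]
      have hfin := X.finV
      let X' := γ.piece hX false
      let p' : X'.V → Fin m := fun x => p (γ.place x.1)
      have hp' : ∀ v, p' (γ.toPiece hX false v) = p v := by
        intro v
        change p (γ.place (γ.contract false v)) = p v
        by_cases h : γ.side v = false
        · rw [γ.contract_of_eq h]
          rfl
        · rw [γ.contract_of_ne h]
          have h1 : γ.side (γ.rep true) = true := γ.side_rep true
          have h2 : p (γ.rep true) = p a := by simpa [γ] using h1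
          have h3 : p v = p a := by simpa [hγ] using h
          rw [h3]
          exact h2
      refine ih (Nat.card X'.V) ?_ X' (γ.piece_connected hX false) p' ⟨?_, ?_, ?_⟩ ?_ rfl
      · rw [← hn]
        refine lt_of_le_of_ne (Nat.card_le_card_of_surjective _ (γ.toPiece_surjective hX false)) ?_
        intro hcard
        have hX'fin : Finite X'.V := X'.finV
        have hbij := (Nat.bijective_iff_surjective_and_card (γ.toPiece hX false)).2
          ⟨γ.toPiece_surjective hX false, hcard.symm⟩
        refine hne (hbij.1 (Subtype.ext ?_))
        have k1 : γ.side a ≠ false := by rw [ne_eq, hγ]; simp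
        have k2 : γ.side a' ≠ false := by rw [ne_eq, hγ]; simp [haa]
        exact (γ.contract_of_ne k1).trans (γ.contract_of_ne k2).symm
      · intro i
        obtain ⟨v, rfl⟩ := hp.surjective i
        exact ⟨γ.toPiece hX false v, hp' v⟩
      · intro x y z h1 h2
        exact ⟨x.2.trans y.2.symm, y.2.trans z.2.symm, hp.cyc _ _ _ h1 h2⟩
      · intro x x' y y' h1 h2 h3 h4 h5
        exact hp.noncrossing _ _ _ _ h1 h2 h3 h4.2.2 h5.2.2
      · intro i
        rw [hσ i, γ.sideRel_piece hX]
        congr 1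
        ext v
        simp [hp']

end FilmSurface
end Film

namespace Film
namespace FilmSurface

variable {S : Type w} {X : FilmSurface S}

/-! ### Surfaces with three vertices -/

/-- The disk of color `d` has a side between `q` and `p`, which runs from `q` to `p` for `b = true` and
from `p` to `q` for `b = false`. -/
def HasSide (X : FilmSurface S) (d : S) (b : Bool) (q p : X.V) : Prop :=
  ∃ c, X.color (X.disk c) = d ∧ bif b then X.src c = q ∧ X.tgt c = p else X.src c = p ∧ X.tgt c = q

theorem HasSide.symm {d : S} {b : Bool} {q p : X.V} (h : X.HasSide d b q p) :
    X.HasSide d (!b) p q := by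
  obtain ⟨c, h1, h2⟩ := h
  exact ⟨c, h1, by cases b <;> exact h2⟩

theorem HasSide.mem_colors {d : S} {b : Bool} {q p : X.V} (h : X.HasSide d b q p) :
    d ∈ (X.cls q).colors := by
  obtain ⟨c, h1, h2⟩ := h
  rw [GraphClass.mem_colors_iff _ _ b, incidence_cls]
  have hc : X.Crossing {q} b c := by
    cases b
    · exact crossing_singleton.2.2 h2.2
    · exact crossing_singleton.1.2 h2.1
  exact ⟨c, c, hc, hc, h1, h1, rfl⟩

theorem exists_src_of_mem_colors {d : S} {q : X.V} (h : d ∈ (X.cls q).colors) :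
    ∃ c, X.color (X.disk c) = d ∧ X.src c = q := by
  rw [GraphClass.mem_colors_iff _ _ true, incidence_cls] at h
  obtain ⟨c, -, h1, -, h2, -⟩ := h
  exact ⟨c, h2, crossing_singleton.1.1 h1⟩

theorem exists_hasSide {d : S} {q : X.V} (h : d ∈ (X.cls q).colors) (b : Bool) :
    ∃ p, X.HasSide d b q p := by
  obtain ⟨c, h1, rfl⟩ := exists_src_of_mem_colors h
  cases b
  · obtain ⟨c', h2⟩ := exists_prev c
    exact ⟨X.src c', c', by rw [h2.1, h1], rfl, h2.2⟩
  · exact ⟨X.tgt c, c, h1, rfl, rfl⟩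

theorem HasSide.ne {d : S} {b : Bool} {q p : X.V} (h : X.HasSide d b q p) : q ≠ p := by
  obtain ⟨c, -, h2⟩ := h
  have := src_ne_tgt c
  cases b
  · rw [← h2.1, ← h2.2]; exact this.symm
  · rw [← h2.1, ← h2.2]; exact this

theorem HasSide.unique (hX : X.Connected) {d : S} {b : Bool} {q p p' : X.V}
    (h : X.HasSide d b q p) (h' : X.HasSide d b q p') : p = p' := by
  obtain ⟨c, h1, h2⟩ := h
  obtain ⟨c', h1', h2'⟩ := h'
  have hd := X.color_inj c c' (hX _ _) (h1.trans h1'.symm)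
  cases b
  · obtain rfl := X.tgt_inj _ _ hd (h2.2.trans h2'.2.symm)
    exact h2.1.symm.trans h2'.1
  · obtain rfl := X.src_inj _ _ hd (h2.1.trans h2'.1.symm)
    exact h2.2.symm.trans h2'.2

/-- Half-edges at the same vertex of the graph of `q` are related in the graph of the other end of the
corresponding edge as well. -/
theorem exists_hasSide_of_incidence {d d' : S} {b b' : Bool} {q : X.V}
    (h : (X.cls q).incidence (d, b) (d', b')) :
    ∃ p, X.HasSide d b q p ∧ X.HasSide d' b' q p ∧ (X.cls p).incidence (d, !b) (d', !b') := by
  rw [incidence_cls] at h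
  obtain ⟨c, c', h1, h2, h3, h4, h5⟩ := h
  have key : ∀ b c, X.Crossing {q} b c → ∃ p, X.ends (X.edge c) = s(q, p) ∧
      X.HasSide (X.color (X.disk c)) b q p ∧ X.Crossing {p} (!b) c := by
    rintro (_ | _) c hc
    · have h := crossing_singleton.2.1 hc
      exact ⟨X.src c, by rw [X.ends_edge, h, Sym2.eq_swap], ⟨c, rfl, rfl, h⟩,
        crossing_singleton.1.2 rfl⟩
    · have h := crossing_singleton.1.1 hc
      exact ⟨X.tgt c, by rw [X.ends_edge, h], ⟨c, rfl, h, rfl⟩, crossing_singleton.2.2 rfl⟩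
  obtain ⟨p, k1, k2, k3⟩ := key _ _ h1
  obtain ⟨p', k1', k2', k3'⟩ := key _ _ h2
  obtain rfl : p = p' := by
    have h0 := k1.symm.trans ((congrArg X.ends h5).trans k1')
    rcases Sym2.eq_iff.1 h0 with h | h
    · exact h.2
    · exact h.2.trans h.1
  simp only at h3 h4
  rw [h3] at k2
  rw [h4] at k2'
  refine ⟨p, k2, k2', ?_⟩
  rw [incidence_cls]
  exact ⟨c, c', k3, k3', h3, h4, h5⟩

theorem not_mem_colors_of_cyc (hX : X.Connected) {d : S} {q p r : X.V} (h : X.HasSide d true q p)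
    (hc : X.cyc q r p) : d ∉ (X.cls r).colors := by
  intro hd
  obtain ⟨c, h1, h2, h3⟩ := h
  obtain ⟨c', k1, rfl⟩ := exists_src_of_mem_colors hd
  apply X.cyc_disk c c' (X.color_inj _ _ (hX _ _) (h1.trans k1.symm))
  rwa [h2, h3]

/-- A connected film surface with the three vertices `q₁`, `q₂`, `q₃` in this cyclic order. -/
structure IsTriangle (X : FilmSurface S) (q₁ q₂ q₃ : X.V) : Prop where
  connected : X.Connected
  cyc : X.cyc q₁ q₂ q₃
  cases : ∀ v, v = q₁ ∨ v = q₂ ∨ v = q₃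

namespace IsTriangle

variable {q₁ q₂ q₃ : X.V}

theorem rotate (h : X.IsTriangle q₁ q₂ q₃) : X.IsTriangle q₂ q₃ q₁ :=
  ⟨h.connected, X.cyc_rotate _ _ _ h.cyc, fun v => by have := h.cases v; tauto⟩

/-- The side of a disk that leaves `q₁` ends at `q₂` if the disk contains `q₂`. -/
theorem hasSide_true (h : X.IsTriangle q₁ q₂ q₃) {d : S} (h1 : d ∈ (X.cls q₁).colors)
    (h2 : d ∈ (X.cls q₂).colors) : X.HasSide d true q₁ q₂ := by
  obtain ⟨p, hp⟩ := exists_hasSide h1 true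
  rcases h.cases p with rfl | rfl | rfl
  · exact absurd rfl hp.ne
  · exact hp
  · exact absurd h2 (not_mem_colors_of_cyc h.connected hp h.cyc)

theorem hasSide_true' (h : X.IsTriangle q₁ q₂ q₃) {d : S} (h1 : d ∈ (X.cls q₁).colors)
    (h2 : d ∉ (X.cls q₂).colors) : X.HasSide d true q₁ q₃ := by
  obtain ⟨p, hp⟩ := exists_hasSide h1 true
  rcases h.cases p with rfl | rfl | rfl
  · exact absurd rfl hp.ne
  · exact absurd hp.symm.mem_colors h2
  · exact hp

theorem hasSide_false (h : X.IsTriangle q₁ q₂ q₃) {d : S} (h1 : d ∈ (X.cls q₁).colors)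
    (h3 : d ∈ (X.cls q₃).colors) : X.HasSide d false q₁ q₃ :=
  (h.rotate.rotate.hasSide_true h3 h1).symm

theorem hasSide_false' (h : X.IsTriangle q₁ q₂ q₃) {d : S} (h1 : d ∈ (X.cls q₁).colors)
    (h3 : d ∉ (X.cls q₃).colors) : X.HasSide d false q₁ q₂ := by
  obtain ⟨p, hp⟩ := exists_hasSide h1 false
  rcases h.cases p with rfl | rfl | rfl
  · exact absurd rfl hp.ne
  · exact hp
  · exact absurd hp.symm.mem_colors h3

theorem mem_colors_or (h : X.IsTriangle q₁ q₂ q₃) {d : S} (h1 : d ∈ (X.cls q₁).colors) :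
    d ∈ (X.cls q₂).colors ∨ d ∈ (X.cls q₃).colors := by
  by_contra hno
  rw [not_or] at hno
  exact hno.2 (h.hasSide_true' h1 hno.1).symm.mem_colors

/-- The other end of a half-edge of the graph of `q₃` is `q₂` or `q₁`, depending on the vertices of the
disk; this describes the graph of `q₃` by the graphs of `q₁` and `q₂` and by its own colors. -/
theorem incidence_iff (h : X.IsTriangle q₁ q₂ q₃) (k k' : S × Bool) :
    (X.cls q₃).incidence k k' ↔
      k.1 ∈ (X.cls q₃).colors ∧ k'.1 ∈ (X.cls q₃).colors ∧
      ((bif k.2 then k.1 ∉ (X.cls q₁).colors else k.1 ∈ (X.cls q₂).colors) ∧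
        (bif k'.2 then k'.1 ∉ (X.cls q₁).colors else k'.1 ∈ (X.cls q₂).colors) ∧
        (X.cls q₂).incidence (k.1, !k.2) (k'.1, !k'.2) ∨
      ¬ (bif k.2 then k.1 ∉ (X.cls q₁).colors else k.1 ∈ (X.cls q₂).colors) ∧
        ¬ (bif k'.2 then k'.1 ∉ (X.cls q₁).colors else k'.1 ∈ (X.cls q₂).colors) ∧
        (X.cls q₁).incidence (k.1, !k.2) (k'.1, !k'.2)) := by
  have h3 := h.rotate.rotate
  have hside : ∀ d b, d ∈ (X.cls q₃).colors →
      (X.HasSide d b q₃ q₂ ↔ bif b then d ∉ (X.cls q₁).colors else d ∈ (X.cls q₂).colors) ∧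
      (X.HasSide d b q₃ q₁ ↔
        ¬ (bif b then d ∉ (X.cls q₁).colors else d ∈ (X.cls q₂).colors)) := by
    have hne : q₁ ≠ q₂ := cyc_ne₁ h.cyc
    rintro d (_ | _) hd
    · by_cases hm : d ∈ (X.cls q₂).colors
      · have := h3.hasSide_false hd hm
        refine ⟨iff_of_true this hm, iff_of_false (fun k => hne (k.unique h.connected this)) ?_⟩
        simpa using hm
      · have := h3.hasSide_false' hd hm
        refine ⟨iff_of_false (fun k => hne (this.unique h.connected k)) hm, iff_of_true this hm⟩
    · by_cases hm : d ∈ (X.cls q₁).colors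
      · have := h3.hasSide_true hd hm
        refine ⟨iff_of_false (fun k => hne (this.unique h.connected k)) ?_, iff_of_true this ?_⟩
        · simpa using hm
        · simpa using hm
      · have := h3.hasSide_true' hd hm
        refine ⟨iff_of_true this hm, iff_of_false (fun k => hne (k.unique h.connected this)) ?_⟩
        simpa using hm
  obtain ⟨d, b⟩ := k
  obtain ⟨d', b'⟩ := k'
  constructor
  · intro hi
    have hd := GraphClass.incidence_colors_left _ hi
    have hd' := GraphClass.incidence_colors_right _ hi
    refine ⟨hd, hd', ?_⟩
    obtain ⟨p, e1, e2, e3⟩ := exists_hasSide_of_incidence hi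
    rcases h.cases p with rfl | rfl | rfl
    · exact .inr ⟨(hside _ _ hd).2.1 e1, (hside _ _ hd').2.1 e2, e3⟩
    · exact .inl ⟨(hside _ _ hd).1.1 e1, (hside _ _ hd').1.1 e2, e3⟩
    · exact absurd rfl e1.ne
  · rintro ⟨hd, hd', ⟨k1, k2, k3⟩ | ⟨k1, k2, k3⟩⟩
    · obtain ⟨p, e1, e2, e3⟩ := exists_hasSide_of_incidence k3
      obtain rfl := e1.unique h.connected ((hside _ _ hd).1.2 k1).symm
      simpa using e3
    · obtain ⟨p, e1, e2, e3⟩ := exists_hasSide_of_incidence k3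
      obtain rfl := e1.unique h.connected ((hside _ _ hd).2.2 k1).symm
      simpa using e3

end IsTriangle

end FilmSurface

open FilmSurface

variable {S : Type w}

theorem CompatibleSurface.isTriangle {σ₁ σ₂ σ₃ : GraphClass S}
    (m : CompatibleSurface ![σ₁, σ₂, σ₃]) :
    m.surface.IsTriangle (m.vertex 0) (m.vertex 1) (m.vertex 2) where
  connected := m.connected
  cyc := m.cyc_vertex 0 1 2 (by decide) (by decide)
  cases v := by
    obtain ⟨i, rfl⟩ := m.vertex.surjective v
    fin_cases i <;> simp

/-- The graphs of two vertices alone do not determine the graph of the third vertex of a surface with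
three vertices.  They do as soon as the colors of the latter are bounded by the colors in one
solution. -/
theorem third_class_unique {σ₁ σ₂ s s' : GraphClass S} (m : CompatibleSurface ![σ₁, σ₂, s])
    (m' : CompatibleSurface ![σ₁, σ₂, s']) (h : s'.colors ⊆ s.colors) : s' = s := by
  have hm := m.isTriangle
  have hm' := m'.isTriangle
  have e1 : m.surface.cls (m.vertex 0) = σ₁ := m.cls_vertex 0
  have e2 : m.surface.cls (m.vertex 1) = σ₂ := m.cls_vertex 1
  have e3 : m.surface.cls (m.vertex 2) = s := m.cls_vertex 2
  have e1' : m'.surface.cls (m'.vertex 0) = σ₁ := m'.cls_vertex 0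
  have e2' : m'.surface.cls (m'.vertex 1) = σ₂ := m'.cls_vertex 1
  have e3' : m'.surface.cls (m'.vertex 2) = s' := m'.cls_vertex 2
  generalize m.vertex 0 = q₁ at *
  generalize m.vertex 1 = q₂ at *
  generalize m.vertex 2 = q₃ at *
  generalize m'.vertex 0 = p₁ at *
  generalize m'.vertex 1 = p₂ at *
  generalize m'.vertex 2 = p₃ at *
  by_cases hcol : s.colors ⊆ s'.colors
  · have hcol : s'.colors = s.colors := h.antisymm hcol
    apply GraphClass.incidence_injective
    funext k k'
    apply propext
    have i1 := hm.incidence_iff k k'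
    have i2 := hm'.incidence_iff k k'
    rw [e1, e2, e3] at i1
    rw [e1', e2', e3', hcol] at i2
    rw [i1, i2]
  · exfalso
    obtain ⟨c, hc, hc'⟩ := Set.not_subset.1 hcol
    -- the disk of color `c` has two vertices in the second surface and three vertices in the first
    have hc12 : c ∈ σ₁.colors ∧ c ∈ σ₂.colors := by
      have h0 : c ∈ σ₁.colors ∨ c ∈ σ₂.colors := by
        have := hm.rotate.rotate.mem_colors_or (d := c) (by rwa [e3])
        rwa [e1, e2] at this
      have k1 := hm'.mem_colors_or (d := c)
      have k2 := hm'.rotate.mem_colors_or (d := c)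
      rw [e1', e2', e3'] at k1
      rw [e2', e3', e1'] at k2
      tauto
    have hZ : m'.surface.HasSide c true p₂ p₁ := by
      refine hm'.rotate.hasSide_true' ?_ ?_
      · rw [e2']; exact hc12.2
      · rwa [e3']
    -- every half-edge at the target of `c` in the graph `σ₂` is a target, of a disk with three
    -- vertices in the first surface
    have step : ∀ d b, σ₂.incidence (c, true) (d, b) →
        b = true ∧ d ∈ σ₁.colors ∧ d ∈ σ₂.colors ∧ d ∈ s.colors := by
      intro d b hd
      have hd1 : d ∈ σ₁.colors := by
        rw [← e2'] at hd
        obtain ⟨p, k1, k2, -⟩ := exists_hasSide_of_incidence hd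
        obtain rfl := k1.unique hm'.connected hZ
        rw [← e1']
        exact k2.symm.mem_colors
      have hd2 : d ∈ σ₂.colors := GraphClass.incidence_colors_right _ hd
      have hQ : m.surface.HasSide c true q₂ q₃ := hm.rotate.hasSide_true
        (by rw [e2]; exact hc12.2) (by rwa [e3])
      rw [← e2] at hd
      obtain ⟨p, k1, k2, -⟩ := exists_hasSide_of_incidence hd
      obtain rfl := k1.unique hm.connected hQ
      have hd3 : d ∈ s.colors := by
        rw [← e3]
        exact k2.symm.mem_colors
      refine ⟨?_, hd1, hd2, hd3⟩
      by_contra hb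
      rw [Bool.not_eq_true] at hb
      subst hb
      exact not_mem_colors_of_cyc hm.connected k2.symm (cyc_rotate₂ hm.cyc) (by rwa [e1])
    have step' : ∀ d b, σ₁.incidence (c, false) (d, b) → σ₂.incidence (c, true) (d, !b) := by
      intro d b hd
      rw [← e1'] at hd
      obtain ⟨p, k1, k2, k3⟩ := exists_hasSide_of_incidence hd
      obtain rfl := k1.unique hm'.connected hZ.symm
      rwa [e2'] at k3
    have step'' : ∀ d b, σ₂.incidence (c, true) (d, b) → σ₁.incidence (c, false) (d, !b) := by
      intro d b hd
      rw [← e2'] at hd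
      obtain ⟨p, k1, k2, k3⟩ := exists_hasSide_of_incidence hd
      obtain rfl := k1.unique hm'.connected hZ
      rwa [e1'] at k3
    -- the two ends of `c` in `s`, with the edges joining them, are a component of `s`
    have hall : ∀ d ∈ s.colors, σ₂.incidence (c, true) (d, true) := by
      intro d hd
      refine s.forall_colors_of_closed (fun k => σ₂.incidence (c, true) (k.1, true)) ?_
        (fun _ _ _ h => h) (h := (c, true)) hc ?_ hd true
      · rintro ⟨d, b⟩ ⟨d', b'⟩ hi hP
        obtain ⟨-, m1, m2, m3⟩ := step _ _ hP
        rw [← e3] at hi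
        obtain ⟨p, k1, k2, k3⟩ := exists_hasSide_of_incidence hi
        cases b
        · have := hm.rotate.rotate.hasSide_false (d := d) (by rwa [e3]) (by rwa [e2])
          obtain rfl := k1.unique hm.connected this
          rw [e2] at k3
          have h0 := σ₂.incidence_trans hP k3
          obtain ⟨h1, -⟩ := step _ _ h0
          rwa [h1] at h0
        · have := hm.rotate.rotate.hasSide_true (d := d) (by rwa [e3]) (by rwa [e1])
          obtain rfl := k1.unique hm.connected this
          rw [e1] at k3
          have h0 := step' _ _ (σ₁.incidence_trans (step'' _ _ hP) k3)
          obtain ⟨h1, -⟩ := step _ _ h0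
          rwa [h1] at h0
      · exact (GraphClass.mem_colors_iff _ _ _).1 hc12.2
    obtain ⟨d, hd⟩ := s'.colors_nonempty
    have hi := hall d (h hd)
    rw [← e2'] at hi
    obtain ⟨p, k1, k2, -⟩ := exists_hasSide_of_incidence hi
    obtain rfl := k1.unique hm'.connected hZ
    exact not_mem_colors_of_cyc hm'.connected k2 (m'.surface.cyc_rotate _ _ _ hm'.cyc)
      (by rwa [e3'])

end Film

namespace Film
namespace FilmSurface

variable {S : Type w}

/-! ### Surfaces with two vertices -/

/-- The cells of the film surface with two vertices, called `true` and `false`, such that the graph of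
the vertex `true` is `G`: the edges of the surface are the vertices of `G`, and each disk is a bigon
given by an edge of `G`. -/
def bigonData (G : ColoredGraph S) : SurfaceData S where
  V := Bool
  E := G.V
  D := G.E
  C := G.E × Bool
  ends _ := s(true, false)
  disk c := c.1
  edge c := G.endpt c.2 c.1
  src c := c.2
  tgt c := !c.2
  color := G.color
  cyc _ _ _ := False

theorem bigon_joined (G : ColoredGraph S) (v w : Bool) : (bigonData G).Joined v w := by
  obtain ⟨e⟩ := G.nonemptyE
  have h : (bigonData G).Joined true false := .rel _ _ ⟨G.src e, rfl⟩
  have h' : (bigonData G).Joined false true := Relation.EqvGen.symm _ _ h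
  cases v <;> cases w
  · exact .refl _
  · exact h'
  · exact h
  · exact .refl _

theorem bigon_cyclic (G : ColoredGraph S) (χ : Bool → Bool) : (bigonData G).IsGraphCut χ := by
  obtain ⟨e₀⟩ := G.nonemptyE
  constructor
  · intro e e' h _ _
    have hne : χ true ≠ χ false := by
      obtain ⟨v, w, h1, h2⟩ := h
      have h1 : s(true, false) = s(v, w) := h1
      rcases Sym2.eq_iff.1 h1 with ⟨rfl, rfl⟩ | ⟨rfl, rfl⟩
      · exact h2
      · exact h2.symm
    have hall : ∀ e, (bigonData G).Crosses χ e := fun e => ⟨true, false, rfl, hne⟩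
    refine eqvGen_lift id ?_ (G.connected e e')
    rintro a b ⟨d, rfl, rfl⟩
    exact .rel _ _ ⟨hall _, hall _, (d, false), (d, true), rfl, rfl, rfl⟩
  · intro v w _ hvw
    have hadj : v ≠ w → ∃ e, (bigonData G).ends e = s(v, w) := by
      intro hne
      refine ⟨G.src e₀, ?_⟩
      change s(true, false) = s(v, w)
      cases v <;> cases w
      · exact absurd rfl hne
      · exact Sym2.eq_swap
      · rfl
      · exact absurd rfl hne
    by_cases h : v = w
    · subst h
      exact .refl _
    · exact .rel _ _ ⟨rfl, hvw.symm, hadj h⟩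

/-- The film surface with two vertices such that the graph of the vertex `true` is `G`. -/
def bigon (G : ColoredGraph S) : FilmSurface S where
  toSurfaceData := bigonData G
  finV := inferInstanceAs (Finite Bool)
  finE := G.finV
  finD := G.finE
  finC := by have := G.finE; exact inferInstanceAs (Finite (G.E × Bool))
  nonemptyV := ⟨true⟩
  ends_not_isDiag _ := by
    change ¬ (s(true, false) : Sym2 Bool).IsDiag
    simp
  ends_edge := by
    rintro ⟨c, _ | _⟩
    · exact Sym2.eq_swap
    · rfl
  circle := by
    rintro ⟨d, b⟩ ⟨d', b'⟩ h
    obtain rfl : d = d' := h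
    have h1 : ∀ t, (bigonData G).Next (d, t) (d, !t) := fun t => ⟨rfl, rfl⟩
    by_cases hb : b' = !b
    · subst hb
      exact .single (h1 b)
    · obtain rfl : b' = b := by cases b <;> cases b' <;> simp_all
      refine .tail (.single (h1 b')) ?_
      have := h1 (!b')
      rwa [Bool.not_not] at this
  src_inj := fun _ _ h h' => Prod.ext h h'
  tgt_inj := fun _ _ h h' => Prod.ext h (Bool.not_inj h')
  edge_inj := by
    rintro ⟨d, b⟩ ⟨d', b'⟩ h h'
    obtain rfl : d = d' := h
    have h' : G.endpt b d = G.endpt b' d := h'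
    cases b <;> cases b'
    · rfl
    · exact absurd h' (G.src_ne_tgt d)
    · exact absurd h'.symm (G.src_ne_tgt d)
    · rfl
  disk_surj := fun d => ⟨(d, true), rfl⟩
  edge_surj := fun v => by
    obtain ⟨b, e, h⟩ := G.exists_endpt v
    exact ⟨(e, b), h⟩
  src_surj := fun v => by
    obtain ⟨e⟩ := G.nonemptyE
    exact ⟨(e, v), rfl⟩
  cyc_rotate _ _ _ h := h
  cyc_asymm _ _ _ h := h.elim
  cyc_trans _ _ _ _ h := h.elim
  cyc_total := by
    intro x y z _ _ h1 h2 h3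
    have key : ∀ x y z : Bool, x ≠ y → y ≠ z → x ≠ z → False := by decide
    exact (key x y z h1 h2 h3).elim
  cyc_joined _ _ _ h := h.elim
  cyc_disk _ _ _ h := h
  color_inj _ _ _ h := G.color_injective h
  cyclic χ _ := bigon_cyclic G χ

theorem bigon_cls_true (G : ColoredGraph S) :
    (bigon G).cls true = Quotient.mk (ColoredGraph.setoid S) G := by
  apply GraphClass.incidence_injective
  refine (incidence_cls (bigon G) true).trans ?_
  have hcr : ∀ b (c : G.E × Bool), (bigon G).Crossing {true} b c ↔ c.2 = b := by
    rintro (_ | _) ⟨d, _ | _⟩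
    · exact iff_of_true (crossing_singleton.2.2 rfl) rfl
    · exact iff_of_false (fun h => Bool.false_ne_true (crossing_singleton.2.1 h)) (by simp)
    · exact iff_of_false (fun h => Bool.false_ne_true (crossing_singleton.1.1 h)) (by simp)
    · exact iff_of_true (crossing_singleton.1.2 rfl) rfl
  funext h h'
  apply propext
  constructor
  · rintro ⟨⟨d, b⟩, ⟨d', b'⟩, h1, h2, h3, h4, h5⟩
    obtain rfl : b = h.2 := (hcr _ _).1 h1
    obtain rfl : b' = h'.2 := (hcr _ _).1 h2
    exact ⟨d, d', h3, h4, h5⟩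
  · rintro ⟨d, d', h3, h4, h5⟩
    exact ⟨(d, h.2), (d', h'.2), (hcr _ _).2 rfl, (hcr _ _).2 rfl, h3, h4, h5⟩

end FilmSurface

open FilmSurface

variable {S : Type w}

/-- In a surface with two vertices the graphs of the vertices are opposite. -/
theorem FilmSurface.cls_eq_star {X : FilmSurface S} {q p : X.V}
    (h : ∀ v, v = q ∨ v = p) : X.cls p = (X.cls q).star := by
  apply GraphClass.incidence_injective
  rw [incidence_star_of_compl (incidence_cls X q) (J' := {p}), incidence_cls]
  intro c b
  have key : ∀ c, (X.src c = q ↔ X.tgt c = p) ∧ (X.src c = p ↔ X.tgt c = q) := by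
    intro c
    have h1 := h (X.src c)
    have h2 := h (X.tgt c)
    have h3 := src_ne_tgt c
    grind
  cases b
  · exact crossing_singleton.2.trans ((key c).1.symm.trans crossing_singleton.1.symm)
  · exact crossing_singleton.1.trans ((key c).2.trans crossing_singleton.2.symm)

theorem CompatibleSurface.eq_star {σ₁ σ₂ : GraphClass S} (m : CompatibleSurface ![σ₁, σ₂]) :
    σ₂ = σ₁.star := by
  have h := cls_eq_star (X := m.surface) (q := m.vertex 0) (p := m.vertex 1)
    (fun v => by
      obtain ⟨i, rfl⟩ := m.vertex.surjective v
      fin_cases i <;> simp)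
  have e1 : m.surface.cls (m.vertex 0) = σ₁ := m.cls_vertex 0
  have e2 : m.surface.cls (m.vertex 1) = σ₂ := m.cls_vertex 1
  rwa [e1, e2] at h

theorem bigon_connected (G : ColoredGraph S) : (bigon G).Connected := bigon_joined G

/-- For each class `σ` there is a film surface with two vertices with the classes `σ` and `σ*`. -/
theorem nonempty_compatibleSurface_star (σ : GraphClass S) :
    Nonempty (CompatibleSurface ![σ, σ.star]) := by
  induction σ using Quotient.ind with | _ G
  let e : Fin 2 ≃ Bool :=
    { toFun := ![true, false]
      invFun := fun b => bif b then 0 else 1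
      left_inv := by intro i; fin_cases i <;> rfl
      right_inv := by rintro (_ | _) <;> rfl }
  have h2 : (bigon G).cls false = ((bigon G).cls true).star := cls_eq_star (X := bigon G)
    (fun v => by
      have : ∀ v : Bool, v = true ∨ v = false := by decide
      exact this v)
  refine ⟨⟨bigon G, bigon_connected G, e, fun i j k h h' => by omega, fun i => ?_⟩⟩
  fin_cases i
  · exact bigon_cls_true G
  · exact h2.trans (congrArg _ (bigon_cls_true G))

end Film

namespace Film
namespace FilmSurface

variable {S : Type w} {X Y : FilmSurface S}

/-! ### Uniqueness of surfaces with given vertex graphs -/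

theorem exists_equiv_of_surjective {α β A B : Type*} {a : α → A} {b : β → B}
    (ha : Function.Surjective a) (hb : Function.Surjective b) (g : α ≃ β)
    (h : ∀ x y, a x = a y ↔ b (g x) = b (g y)) : ∃ e : A ≃ B, ∀ x, e (a x) = b (g x) := by
  have hs : ∀ x, b (g (Function.surjInv ha (a x))) = b (g x) := fun x => by
    rw [← h, Function.surjInv_eq ha]
  refine ⟨Equiv.ofBijective (fun y => b (g (Function.surjInv ha y))) ⟨fun y y' hy => ?_, fun z => ?_⟩,
    hs⟩
  · have := (h _ _).2 hy
    rwa [Function.surjInv_eq ha, Function.surjInv_eq ha] at this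
  · obtain ⟨x, rfl⟩ := hb z
    refine ⟨a (g.symm x), ?_⟩
    simp only [hs, Equiv.apply_symm_apply]

theorem side_ext (hX : X.Connected) {c c' : X.C} (h : X.color (X.disk c) = X.color (X.disk c'))
    (h' : X.src c = X.src c') : c = c' :=
  X.src_inj _ _ (X.color_inj _ _ (hX _ _) h) h'

/-- The vertex graphs tell which sides of disks are glued together. -/
theorem edge_eq_iff (hX : X.Connected) (c c' : X.C) :
    X.edge c = X.edge c' ↔ ∃ b, (bif b then X.src c' else X.tgt c') = X.src c ∧
      (X.cls (X.src c)).incidence (X.color (X.disk c), true) (X.color (X.disk c'), b) := by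
  simp only [incidence_cls]
  constructor
  · intro h
    have h1 := congrArg X.ends h
    rw [X.ends_edge, X.ends_edge] at h1
    rcases Sym2.eq_iff.1 h1 with ⟨h2, -⟩ | ⟨h2, -⟩
    · exact ⟨true, h2.symm, c, c', crossing_singleton.1.2 rfl, crossing_singleton.1.2 h2.symm, rfl,
        rfl, h⟩
    · exact ⟨false, h2.symm, c, c', crossing_singleton.1.2 rfl, crossing_singleton.2.2 h2.symm, rfl,
        rfl, h⟩
  · rintro ⟨b, hb, x, y, h1, h2, h3, h4, h5⟩
    obtain rfl := side_ext hX h3 (crossing_singleton.1.1 h1)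
    suffices y = c' by rw [h5, this]
    cases b
    · exact X.tgt_inj _ _ (X.color_inj _ _ (hX _ _) h4) ((crossing_singleton.2.1 h2).trans hb.symm)
    · exact side_ext hX h4 ((crossing_singleton.1.1 h2).trans hb.symm)

theorem hasSide_map (hX : X.Connected) (hY : Y.Connected) (f : X.V ≃ Y.V)
    (hcyc : ∀ x y z, Y.cyc (f x) (f y) (f z) ↔ X.cyc x y z) (hcls : ∀ q, Y.cls (f q) = X.cls q)
    {d : S} {q p : X.V} (h : X.HasSide d true q p) : Y.HasSide d true (f q) (f p) := by
  obtain ⟨r', hr⟩ := exists_hasSide (X := Y) (d := d) (q := f q) (by rw [hcls]; exact h.mem_colors)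
    true
  obtain ⟨r, rfl⟩ := f.surjective r'
  have hr0 : d ∈ (X.cls r).colors := by
    rw [← hcls]
    exact hr.symm.mem_colors
  have hp0 : d ∈ (Y.cls (f p)).colors := by
    rw [hcls]
    exact h.symm.mem_colors
  by_cases hrp : r = p
  · rwa [hrp] at hr
  · exfalso
    have hqr : q ≠ r := fun h => hr.ne (congrArg f h)
    rcases X.cyc_total q p r (hX _ _) (hX _ _) h.ne (Ne.symm hrp) hqr with k | k
    · exact not_mem_colors_of_cyc hY hr ((hcyc _ _ _).2 k) hp0
    · exact not_mem_colors_of_cyc hX h (cyc_rotate₂ k) hr0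

/-- A connected film surface is determined by its vertex graphs and the cyclic order of its vertices. -/
theorem exists_iso (hX : X.Connected) (hY : Y.Connected) (f : X.V ≃ Y.V)
    (hcyc : ∀ x y z, Y.cyc (f x) (f y) (f z) ↔ X.cyc x y z) (hcls : ∀ q, Y.cls (f q) = X.cls q) :
    ∃ φ : Iso X Y, φ.onV = f := by
  have hg : ∀ c : X.C, ∃ c' : Y.C, Y.color (Y.disk c') = X.color (X.disk c) ∧
      Y.src c' = f (X.src c) ∧ Y.tgt c' = f (X.tgt c) := fun c =>
    hasSide_map hX hY f hcyc hcls (d := X.color (X.disk c)) ⟨c, rfl, rfl, rfl⟩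
  choose g hg1 hg2 hg3 using hg
  have hbij : Function.Bijective g := by
    constructor
    · intro c c' h
      refine side_ext hX ?_ (f.injective ?_)
      · rw [← hg1, ← hg1, h]
      · rw [← hg2, ← hg2, h]
    · intro c'
      obtain ⟨c, h1, h2, h3⟩ := hasSide_map hY hX f.symm (fun x y z => by
        rw [← hcyc]
        simp) (fun q => by rw [← hcls, Equiv.apply_symm_apply])
        (d := Y.color (Y.disk c')) (q := Y.src c') (p := Y.tgt c') ⟨c', rfl, rfl, rfl⟩
      refine ⟨c, side_ext hY ((hg1 c).trans h1) ?_⟩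
      rw [hg2, h2, Equiv.apply_symm_apply]
  let onC := Equiv.ofBijective g hbij
  obtain ⟨onD, hD⟩ := exists_equiv_of_surjective X.disk_surj Y.disk_surj onC (fun x y => by
    constructor
    · intro h
      refine Y.color_inj _ _ (hY _ _) ?_
      change Y.color (Y.disk (g x)) = Y.color (Y.disk (g y))
      rw [hg1, hg1, h]
    · intro h
      refine X.color_inj _ _ (hX _ _) ?_
      replace h : Y.disk (g x) = Y.disk (g y) := h
      rw [← hg1, ← hg1, h])
  obtain ⟨onE, hE⟩ := exists_equiv_of_surjective X.edge_surj Y.edge_surj onC (fun x y => by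
    change _ ↔ Y.edge (g x) = Y.edge (g y)
    rw [edge_eq_iff hX, edge_eq_iff hY]
    refine exists_congr fun b => ?_
    rw [hg1, hg1, hg2 x, hcls]
    refine and_congr_left fun _ => ?_
    cases b
    · simp [hg3]
    · simp [hg2])
  refine ⟨⟨f, onE, onD, onC, ?_, fun c => (hD c).symm, fun c => (hE c).symm, hg2, hg3, ?_, hcyc⟩, rfl⟩
  · intro e
    obtain ⟨c, rfl⟩ := X.edge_surj e
    rw [hE, X.ends_edge, Y.ends_edge, Sym2.map_mk]
    exact congrArg₂ _ (hg2 c) (hg3 c)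
  · intro d
    obtain ⟨c, rfl⟩ := X.disk_surj d
    rw [hD]
    exact hg1 c

end FilmSurface

open FilmSurface

variable {S : Type w}

/-- The connected film surface with given vertex graphs in a given cyclic order is unique. -/
theorem CompatibleSurface.exists_iso {n : ℕ} {σ : Fin n → GraphClass S} (m m' : CompatibleSurface σ) :
    ∃ φ : FilmSurface.Iso m.surface m'.surface, ∀ i, φ.onV (m.vertex i) = m'.vertex i := by
  have key : ∀ (m m' : CompatibleSurface σ) (i j k : Fin n),
      m.surface.cyc (m.vertex i) (m.vertex j) (m.vertex k) →
      m'.surface.cyc (m'.vertex i) (m'.vertex j) (m'.vertex k) := by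
    intro m m' i j k h
    have n1 : i ≠ j := fun e => cyc_ne₁ h (by rw [e])
    have n2 : j ≠ k := fun e => cyc_ne₂ h (by rw [e])
    have n3 : i ≠ k := fun e => cyc_ne₃ h (by rw [e])
    have h' : ∀ i j k : Fin n, i < j → j < k → m.surface.cyc (m.vertex i) (m.vertex j) (m.vertex k) ∧
        m'.surface.cyc (m'.vertex i) (m'.vertex j) (m'.vertex k) :=
      fun i j k h1 h2 => ⟨m.cyc_vertex i j k h1 h2, m'.cyc_vertex i j k h1 h2⟩
    rcases lt_or_gt_of_ne n1 with h1 | h1 <;> rcases lt_or_gt_of_ne n2 with h2 | h2 <;>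
      rcases lt_or_gt_of_ne n3 with h3 | h3
    · exact (h' _ _ _ h1 h2).2
    · omega
    · exact absurd h (m.surface.cyc_asymm _ _ _ (m.surface.cyc_rotate _ _ _ (h' _ _ _ h3 h2).1))
    · exact m'.surface.cyc_rotate _ _ _ (h' _ _ _ h3 h1).2
    · exact absurd h (m.surface.cyc_asymm _ _ _ (cyc_rotate₂ (h' _ _ _ h1 h3).1))
    · exact cyc_rotate₂ (h' _ _ _ h2 h3).2
    · omega
    · exact absurd h (m.surface.cyc_asymm _ _ _ (h' _ _ _ h2 h1).1)
  obtain ⟨φ, hφ⟩ := FilmSurface.exists_iso m.connected m'.connected (m.vertex.symm.trans m'.vertex)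
    (fun x y z => by
      obtain ⟨i, rfl⟩ := m.vertex.surjective x
      obtain ⟨j, rfl⟩ := m.vertex.surjective y
      obtain ⟨k, rfl⟩ := m.vertex.surjective z
      simp only [Equiv.trans_apply, Equiv.symm_apply_apply]
      exact ⟨key m' m i j k, key m m' i j k⟩)
    (fun q => by
      obtain ⟨i, rfl⟩ := m.vertex.surjective q
      simp only [Equiv.trans_apply, Equiv.symm_apply_apply]
      rw [m.cls_vertex, m'.cls_vertex])
  refine ⟨φ, fun i => ?_⟩
  rw [hφ]
  simp

end Film

namespace Film

/-! ### The products of a graph-Frobenius algebra -/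

section Algebra

variable {K : Type u} [Field K] {S : Type w} {B : GraphClass S → Type v}
  [∀ σ, AddCommGroup (B σ)] [∀ σ, Module K (B σ)]

variable (K B) in
/-- The inclusion of a homogeneous component as a linear map. -/
noncomputable def inclₗ (σ : GraphClass S) : B σ →ₗ[K] ⨁ σ, B σ := DirectSum.lof K _ B σ

theorem inclₗ_apply {σ : GraphClass S} (x : B σ) : inclₗ K B σ x = incl x := rfl

theorem incl_injective {σ : GraphClass S} {x y : B σ} (h : incl x = incl y) : x = y :=
  DirectSum.of_injective σ h

variable (B) in
/-- The homogeneous elements of degree `σ`. -/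
def IsHom (σ : GraphClass S) (x : ⨁ σ, B σ) : Prop := ∃ z : B σ, incl z = x

theorem isHom_incl {σ : GraphClass S} (z : B σ) : IsHom B σ (incl z) := ⟨z, rfl⟩

theorem incl_castB {σ τ : GraphClass S} (h : σ = τ) (x : B σ) :
    incl (castB (K := K) h x) = incl x := by
  subst h
  rfl

theorem linearMap_ext_incl {M : Type*} [AddCommGroup M] [Module K M] {f g : (⨁ σ, B σ) →ₗ[K] M}
    (h : ∀ σ (x : B σ), f (incl x) = g (incl x)) : f = g :=
  DirectSum.linearMap_ext K fun σ => LinearMap.ext fun x => h σ x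

namespace GraphFrobenius

variable (G : GraphFrobenius K B)

/-- The pairing of opposite homogeneous components, as a map to the dual space. -/
noncomputable def pairing (σ : GraphClass S) : B σ.star →ₗ[K] Module.Dual K (B σ) :=
  G.bil.compl₁₂ (inclₗ K B σ.star) (inclₗ K B σ)

theorem pairing_apply (σ : GraphClass S) (x : B σ.star) (y : B σ) :
    G.pairing σ x y = G.bil (incl x) (incl y) := rfl

theorem pairing_injective (σ : GraphClass S) : Function.Injective (G.pairing σ) := by
  rw [← LinearMap.ker_eq_bot, LinearMap.ker_eq_bot']
  intro x hx
  refine incl_injective (σ := σ.star) ?_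
  rw [show incl (0 : B σ.star) = 0 from map_zero (inclₗ K B _)]
  refine G.nondegenerate.1 _ fun y => ?_
  suffices G.bil (incl x) = 0 by rw [this, LinearMap.zero_apply]
  refine linearMap_ext_incl fun τ z => ?_
  by_cases h : σ.star = τ.star
  · obtain rfl := GraphClass.star_injective h
    exact LinearMap.congr_fun hx z
  · exact G.bil_eq_zero x z h

theorem eq_of_bil_eq {σ : GraphClass S} {x y : ⨁ σ, B σ} (hx : IsHom B σ.star x)
    (hy : IsHom B σ.star y) (h : ∀ z : B σ, G.bil x (incl z) = G.bil y (incl z)) : x = y := by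
  obtain ⟨x, rfl⟩ := hx
  obtain ⟨y, rfl⟩ := hy
  rw [G.pairing_injective σ (LinearMap.ext h)]

variable [∀ σ, FiniteDimensional K (B σ)]

theorem finrank_star (G : GraphFrobenius K B) (σ : GraphClass S) :
    Module.finrank K (B σ.star) = Module.finrank K (B σ) := by
  have h : ∀ σ, Module.finrank K (B σ.star) ≤ Module.finrank K (B σ) := fun σ => by
    rw [← Subspace.dual_finrank_eq (V := B σ)]
    exact LinearMap.finrank_le_finrank_of_injective (G.pairing_injective σ)
  refine (h σ).antisymm ?_
  have := h σ.star
  rwa [GraphClass.star_star] at this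

/-- The pairing of opposite homogeneous components is perfect. -/
noncomputable def pairingEquiv (σ : GraphClass S) : B σ.star ≃ₗ[K] Module.Dual K (B σ) :=
  LinearMap.linearEquivOfInjective (G.pairing σ) (G.pairing_injective σ)
    ((G.finrank_star σ).trans Subspace.dual_finrank_eq.symm)

theorem pairingEquiv_symm_apply (σ : GraphClass S) (f : Module.Dual K (B σ)) (y : B σ) :
    G.bil (incl ((G.pairingEquiv σ).symm f)) (incl y) = f y := by
  rw [← G.pairing_apply]
  exact LinearMap.congr_fun ((G.pairingEquiv σ).apply_symm_apply f) y

/-- The product of two elements with values in the component `σ*`: it is defined by the condition that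
`(x y, z) = (x, y, z)` for all `z` in the component `σ`. -/
noncomputable def mul (σ : GraphClass S) : (⨁ σ, B σ) →ₗ[K] (⨁ σ, B σ) →ₗ[K] (⨁ σ, B σ) :=
  (G.tri.compr₂ (LinearMap.lcomp K K (inclₗ K B σ))).compr₂
    (inclₗ K B σ.star ∘ₗ (G.pairingEquiv σ).symm.toLinearMap)

theorem isHom_mul (σ : GraphClass S) (x y : ⨁ σ, B σ) : IsHom B σ.star (G.mul σ x y) :=
  isHom_incl _

theorem bil_mul {σ : GraphClass S} (x y : ⨁ σ, B σ) {z : ⨁ σ, B σ} (hz : IsHom B σ z) :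
    G.bil (G.mul σ x y) z = G.tri x y z := by
  obtain ⟨z, rfl⟩ := hz
  exact G.pairingEquiv_symm_apply σ _ z

theorem mul_eq_sum (σ : GraphClass S) {b : BasisFamily K B} {F : MatrixFamily K B}
    (hF : IsInverseGram K G.bil b F) (x y : ⨁ σ, B σ) :
    G.mul σ x y =
      ∑ i, ∑ j, (G.tri x y (incl (b σ i)) * F σ i j) • incl (b σ.star j) := by
  have hhom : ∑ i, ∑ j, (G.tri x y (incl (b σ i)) * F σ i j) • incl (b σ.star j) =
      inclₗ K B σ.star (∑ i, ∑ j, (G.tri x y (incl (b σ i)) * F σ i j) • b σ.star j) := by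
    simp only [map_sum, map_smul, inclₗ_apply]
  refine G.eq_of_bil_eq (G.isHom_mul _ _ _) (hhom ▸ isHom_incl _) fun z => ?_
  rw [G.bil_mul _ _ (isHom_incl z)]
  suffices h : (G.tri x y) ∘ₗ inclₗ K B σ = (G.bil (∑ i, ∑ j,
      (G.tri x y (incl (b σ i)) * F σ i j) • incl (b σ.star j))) ∘ₗ inclₗ K B σ from
    LinearMap.congr_fun h z
  refine (b σ).ext fun k => ?_
  have h1 : ∀ i, ∑ j, F σ i j * G.bil (incl (b σ.star j)) (incl (b σ k)) = if i = k then 1 else 0 :=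
    fun i => by
      have := congrFun (congrFun (hF σ).1 i) k
      rwa [Matrix.mul_apply, Matrix.one_apply] at this
  simp only [LinearMap.comp_apply, inclₗ_apply, map_sum, map_smul, LinearMap.sum_apply,
    LinearMap.smul_apply, smul_eq_mul, mul_assoc]
  simp only [← Finset.mul_sum, h1]
  simp

theorem exists_isInverseGram (b : BasisFamily K B) : ∃ F, IsInverseGram K G.bil b F := by
  refine ⟨fun σ i j => (b σ.star).repr ((G.pairingEquiv σ).symm ((b σ).coord i)) j, fun σ => ?_⟩
  have h1 : (Matrix.of fun i j => (b σ.star).repr ((G.pairingEquiv σ).symm ((b σ).coord i)) j) *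
      Matrix.of (fun j i => G.bil (incl (b σ.star j)) (incl (b σ i))) = 1 := by
    ext i k
    rw [Matrix.mul_apply, Matrix.one_apply]
    have h2 := G.pairingEquiv_symm_apply σ ((b σ).coord i) (b σ k)
    rw [← (b σ.star).sum_repr ((G.pairingEquiv σ).symm ((b σ).coord i)), ← inclₗ_apply (K := K)] at h2
    simp only [map_sum, map_smul, LinearMap.sum_apply, LinearMap.smul_apply, smul_eq_mul,
      inclₗ_apply, Module.Basis.coord_apply, Module.Basis.repr_self] at h2
    refine h2.trans ?_
    rw [Finsupp.single_apply]
    exact if_congr eq_comm rfl rfl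
  refine ⟨h1, ?_⟩
  exact (Matrix.mul_eq_one_comm_of_card_eq _ _ _ (by simpa using (G.finrank_star σ).symm)).1 h1

theorem tri_mul_eq {σ₁ σ₂ σ₃ σ₄ s t : GraphClass S}
    (h : Nonempty (CompatibleSurface ![σ₁, σ₂, σ₃, σ₄]))
    (h1 : Nonempty (CompatibleSurface ![σ₁, σ₂, s]))
    (h2 : Nonempty (CompatibleSurface ![s.star, σ₃, σ₄]))
    (h3 : Nonempty (CompatibleSurface ![σ₄, σ₁, t]))
    (h4 : Nonempty (CompatibleSurface ![t.star, σ₂, σ₃]))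
    {x₁ x₂ x₃ x₄ : ⨁ σ, B σ} (e1 : IsHom B σ₁ x₁) (e2 : IsHom B σ₂ x₂) (e3 : IsHom B σ₃ x₃)
    (e4 : IsHom B σ₄ x₄) :
    G.tri (G.mul s x₁ x₂) x₃ x₄ = G.tri (G.mul t x₄ x₁) x₂ x₃ := by
  obtain ⟨x₁, rfl⟩ := e1
  obtain ⟨x₂, rfl⟩ := e2
  obtain ⟨x₃, rfl⟩ := e3
  obtain ⟨x₄, rfl⟩ := e4
  let b : BasisFamily K B := fun σ => Module.finBasis K (B σ)
  obtain ⟨F, hF⟩ := G.exists_isInverseGram b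
  have := G.assoc h h1 h2 h3 h4 b F hF x₁ x₂ x₃ x₄
  rw [G.mul_eq_sum s hF, G.mul_eq_sum t hF]
  simpa only [map_sum, map_smul, LinearMap.sum_apply, LinearMap.smul_apply, smul_eq_mul] using this

/-- Associativity of the products, for the degrees `s*` and `t` of the partial products. -/
theorem mul_assoc' {σ₁ σ₂ σ₃ σ₄ s t : GraphClass S}
    (h : Nonempty (CompatibleSurface ![σ₁, σ₂, σ₃, σ₄]))
    (h1 : Nonempty (CompatibleSurface ![σ₁, σ₂, s]))
    (h2 : Nonempty (CompatibleSurface ![s.star, σ₃, σ₄]))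
    (h3 : Nonempty (CompatibleSurface ![σ₄, σ₁, t]))
    (h4 : Nonempty (CompatibleSurface ![t.star, σ₂, σ₃]))
    {x y z : ⨁ σ, B σ} (e1 : IsHom B σ₁ x) (e2 : IsHom B σ₂ y) (e3 : IsHom B σ₃ z) :
    G.mul σ₄ (G.mul s x y) z = G.mul σ₄ x (G.mul t.star y z) := by
  refine G.eq_of_bil_eq (G.isHom_mul _ _ _) (G.isHom_mul _ _ _) fun w => ?_
  have hw := isHom_incl w
  have hyz : IsHom B t (G.mul t.star y z) := by
    have := G.isHom_mul t.star y z
    rwa [GraphClass.star_star] at this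
  rw [G.bil_mul _ _ hw, G.bil_mul _ _ hw, G.tri_mul_eq h h1 h2 h3 h4 e1 e2 e3 hw, G.tri_cyclic,
    ← G.bil_mul y z (G.isHom_mul t _ _), G.bil_symm, G.bil_mul _ _ hyz, G.tri_cyclic]

/-- The tensor inverse to the pairing of `B σ*` and `B σ`. -/
noncomputable def copairing (σ : GraphClass S) : B σ ⊗[K] B σ.star :=
  ∑ i, Module.finBasis K (B σ) i ⊗ₜ[K] (G.pairingEquiv σ).symm ((Module.finBasis K (B σ)).coord i)

end GraphFrobenius

/-- The contraction of a tensor with linear forms on both of its factors. -/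
noncomputable def contract₂ {σ τ : GraphClass S} (f g : (⨁ σ, B σ) →ₗ[K] K) :
    B σ ⊗[K] B τ →ₗ[K] K :=
  LinearMap.mul' K K ∘ₗ TensorProduct.map (f ∘ₗ inclₗ K B σ) (g ∘ₗ inclₗ K B τ)

theorem contract₂_tmul {σ τ : GraphClass S} (f g : (⨁ σ, B σ) →ₗ[K] K) (x : B σ) (y : B τ) :
    contract₂ f g (x ⊗ₜ[K] y) = f (incl x) * g (incl y) := rfl

namespace GraphFrobenius

variable (G : GraphFrobenius K B) [∀ σ, FiniteDimensional K (B σ)]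

theorem contract₂_copairing {σ : GraphClass S} (f : (⨁ σ, B σ) →ₗ[K] K) {c : ⨁ σ, B σ}
    (hc : IsHom B σ c) : contract₂ f (G.bil.flip c) (G.copairing σ) = f c := by
  obtain ⟨c, rfl⟩ := hc
  simp only [copairing, map_sum, contract₂_tmul, LinearMap.flip_apply, G.pairingEquiv_symm_apply]
  conv_rhs => rw [← (Module.finBasis K (B σ)).sum_repr c, ← inclₗ_apply (K := K)]
  simp only [map_sum, map_smul, inclₗ_apply, Module.Basis.coord_apply, smul_eq_mul]
  exact Finset.sum_congr rfl fun i _ => mul_comm _ _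

/-- The copairing is determined by its contractions with the bilinear form. -/
theorem eq_copairing {σ : GraphClass S} (k : B σ ⊗[K] B σ.star)
    (hk : ∀ (a : B σ.star) (c : B σ),
      contract₂ (G.bil.flip (incl a)) (G.bil.flip (incl c)) k = G.bil (incl c) (incl a)) :
    k = G.copairing σ := by
  -- the tensors are identified with endomorphisms of `B σ`
  let e : B σ ⊗[K] B σ.star ≃ₗ[K] (B σ →ₗ[K] B σ) :=
    (TensorProduct.congr (LinearEquiv.refl K (B σ)) (G.pairingEquiv σ)).trans
      ((TensorProduct.comm K _ _).trans (dualTensorHomEquiv K (B σ) (B σ)))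
  have he : ∀ k a c, contract₂ (G.bil.flip (incl a)) (G.bil.flip (incl c)) k =
      G.bil (incl (e k c)) (incl (a : B σ.star)) := by
    intro k a c
    induction k using TensorProduct.induction_on with
    | zero =>
      rw [map_zero, map_zero, LinearMap.zero_apply, ← inclₗ_apply (K := K), map_zero, map_zero,
        LinearMap.zero_apply]
    | tmul p q =>
      have h1 : e (p ⊗ₜ[K] q) c = G.bil (incl q) (incl c) • p := rfl
      rw [h1, contract₂_tmul, ← inclₗ_apply (K := K) (_ • p), map_smul, map_smul,
        LinearMap.smul_apply, smul_eq_mul, mul_comm]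
      rfl
    | add k k' h h' =>
      rw [map_add, h, h', map_add, LinearMap.add_apply, ← inclₗ_apply (K := K) (_ + _), map_add,
        map_add, LinearMap.add_apply]
      rfl
  apply e.injective
  ext c
  have hinj := G.pairing_injective σ.star
  have h2 : ∀ k k' : B σ, (∀ a : B σ.star, G.bil (incl k) (incl a) = G.bil (incl k') (incl a)) →
      k = k' := by
    intro k k' h
    apply (castB (K := K) (B := B) (GraphClass.star_star σ).symm).injective
    refine hinj (LinearMap.ext fun a => ?_)
    rw [G.pairing_apply, G.pairing_apply, incl_castB, incl_castB, h]
  refine h2 _ _ fun a => ?_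
  rw [← he, ← he, hk, G.contract₂_copairing _ (isHom_incl c)]
  rfl

end GraphFrobenius

end Algebra

end Film

namespace Film
namespace FilmSurface

variable {S : Type w} (X : FilmSurface S)

/-! ### Lists of vertices in cyclic order -/

/-- The list `l` runs once through the vertices of a component in their cyclic order. -/
structure IsCycle (l : List X.V) : Prop where
  ne_nil : l ≠ []
  nodup : l.Nodup
  joined : ∀ v ∈ l, ∀ w, X.Joined v w ↔ w ∈ l
  cyc : ∀ a b c, List.Sublist [a, b, c] l → X.cyc a b c

/-- The half-edge relation of the graph that cuts off the vertices in a list. -/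
abbrev listRel (l : List X.V) : S × Bool → S × Bool → Prop := X.sideRel {v | v ∈ l}

variable {X}

theorem listRel_singleton (v : X.V) : X.listRel [v] = (X.cls v).incidence := by
  have h : {w | w ∈ [v]} = ({v} : Set X.V) := by
    ext w
    simp
  rw [listRel, h, incidence_cls]

namespace IsCycle

theorem rotate_one {v : X.V} {l : List X.V} (h : X.IsCycle (v :: l)) : X.IsCycle (l ++ [v]) where
  ne_nil := by simp
  nodup := by
    exact (List.perm_append_singleton v l).nodup_iff.2 h.nodup
  joined w hw x := by
    have := h.joined w (by simpa [or_comm] using hw) x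
    rw [this]
    simp [or_comm]
  cyc a b c hs := by
    obtain ⟨l₁, l₂, h1, h2, h3⟩ := List.sublist_append_iff.1 hs
    rcases List.sublist_singleton.1 h3 with rfl | rfl
    · rw [List.append_nil] at h1
      subst h1
      exact h.cyc _ _ _ (h2.trans (List.sublist_cons_self _ _))
    · rw [show [a, b, c] = [a, b] ++ [c] from rfl] at h1
      obtain ⟨rfl, h4⟩ := List.append_inj' h1 rfl
      obtain rfl : c = v := by simpa using h4
      exact X.cyc_rotate _ _ _ (h.cyc _ _ _ (h2.cons_cons c))

theorem rotate {l₁ l₂ : List X.V} (h : X.IsCycle (l₁ ++ l₂)) : X.IsCycle (l₂ ++ l₁) := by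
  induction l₁ generalizing l₂ with
  | nil => simpa using h
  | cons v l ih =>
    have h1 := rotate_one (l := l ++ l₂) h
    rw [List.append_assoc] at h1
    have h2 := ih h1
    rwa [List.append_assoc] at h2

theorem cyc_of_sublist_pair {l₁ l₂ : List X.V} (h : X.IsCycle (l₁ ++ l₂)) {a b c : X.V}
    (hab : List.Sublist [a, b] l₁) (hc : c ∈ l₂) : X.cyc a b c :=
  h.cyc a b c (hab.append (List.singleton_sublist.2 hc))

theorem isArc {l₁ l₂ : List X.V} (h : X.IsCycle (l₁ ++ l₂)) (h1 : l₁ ≠ []) (h2 : l₂ ≠ []) :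
    X.IsArc {v | v ∈ l₁} where
  joined a ha b hb := (h.joined a (List.mem_append_left _ ha) b).2 (List.mem_append_left _ hb)
  proper := by
    obtain ⟨a, ha⟩ := List.exists_mem_of_ne_nil _ h1
    obtain ⟨b, hb⟩ := List.exists_mem_of_ne_nil _ h2
    refine ⟨a, ha, b, fun hb' => ?_, (h.joined a (List.mem_append_left _ ha) b).2
      (List.mem_append_right _ hb)⟩
    exact (List.nodup_append.1 h.nodup).2.2 b hb' b hb rfl
  noncrossing a ha a' ha' b hb b' hb' k k' := by
    have hmem : ∀ x, X.Joined a x → x ∉ l₁ → x ∈ l₂ := fun x hx hn =>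
      (List.mem_append.1 ((h.joined a (List.mem_append_left _ ha) x).1 hx)).resolve_left hn
    have hb2 := hmem b (X.cyc_joined _ _ _ k) hb
    have hb2' := hmem b' (Joined.trans (X.cyc_joined _ _ _ (cyc_rotate₂ k')) (X.cyc_joined _ _ _ k')) hb'
    obtain ⟨i, hi, rfl⟩ := List.getElem_of_mem ha
    obtain ⟨j, hj, rfl⟩ := List.getElem_of_mem ha'
    have hsub : ∀ {i j : ℕ} (hi : i < l₁.length) (hj : j < l₁.length), i < j →
        List.Sublist [l₁[i], l₁[j]] l₁ := by
      intro i j hi hj hij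
      have := List.pairwise_iff_getElem.1
        (List.pairwise_iff_forall_sublist.2 (fun {a b} (h : List.Sublist [a, b] l₁) => h))
      exact this i j hi hj hij
    rcases lt_trichotomy i j with hij | rfl | hij
    · exact X.cyc_asymm _ _ _ (h.cyc_of_sublist_pair (hsub hi hj hij) hb2) (X.cyc_rotate _ _ _ k)
    · exact cyc_ne₃ k rfl
    · exact X.cyc_asymm _ _ _ (h.cyc_of_sublist_pair (hsub hj hi hij) hb2') (X.cyc_rotate _ _ _ k')

theorem crossing_compl {l₁ l₂ : List X.V} (h : X.IsCycle (l₁ ++ l₂)) (c : X.C) (b : Bool) :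
    X.Crossing {v | v ∈ l₂} b c ↔ X.Crossing {v | v ∈ l₁} (!b) c := by
  have h1 : ∀ {x y}, X.Joined x y → x ∈ l₁ ∨ x ∈ l₂ → y ∈ l₁ ∨ y ∈ l₂ := fun hj hx =>
    List.mem_append.1 ((h.joined _ (List.mem_append.2 hx) _).1 hj)
  have h2 : ∀ x, x ∈ l₁ → x ∈ l₂ → False := fun x hx hx' =>
    (List.nodup_append.1 h.nodup).2.2 x hx x hx' rfl
  have e1 := h1 (joined_side c)
  have e2 := h1 (joined_side c).symm
  have e3 := h2 (X.src c)
  have e4 := h2 (X.tgt c)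
  cases b
  · change (X.src c ∉ l₂ ∧ X.tgt c ∈ l₂) ↔ (X.src c ∈ l₁ ∧ X.tgt c ∉ l₁)
    tauto
  · change (X.src c ∈ l₂ ∧ X.tgt c ∉ l₂) ↔ (X.src c ∉ l₁ ∧ X.tgt c ∈ l₁)
    tauto

theorem exists_class {l₁ l₂ : List X.V} (h : X.IsCycle (l₁ ++ l₂)) (h1 : l₁ ≠ []) (h2 : l₂ ≠ []) :
    ∃ σ : GraphClass S, σ.incidence = X.listRel l₁ ∧ σ.star.incidence = X.listRel l₂ := by
  obtain ⟨σ, hσ⟩ := (h.isArc h1 h2).exists_class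
  exact ⟨σ, hσ, incidence_star_of_compl hσ h.crossing_compl⟩

theorem isClopen {l : List X.V} (h : X.IsCycle l) : X.IsClopen {v | v ∈ l} where
  nonempty := List.exists_mem_of_ne_nil _ h.ne_nil
  closed hj hv := (h.joined _ hv _).1 hj

/-- Blocks of consecutive vertices of a component can be contracted to single vertices. -/
theorem nonempty_compatibleSurface {L : List (List X.V)} (hL : X.IsCycle L.flatten)
    (hne : ∀ l ∈ L, l ≠ []) (h2 : 2 ≤ L.length) {σ : Fin L.length → GraphClass S}
    (hσ : ∀ i, (σ i).incidence = X.listRel (L.get i)) : Nonempty (CompatibleSurface σ) := by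
  have hU := hL.isClopen
  have hconn : (restrict hU).Connected := fun v w => (restrict_joined hU).2
    ((hL.joined _ v.2 _).2 w.2)
  have hex : ∀ x : (restrict hU).V, ∃ i : Fin L.length, x.1 ∈ L.get i := by
    rintro ⟨x, hx⟩
    obtain ⟨l, hl, hxl⟩ := List.mem_flatten.1 hx
    obtain ⟨i, rfl⟩ := List.get_of_mem hl
    exact ⟨i, hxl⟩
  choose p hp using hex
  have hp' : ∀ (x : (restrict hU).V) i, x.1 ∈ L.get i ↔ p x = i := by
    intro x i
    refine ⟨fun hi => ?_, fun hi => hi ▸ hp x⟩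
    by_contra hne
    have hd := (List.nodup_flatten.1 hL.nodup).2
    rw [List.pairwise_iff_get] at hd
    rcases lt_or_gt_of_ne hne with h | h
    · exact hd _ _ h (hp x) hi
    · exact hd _ _ h hi (hp x)
  have hmem : ∀ i, ∀ x ∈ L.get i, x ∈ L.flatten := fun i x hx =>
    List.mem_flatten.2 ⟨_, List.get_mem L i, hx⟩
  refine exists_compatibleSurface h2 (restrict hU) hconn p ⟨?_, ?_, ?_⟩ ?_
  · intro i
    obtain ⟨x, hx⟩ := List.exists_mem_of_ne_nil _ (hne _ (List.get_mem L i))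
    exact ⟨⟨x, hmem i x hx⟩, (hp' _ _).1 hx⟩
  · intro a b c hab hbc
    refine hL.cyc a.1 b.1 c.1 ?_
    have h1 : List.Sublist [L.get (p a), L.get (p b), L.get (p c)] L := by
      rw [List.sublist_iff_exists_fin_orderEmbedding_get_eq]
      refine ⟨OrderEmbedding.ofStrictMono ![p a, p b, p c] ?_, ?_⟩
      · intro i j hij
        fin_cases i <;> fin_cases j <;> simp_all
        · exact hab.trans hbc
      · intro i
        fin_cases i <;> rfl
    refine List.Sublist.trans ?_ h1.flatten
    have := (List.singleton_sublist.2 (hp a)).append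
      ((List.singleton_sublist.2 (hp b)).append (List.singleton_sublist.2 (hp c)))
    simpa using this
  · intro a a' b b' h1 h2' h3
    have hsplit : L.flatten = (L.take (p a)).flatten ++ (L.get (p a) ++ (L.drop (p a + 1)).flatten) := by
      conv_lhs => rw [← List.take_append_drop (p a) L, List.drop_eq_getElem_cons (p a).2]
      rw [List.flatten_append, List.flatten_cons]
      rfl
    have hc := hL
    rw [hsplit] at hc
    have hc := hc.rotate
    rw [List.append_assoc] at hc
    have hb : b.1 ∉ L.get (p a) := fun h => h2' ((hp' _ _).1 h)
    have harc := hc.isArc (hne _ (List.get_mem _ _)) (by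
      have : b.1 ∈ L.get (p a) ++ ((L.drop (p a + 1)).flatten ++ (L.take (p a)).flatten) := by
        rw [← hc.joined a.1 (List.mem_append_left _ (hp a))]
        exact (hL.joined _ a.2 _).2 b.2
      intro hnil
      rw [hnil, List.append_nil] at this
      exact hb this)
    exact harc.noncrossing a.1 (hp a) a'.1 (h1 ▸ hp a') b.1 hb b'.1
      (fun h => h3 ((hp' _ _).1 h))
  · intro i
    rw [hσ i, ← (restrictEmb hU).sideRel_image]
    refine congrArg X.sideRel (Set.ext fun x => ⟨fun hx => ?_, ?_⟩)
    · exact ⟨⟨x, hmem i x hx⟩, (hp' _ _).1 hx, rfl⟩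
    · rintro ⟨y, hy, rfl⟩
      exact (hp' _ _).2 hy

theorem nonempty_compatibleSurface₃ {l₁ l₂ l₃ : List X.V} (h : X.IsCycle (l₁ ++ (l₂ ++ l₃)))
    (h1 : l₁ ≠ []) (h2 : l₂ ≠ []) (h3 : l₃ ≠ []) {σ₁ σ₂ σ₃ : GraphClass S}
    (e1 : σ₁.incidence = X.listRel l₁) (e2 : σ₂.incidence = X.listRel l₂)
    (e3 : σ₃.incidence = X.listRel l₃) : Nonempty (CompatibleSurface ![σ₁, σ₂, σ₃]) := by
  refine nonempty_compatibleSurface (L := [l₁, l₂, l₃]) (by simpa using h) (by simp [h1, h2, h3])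
    (by simp) (σ := ![σ₁, σ₂, σ₃]) fun i => ?_
  fin_cases i
  · exact e1
  · exact e2
  · exact e3

theorem nonempty_compatibleSurface₄ {l₁ l₂ l₃ l₄ : List X.V}
    (h : X.IsCycle (l₁ ++ (l₂ ++ (l₃ ++ l₄))))
    (h1 : l₁ ≠ []) (h2 : l₂ ≠ []) (h3 : l₃ ≠ []) (h4 : l₄ ≠ []) {σ₁ σ₂ σ₃ σ₄ : GraphClass S}
    (e1 : σ₁.incidence = X.listRel l₁) (e2 : σ₂.incidence = X.listRel l₂)
    (e3 : σ₃.incidence = X.listRel l₃) (e4 : σ₄.incidence = X.listRel l₄) :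
    Nonempty (CompatibleSurface ![σ₁, σ₂, σ₃, σ₄]) := by
  refine nonempty_compatibleSurface (L := [l₁, l₂, l₃, l₄]) (by simpa using h)
    (by simp [h1, h2, h3, h4]) (by simp) (σ := ![σ₁, σ₂, σ₃, σ₄]) fun i => ?_
  fin_cases i
  · exact e1
  · exact e2
  · exact e3
  · exact e4

/-- Two cyclic lists of the vertices of the same component are rotations of each other. -/
theorem eq_rotate {l l' : List X.V} (h : X.IsCycle l) (h' : X.IsCycle l') {v : X.V} (hv : v ∈ l)
    (hv' : v ∈ l') : ∃ l₁ l₂, l = l₁ ++ l₂ ∧ l' = l₂ ++ l₁ := by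
  have hmem : ∀ w, w ∈ l ↔ w ∈ l' := fun w => (h.joined v hv w).symm.trans (h'.joined v hv' w)
  obtain ⟨q, t, rfl⟩ := List.exists_cons_of_ne_nil h'.ne_nil
  obtain ⟨a, b, rfl⟩ := List.append_of_mem ((hmem q).2 (by simp))
  have hc := h.rotate
  refine ⟨a, q :: b, rfl, ?_⟩
  have key : ∀ {q : X.V} {t : List X.V}, X.IsCycle (q :: t) → t.Pairwise (X.cyc q) := fun hq =>
    List.pairwise_iff_forall_sublist.2 fun hs => hq.cyc _ _ _ (hs.cons_cons _)
  have hperm : t.Perm (b ++ a) := by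
    rw [List.perm_ext_iff_of_nodup (List.nodup_cons.1 h'.nodup).2
      (List.nodup_cons.1 (show (q :: (b ++ a)).Nodup from hc.nodup)).2]
    intro w
    have h1 := hmem w
    have h2 := (List.nodup_cons.1 h'.nodup).1
    have h3 := (List.nodup_cons.1 (show (q :: (b ++ a)).Nodup from hc.nodup)).1
    simp only [List.mem_append, List.mem_cons] at h1 h3 ⊢
    by_cases hw : w = q
    · subst hw
      tauto
    · tauto
  have := List.Perm.eq_of_pairwise (le := X.cyc q) (fun x y _ _ h1 h2 =>
    (X.cyc_asymm _ _ _ h1 (X.cyc_rotate _ _ _ h2)).elim)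
    (key h') (key (q := q) (t := b ++ a) hc) hperm
  rw [this]
  rfl

end IsCycle

/-- Each vertex lies on a cyclic list. -/
theorem exists_isCycle (v : X.V) : ∃ l, X.IsCycle l ∧ v ∈ l := by
  classical
  have := X.finV
  let W := {w : X.V // X.Joined v w ∧ w ≠ v}
  have : Fintype W := Fintype.ofFinite _
  let r : W → W → Prop := fun a b => a = b ∨ X.cyc v a.1 b.1
  have hr1 : IsTrans W r := ⟨by
    rintro a b c (rfl | h1) (rfl | h2)
    · exact .inl rfl
    · exact .inr h2
    · exact .inr h1
    · exact .inr (X.cyc_trans _ _ _ _ h1 h2)⟩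
  have hr2 : Std.Antisymm r := ⟨by
    rintro a b (h | h1) (h' | h2)
    · exact h
    · exact h
    · exact h'.symm
    · exact (X.cyc_asymm _ _ _ h1 (X.cyc_rotate _ _ _ h2)).elim⟩
  have hr3 : Std.Total r := ⟨by
    intro a b
    by_cases hab : a = b
    · exact .inl (.inl hab)
    · rcases X.cyc_total v a.1 b.1 a.2.1 (Joined.trans a.2.1.symm b.2.1) a.2.2.symm
        (fun h => hab (Subtype.ext h)) b.2.2.symm with h | h
      · exact .inl (.inr h)
      · exact .inr (.inr (cyc_rotate₂ h))⟩
  have hdec : DecidableRel r := Classical.decRel r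
  let t := (Finset.univ : Finset W).sort r
  have ht : ∀ w, w ∈ t.map Subtype.val ↔ X.Joined v w ∧ w ≠ v := by
    intro w
    simp only [List.mem_map, t, Finset.mem_sort, Finset.mem_univ, true_and]
    exact ⟨fun ⟨a, ha⟩ => ha ▸ a.2, fun h => ⟨⟨w, h⟩, rfl⟩⟩
  have hall : ∀ w, w ∈ v :: t.map Subtype.val ↔ X.Joined v w := by
    intro w
    rw [List.mem_cons, ht]
    by_cases hw : w = v
    · subst hw
      exact iff_of_true (.inl rfl) (joined_refl _)
    · simp [hw]
  have hnd : (t.map Subtype.val).Nodup :=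
    (Finset.sort_nodup _ r).map Subtype.val_injective
  have hpw : (t.map Subtype.val).Pairwise (X.cyc v) := by
    rw [List.pairwise_map]
    have h1 : t.Pairwise r := Finset.pairwise_sort _ r
    have h2 : t.Pairwise (· ≠ ·) := Finset.sort_nodup _ r
    exact (h1.and h2).imp fun h => h.1.resolve_left h.2
  rw [List.pairwise_iff_forall_sublist] at hpw
  refine ⟨v :: t.map Subtype.val, ⟨by simp, ?_, ?_, ?_⟩, by simp⟩
  · exact List.nodup_cons.2 ⟨fun h => ((ht v).1 h).2 rfl, hnd⟩
  · intro x hx w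
    rw [hall] at hx
    rw [hall]
    exact ⟨fun h => Joined.trans hx h, fun h => Joined.trans hx.symm h⟩
  · intro a b c hs
    rcases List.sublist_cons_iff.1 hs with h | ⟨l, h1, h2⟩
    · have h1 : X.cyc v a b := hpw ((List.Sublist.cons_cons a (List.Sublist.cons_cons b
        (List.nil_sublist [c]))).trans h)
      have h2 : X.cyc v b c := hpw ((List.sublist_cons_self a [b, c]).trans h)
      exact cyc_trans' h1 h2
    · simp only [List.cons.injEq] at h1
      obtain ⟨rfl, rfl⟩ := h1
      exact hpw h2

end FilmSurface
end Film

namespace Film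

/-! ### Products along cyclic lists of vertices -/

section Products

variable {K : Type u} [Field K] {S : Type w} {B : GraphClass S → Type v}
  [∀ σ, AddCommGroup (B σ)] [∀ σ, Module K (B σ)]

variable (B) in
/-- The elements that are homogeneous of the degree with the half-edge relation `R`.  Degrees are given
by relations so that the degree of a partial product is a function of its list of vertices. -/
def HomRel (R : S × Bool → S × Bool → Prop) (x : ⨁ σ, B σ) : Prop :=
  ∃ σ : GraphClass S, σ.incidence = R ∧ IsHom B σ x

theorem HomRel.isHom {R : S × Bool → S × Bool → Prop} {x : ⨁ σ, B σ} (h : HomRel B R x)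
    {σ : GraphClass S} (hσ : σ.incidence = R) : IsHom B σ x := by
  obtain ⟨τ, hτ, hx⟩ := h
  obtain rfl := GraphClass.incidence_injective (hσ.trans hτ.symm)
  exact hx

namespace GraphFrobenius

variable (G : GraphFrobenius K B) [∀ σ, FiniteDimensional K (B σ)]

open Classical in
/-- The product with values in the component whose class has the half-edge relation `R`; it is zero if
there is no such class. -/
noncomputable def mulRel (R : S × Bool → S × Bool → Prop) :
    (⨁ σ, B σ) →ₗ[K] (⨁ σ, B σ) →ₗ[K] (⨁ σ, B σ) :=
  if h : ∃ s : GraphClass S, s.star.incidence = R then G.mul h.choose else 0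

theorem mulRel_eq {R : S × Bool → S × Bool → Prop} {s : GraphClass S}
    (hs : s.star.incidence = R) : G.mulRel R = G.mul s := by
  have h : ∃ s : GraphClass S, s.star.incidence = R := ⟨s, hs⟩
  rw [mulRel, dif_pos h]
  congr 1
  exact GraphClass.star_injective
    (GraphClass.incidence_injective (h.choose_spec.trans hs.symm))

variable {X : FilmSurface S}

/-- The iterated product of the elements `ξ v` along a list of vertices `v`; the product over a list
is taken in the component of the class of the graph that cuts this list off.  The value at the empty
list is immaterial. -/
noncomputable def prod (ξ : X.V → ⨁ σ, B σ) : List X.V → ⨁ σ, B σ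
  | [] => 0
  | [v] => ξ v
  | v :: w :: l => G.mulRel (X.listRel (v :: w :: l)) (ξ v) (prod ξ (w :: l))

theorem prod_singleton (ξ : X.V → ⨁ σ, B σ) (v : X.V) : G.prod ξ [v] = ξ v := by
  rw [prod]

theorem prod_cons (ξ : X.V → ⨁ σ, B σ) (v : X.V) {l : List X.V} (h : l ≠ []) :
    G.prod ξ (v :: l) = G.mulRel (X.listRel (v :: l)) (ξ v) (G.prod ξ l) := by
  obtain ⟨w, l, rfl⟩ := List.exists_cons_of_ne_nil h
  rw [prod]

theorem homRel_mulRel {l₁ l₂ : List X.V} (h : X.IsCycle (l₁ ++ l₂)) (h1 : l₁ ≠ []) (h2 : l₂ ≠ [])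
    (x y : ⨁ σ, B σ) : HomRel B (X.listRel l₁) (G.mulRel (X.listRel l₁) x y) := by
  obtain ⟨σ, e1, -⟩ := h.exists_class h1 h2
  have e := e1
  rw [← σ.star_star] at e
  rw [G.mulRel_eq e]
  exact ⟨_, e, G.isHom_mul _ _ _⟩

theorem homRel_prod {ξ : X.V → ⨁ σ, B σ} (hξ : ∀ v, IsHom B (X.cls v) (ξ v)) {l₁ l₂ : List X.V}
    (h : X.IsCycle (l₁ ++ l₂)) (h1 : l₁ ≠ []) (h2 : l₂ ≠ []) :
    HomRel B (X.listRel l₁) (G.prod ξ l₁) := by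
  obtain ⟨v, l, rfl⟩ := List.exists_cons_of_ne_nil h1
  cases l with
  | nil =>
    rw [prod_singleton, FilmSurface.listRel_singleton]
    exact ⟨_, rfl, hξ v⟩
  | cons w l =>
    rw [prod_cons _ _ _ (by simp)]
    exact G.homRel_mulRel h h1 h2 _ _

/-- The associativity condition of the algebra applies to any four consecutive blocks of vertices that
make up a component, since contracting the blocks gives a surface with four vertices. -/
theorem mulRel_assoc {l₁ l₂ l₃ l₄ : List X.V} (h : X.IsCycle (l₁ ++ (l₂ ++ (l₃ ++ l₄))))
    (h1 : l₁ ≠ []) (h2 : l₂ ≠ []) (h3 : l₃ ≠ []) (h4 : l₄ ≠ []) {x y z : ⨁ σ, B σ}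
    (hx : HomRel B (X.listRel l₁) x) (hy : HomRel B (X.listRel l₂) y)
    (hz : HomRel B (X.listRel l₃) z) :
    G.mulRel (X.listRel (l₁ ++ (l₂ ++ l₃))) (G.mulRel (X.listRel (l₁ ++ l₂)) x y) z =
      G.mulRel (X.listRel (l₁ ++ (l₂ ++ l₃))) x (G.mulRel (X.listRel (l₂ ++ l₃)) y z) := by
  have r1 : X.IsCycle ((l₁ ++ l₂) ++ (l₃ ++ l₄)) := by simpa using h
  have r2 : X.IsCycle (l₂ ++ (l₃ ++ (l₄ ++ l₁))) := by simpa using h.rotate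
  have r3 : X.IsCycle ((l₂ ++ l₃) ++ (l₄ ++ l₁)) := by simpa using r2
  have r0 : X.IsCycle ((l₁ ++ (l₂ ++ l₃)) ++ l₄) := by simpa using h
  have r4 : X.IsCycle (l₄ ++ (l₁ ++ (l₂ ++ l₃))) := r0.rotate
  have r5 : X.IsCycle ((l₄ ++ l₁) ++ (l₂ ++ l₃)) := by simpa using r4
  obtain ⟨σ₁, e1, hx⟩ := hx
  obtain ⟨σ₂, e2, hy⟩ := hy
  obtain ⟨σ₃, e3, hz⟩ := hz
  obtain ⟨σ₄, e4, e4'⟩ := r4.exists_class h4 (by simp [h1])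
  obtain ⟨s, hs, hs'⟩ := r1.exists_class (by simp [h1]) (by simp [h3])
  obtain ⟨t, ht, ht'⟩ := r3.exists_class (by simp [h2]) (by simp [h4])
  rw [← s.star_star] at hs
  rw [G.mulRel_eq e4', G.mulRel_eq hs, G.mulRel_eq (s := t.star) (by rwa [t.star_star])]
  refine G.mul_assoc' (h.nonempty_compatibleSurface₄ h1 h2 h3 h4 e1 e2 e3 e4)
    (h.nonempty_compatibleSurface₃ h1 h2 (by simp [h3]) e1 e2 hs')
    (r1.nonempty_compatibleSurface₃ (by simp [h1]) h3 h4 hs e3 e4)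
    (r4.nonempty_compatibleSurface₃ h4 h1 (by simp [h2]) e4 e1 ht)
    (r5.nonempty_compatibleSurface₃ (by simp [h4]) h2 h3 ht' e2 e3) hx hy hz

/-- Generalized associativity: a product along a list can be split at any place. -/
theorem prod_append {ξ : X.V → ⨁ σ, B σ} (hξ : ∀ v, IsHom B (X.cls v) (ξ v)) {l₁ l₂ l₃ : List X.V}
    (h : X.IsCycle (l₁ ++ (l₂ ++ l₃))) (h1 : l₁ ≠ []) (h2 : l₂ ≠ []) (h3 : l₃ ≠ []) :
    G.prod ξ (l₁ ++ l₂) = G.mulRel (X.listRel (l₁ ++ l₂)) (G.prod ξ l₁) (G.prod ξ l₂) := by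
  induction l₁ generalizing l₃ with
  | nil => exact absurd rfl h1
  | cons v l ih =>
    by_cases hl : l = []
    · subst hl
      rw [prod_singleton]
      exact G.prod_cons ξ v h2
    · have h' : X.IsCycle ([v] ++ (l ++ (l₂ ++ l₃))) := h
      have r1 : X.IsCycle (l ++ (l₂ ++ (l₃ ++ [v]))) := by simpa using h'.rotate
      have r2 : X.IsCycle (l₂ ++ (l₃ ++ ([v] ++ l))) := by simpa using r1.rotate
      rw [List.cons_append, G.prod_cons ξ v (by simp [h2]), G.prod_cons ξ v hl,
        ih r1 hl (by simp)]
      exact (G.mulRel_assoc h' (by simp) hl h2 h3 (G.homRel_prod hξ h' (by simp) (by simp [hl]) |>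
        fun k => by rwa [prod_singleton] at k) (G.homRel_prod hξ r1 hl (by simp [h2]))
        (G.homRel_prod hξ r2 h2 (by simp))).symm

/-- The invariance of the bilinear form, `(x y, z) = (x, y z)`, for three blocks of vertices. -/
theorem bil_mulRel {l₁ l₂ l₃ : List X.V} (h : X.IsCycle (l₁ ++ (l₂ ++ l₃)))
    (h1 : l₁ ≠ []) (h2 : l₂ ≠ []) (h3 : l₃ ≠ []) {x y z : ⨁ σ, B σ}
    (hx : HomRel B (X.listRel l₁) x) (hz : HomRel B (X.listRel l₃) z) :
    G.bil (G.mulRel (X.listRel (l₁ ++ l₂)) x y) z =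
      G.bil x (G.mulRel (X.listRel (l₂ ++ l₃)) y z) := by
  have r1 : X.IsCycle (l₃ ++ (l₁ ++ l₂)) := by
    rw [← List.append_assoc] at h
    exact h.rotate
  obtain ⟨s, hs, hs'⟩ := r1.exists_class h3 (by simp [h1])
  obtain ⟨t, ht, ht'⟩ := h.exists_class h1 (by simp [h2])
  rw [G.mulRel_eq hs', G.mulRel_eq ht', G.bil_mul _ _ (hz.isHom hs), G.bil_symm x,
    G.bil_mul _ _ (hx.isHom ht), G.tri_cyclic]

/-- The value of the theory at a cyclic list of the vertices of a component: the first factor paired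
with the product of the others. -/
noncomputable def val (ξ : X.V → ⨁ σ, B σ) : List X.V → K
  | [] => 0
  | v :: l => G.bil (ξ v) (G.prod ξ l)

/-- The value of a component splits along each of its graph-cuts. -/
theorem val_append {ξ : X.V → ⨁ σ, B σ} (hξ : ∀ v, IsHom B (X.cls v) (ξ v)) {l₁ l₂ : List X.V}
    (h : X.IsCycle (l₁ ++ l₂)) (h1 : l₁ ≠ []) (h2 : l₂ ≠ []) :
    G.val ξ (l₁ ++ l₂) = G.bil (G.prod ξ l₁) (G.prod ξ l₂) := by
  obtain ⟨v, l, rfl⟩ := List.exists_cons_of_ne_nil h1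
  by_cases hl : l = []
  · subst hl
    rw [prod_singleton]
    rfl
  · have h' : X.IsCycle ([v] ++ (l ++ l₂)) := h
    have r1 : X.IsCycle (l ++ (l₂ ++ [v])) := by simpa using h'.rotate
    have hv := G.homRel_prod hξ h' (by simp) (by simp [hl])
    rw [prod_singleton] at hv
    rw [List.cons_append, val, G.prod_append hξ r1 hl h2 (by simp), G.prod_cons ξ v hl]
    exact (G.bil_mulRel h' (by simp) hl h2 hv
      (G.homRel_prod hξ h.rotate h2 (by simp))).symm

theorem val_rotate {ξ : X.V → ⨁ σ, B σ} (hξ : ∀ v, IsHom B (X.cls v) (ξ v)) {l₁ l₂ : List X.V}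
    (h : X.IsCycle (l₁ ++ l₂)) : G.val ξ (l₁ ++ l₂) = G.val ξ (l₂ ++ l₁) := by
  by_cases h1 : l₁ = []
  · simp [h1]
  by_cases h2 : l₂ = []
  · simp [h2]
  rw [G.val_append hξ h h1 h2, G.val_append hξ h.rotate h2 h1, G.bil_symm]

/-- The value of a component does not depend on the place where its cyclic list starts. -/
theorem val_eq {ξ : X.V → ⨁ σ, B σ} (hξ : ∀ v, IsHom B (X.cls v) (ξ v)) {l l' : List X.V}
    (h : X.IsCycle l) (h' : X.IsCycle l') {v : X.V} (hv : v ∈ l) (hv' : v ∈ l') :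
    G.val ξ l = G.val ξ l' := by
  obtain ⟨l₁, l₂, rfl, rfl⟩ := h.eq_rotate h' hv hv'
  exact G.val_rotate hξ h

/-- The product depends only on the factors and on the graphs that cut off the final segments of the
list. -/
theorem prod_map {Y : FilmSurface S} (g : X.V → Y.V) {ξ : X.V → ⨁ σ, B σ} {η : Y.V → ⨁ σ, B σ}
    {l : List X.V} (hR : ∀ t, t <:+ l → t ≠ [] → Y.listRel (t.map g) = X.listRel t)
    (hη : ∀ v ∈ l, η (g v) = ξ v) : G.prod η (l.map g) = G.prod ξ l := by
  induction l with
  | nil => rw [List.map_nil, prod, prod]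
  | cons v l ih =>
    have ih := ih (fun t ht => hR t (ht.trans (List.suffix_cons v l)))
      (fun w hw => hη w (List.mem_cons_of_mem _ hw))
    by_cases hl : l = []
    · subst hl
      rw [List.map_cons, List.map_nil, prod_singleton, prod_singleton, hη v (by simp)]
    · rw [List.map_cons, prod_cons _ _ _ (by simpa using hl), prod_cons _ _ _ hl, ih,
        hη v (by simp), ← List.map_cons, hR _ List.suffix_rfl (by simp)]

theorem val_map {Y : FilmSurface S} (g : X.V → Y.V) {ξ : X.V → ⨁ σ, B σ} {η : Y.V → ⨁ σ, B σ}
    {l : List X.V} (hR : ∀ t, t <:+ l → t ≠ [] → Y.listRel (t.map g) = X.listRel t)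
    (hη : ∀ v ∈ l, η (g v) = ξ v) : G.val η (l.map g) = G.val ξ l := by
  cases l with
  | nil => rfl
  | cons v l =>
    rw [List.map_cons, val, val, hη v (by simp), G.prod_map g
      (fun t ht => hR t (ht.trans (List.suffix_cons v l)))
      (fun w hw => hη w (List.mem_cons_of_mem _ hw))]

theorem prod_congr {ξ η : X.V → ⨁ σ, B σ} {l : List X.V} (h : ∀ v ∈ l, η v = ξ v) :
    G.prod η l = G.prod ξ l := by
  have := G.prod_map (X := X) (Y := X) id (l := l) (ξ := ξ) (η := η) (by simp) h
  rwa [List.map_id] at this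

theorem val_congr {ξ η : X.V → ⨁ σ, B σ} {l : List X.V} (h : ∀ v ∈ l, η v = ξ v) :
    G.val η l = G.val ξ l := by
  have := G.val_map (X := X) (Y := X) id (l := l) (ξ := ξ) (η := η) (by simp) h
  rwa [List.map_id] at this

theorem exists_linear_prod [DecidableEq X.V] (ξ : X.V → ⨁ σ, B σ) {l : List X.V} (hl : l.Nodup)
    {v : X.V} (hv : v ∈ l) : ∃ L : (⨁ σ, B σ) →ₗ[K] ⨁ σ, B σ, ∀ x,
      G.prod (Function.update ξ v x) l = L x := by
  induction l with
  | nil => simp at hv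
  | cons w l ih =>
    have hn := List.nodup_cons.1 hl
    by_cases h0 : l = []
    · subst h0
      obtain rfl : v = w := by simpa using hv
      exact ⟨LinearMap.id, fun x => by simp [prod_singleton]⟩
    rcases List.mem_cons.1 hv with rfl | hv
    · refine ⟨(G.mulRel (X.listRel (v :: l))).flip (G.prod ξ l), fun x => ?_⟩
      rw [prod_cons _ _ _ h0, Function.update_self, G.prod_congr (ξ := ξ) (l := l)]
      · rfl
      · intro u hu
        rw [Function.update_of_ne]
        rintro rfl
        exact hn.1 hu
    · obtain ⟨L, hL⟩ := ih hn.2 hv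
      refine ⟨G.mulRel (X.listRel (w :: l)) (ξ w) ∘ₗ L, fun x => ?_⟩
      rw [prod_cons _ _ _ h0, hL, Function.update_of_ne]
      · rfl
      · rintro rfl
        exact hn.1 hv

/-- The value is linear in each factor, since each vertex occurs only once in the list. -/
theorem exists_linear_val [DecidableEq X.V] (ξ : X.V → ⨁ σ, B σ) {l : List X.V} (hl : l.Nodup)
    {v : X.V} (hv : v ∈ l) : ∃ L : (⨁ σ, B σ) →ₗ[K] K, ∀ x,
      G.val (Function.update ξ v x) l = L x := by
  cases l with
  | nil => simp at hv
  | cons w l =>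
    have hn := List.nodup_cons.1 hl
    rcases List.mem_cons.1 hv with rfl | hv
    · refine ⟨G.bil.flip (G.prod ξ l), fun x => ?_⟩
      rw [val, Function.update_self, G.prod_congr (ξ := ξ) (l := l)]
      · rfl
      · intro u hu
        rw [Function.update_of_ne]
        rintro rfl
        exact hn.1 hu
    · obtain ⟨L, hL⟩ := G.exists_linear_prod ξ hn.2 hv
      refine ⟨G.bil (ξ w) ∘ₗ L, fun x => ?_⟩
      rw [val, hL, Function.update_of_ne]
      · rfl
      · rintro rfl
        exact hn.1 hv

end GraphFrobenius

end Products

end Film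

namespace Film

/-! ### Cyclic lists of embedded, numbered and cut surfaces -/

namespace FilmSurface

variable {S : Type w} {X Y : FilmSurface S}

theorem Emb.listRel_map (f : Emb X Y) (l : List X.V) : Y.listRel (l.map f.onV) = X.listRel l := by
  refine Eq.trans (congrArg Y.sideRel ?_) (f.sideRel_image _)
  ext w
  simp

theorem IsCycle.map (f : Emb X Y) {l : List X.V} (h : X.IsCycle l) : Y.IsCycle (l.map f.onV) where
  ne_nil := by simpa using h.ne_nil
  nodup := h.nodup.map f.injective
  joined v hv w := by
    obtain ⟨a, ha, rfl⟩ := List.mem_map.1 hv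
    constructor
    · intro hj
      obtain ⟨b, rfl, hb⟩ := f.exists_of_joined hj
      exact List.mem_map_of_mem ((h.joined a ha b).1 hb)
    · intro hw
      obtain ⟨b, hb, rfl⟩ := List.mem_map.1 hw
      exact f.joined ((h.joined a ha b).2 hb)
  cyc a b c hs := by
    obtain ⟨l', h1, h2⟩ := List.sublist_map_iff.1 hs
    match l', h2 with
    | [x, y, z], h2 =>
      simp only [List.map_cons, List.map_nil, List.cons.injEq, and_true] at h2
      obtain ⟨rfl, rfl, rfl⟩ := h2
      exact (f.cyc_iff _ _ _).2 (h.cyc x y z h1)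

theorem IsCycle.tail_ne_nil {v : X.V} {l : List X.V} (h : X.IsCycle (v :: l)) : l ≠ [] := by
  rintro rfl
  obtain ⟨c, rfl⟩ := X.src_surj v
  have := (h.joined (X.src c) (by simp) (X.tgt c)).1 (joined_side c)
  exact src_ne_tgt c (List.mem_singleton.1 this).symm

theorem IsCycle.exists_cons {l : List X.V} (h : X.IsCycle l) {v : X.V} (hv : v ∈ l) :
    ∃ t, X.IsCycle (v :: t) := by
  obtain ⟨a, b, rfl⟩ := List.append_of_mem hv
  exact ⟨_, h.rotate⟩

variable (X) in
/-- The relation of lying in the same component. -/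
def joinedSetoid : Setoid X.V := ⟨X.Joined, joined_refl, Joined.symm, Joined.trans⟩

variable (X) in
/-- The set of components of a film surface. -/
def Component : Type := Quotient X.joinedSetoid

instance : Finite X.Component := by
  have := X.finV
  exact Quotient.finite _

/-- A list of the vertices of a component in cyclic order, with an arbitrary start. -/
noncomputable def Component.list (κ : X.Component) : List X.V := (exists_isCycle κ.out).choose

theorem Component.isCycle (κ : X.Component) : X.IsCycle κ.list := (exists_isCycle κ.out).choose_spec.1

theorem Component.mem_list (κ : X.Component) (v : X.V) :
    v ∈ κ.list ↔ Quotient.mk X.joinedSetoid v = κ := by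
  rw [← κ.isCycle.joined _ (exists_isCycle κ.out).choose_spec.2 v]
  constructor
  · intro h
    exact (Quotient.sound h).symm.trans (Quotient.out_eq κ)
  · rintro rfl
    exact Quotient.exact (s := X.joinedSetoid) (Quotient.out_eq (s := X.joinedSetoid) _)

namespace GraphCut

variable (γ : GraphCut X) (hX : X.Connected)

theorem exists_isCycle_cut_inr (b : Bool) : ∃ m : List X.V,
    (γ.cut hX).IsCycle (Sum.inr b :: m.map Sum.inl) ∧ ∀ v, v ∈ m ↔ γ.side v = b := by
  obtain ⟨l, hl, hb⟩ := exists_isCycle (X := γ.cut hX) (Sum.inr b)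
  obtain ⟨t, ht⟩ := hl.exists_cons hb
  have hmem : ∀ x, x ∈ (Sum.inr b :: t : List (X.V ⊕ Bool)) ↔ b = γ.sideOf x := fun x =>
    (ht.joined (Sum.inr b) List.mem_cons_self x).symm.trans (γ.joined_iff hX)
  have hr : t ∈ Set.range (List.map (Sum.inl : X.V → X.V ⊕ Bool)) := by
    rw [Set.range_list_map]
    rintro (v | b') hx
    · exact ⟨v, rfl⟩
    · have h1 : b = b' := (hmem _).1 (List.mem_cons_of_mem _ hx)
      subst h1
      exact absurd hx (List.nodup_cons.1 ht.nodup).1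
  obtain ⟨m, rfl⟩ := hr
  refine ⟨m, ht, fun v => ?_⟩
  have := hmem (Sum.inl v)
  simp only [List.mem_cons, List.mem_map, reduceCtorEq, Sum.inl.injEq, exists_eq_right,
    false_or] at this
  rw [this, eq_comm]
  rfl

/-- Cyclic lists of a surface and of the two pieces of the surface cut along `γ`. -/
theorem exists_isCycle_cut : ∃ m : Bool → List X.V, X.IsCycle (m true ++ m false) ∧
    (∀ b v, v ∈ m b ↔ γ.side v = b) ∧ ∀ b, (γ.cut hX).IsCycle (Sum.inr b :: (m b).map Sum.inl) := by
  choose m hm hmem using γ.exists_isCycle_cut_inr hX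
  have hnd : ∀ b, (m b).Nodup := fun b => (List.nodup_cons.1 (hm b).nodup).2.of_map
  have hall : ∀ v, v ∈ m true ++ m false := fun v => by
    rw [List.mem_append, hmem, hmem]
    cases γ.side v <;> simp
  refine ⟨m, ⟨?_, ?_, fun v _ w => iff_of_true (hX _ _) (hall w), ?_⟩, hmem, hm⟩
  · obtain ⟨v⟩ := X.nonemptyV
    exact List.ne_nil_of_mem (hall v)
  · refine List.nodup_append.2 ⟨hnd _, hnd _, ?_⟩
    rintro v hv _ hv' rfl
    rw [hmem] at hv hv'
    rw [hv] at hv'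
    cases hv'
  · intro x y z hs
    have h3 : ∀ b, List.Sublist [x, y, z] (m b) → X.cyc x y z := by
      intro b h
      have e1 := (hmem b x).1 (h.subset (by simp))
      have e2 := (hmem b y).1 (h.subset (by simp))
      have e3 := (hmem b z).1 (h.subset (by simp))
      have := ((hm b).cyc (Sum.inl x) (Sum.inl y) (Sum.inl z)
        ((h.map Sum.inl).trans (List.sublist_cons_self _ _))).2.2
      refine γ.cyc_of_contract hX (b := b) ?_
      rwa [γ.contract_of_eq e1, γ.contract_of_eq e2, γ.contract_of_eq e3]
    have h2 : ∀ b x y z, List.Sublist [y, z] (m b) → x ∈ m (!b) → X.cyc x y z := by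
      intro b x y z h hx
      have e1 : γ.side x ≠ b := by
        rw [(hmem _ x).1 hx]
        cases b <;> simp
      have e2 := (hmem b y).1 (h.subset (by simp))
      have e3 := (hmem b z).1 (h.subset (by simp))
      have := ((hm b).cyc (Sum.inr b) (Sum.inl y) (Sum.inl z) ((h.map Sum.inl).cons_cons _)).2.2
      refine γ.cyc_of_contract hX (b := b) ?_
      rwa [γ.contract_of_ne e1, γ.contract_of_eq e2, γ.contract_of_eq e3]
    obtain ⟨p, q, h, hp, hq⟩ := List.sublist_append_iff.1 hs
    match p, h with
    | [], h =>
      rw [List.nil_append] at h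
      subst h
      exact h3 _ hq
    | [_], h =>
      simp only [List.cons_append, List.nil_append, List.cons.injEq] at h
      obtain ⟨rfl, rfl⟩ := h
      exact h2 false _ _ _ hq (List.singleton_sublist.1 hp)
    | [_, _], h =>
      simp only [List.cons_append, List.nil_append, List.cons.injEq] at h
      obtain ⟨rfl, rfl, rfl⟩ := h
      exact X.cyc_rotate _ _ _ (h2 true _ _ _ hp (List.singleton_sublist.1 hq))
    | [_, _, _], h =>
      simp only [List.cons_append, List.nil_append, List.cons.injEq] at h
      obtain ⟨rfl, rfl, rfl, rfl⟩ := h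
      exact h3 _ hp
    | _ :: _ :: _ :: _ :: _, h => simp at h

theorem listRel_cut {b : Bool} {t : List X.V} (ht : ∀ v ∈ t, γ.side v = b) :
    (γ.cut hX).listRel (t.map Sum.inl) = X.listRel t := by
  have hmem : ∀ x : X.V ⊕ Bool, x ∈ t.map Sum.inl ↔ ∃ w ∈ t, Sum.inl w = x := fun _ => List.mem_map
  refine γ.sideRel_cut hX (b := b) (K := {x | x ∈ t.map Sum.inl}) (fun v => (hmem _).trans ?_)
    (fun v hv => ?_)
  · by_cases h : γ.side v = b
    · rw [γ.contract_of_eq h]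
      simp
    · rw [γ.contract_of_ne h]
      have : v ∉ t := fun hv => h (ht v hv)
      simp [this]
  · obtain ⟨w, hw, h⟩ := (hmem _).1 hv
    have h1 := γ.sideOf_contract (!b) v
    rw [← h] at h1
    have h2 : γ.side w = !b := h1
    rw [ht w hw] at h2
    cases b <;> cases h2

end GraphCut

end FilmSurface

theorem CompatibleSurface.isCycle {S : Type w} {n : ℕ} [NeZero n] {σ : Fin n → GraphClass S}
    (m : CompatibleSurface σ) : m.surface.IsCycle (List.ofFn m.vertex) where
  ne_nil := by
    rw [ne_eq, List.ofFn_eq_nil_iff]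
    exact NeZero.ne n
  nodup := List.nodup_ofFn.2 m.vertex.injective
  joined v _ w := iff_of_true (m.connected _ _) ((List.mem_ofFn' _ _).2 (m.vertex.surjective w))
  cyc a b c hs := by
    rw [List.ofFn_eq_map] at hs
    obtain ⟨l', h1, h2⟩ := List.sublist_map_iff.1 hs
    match l', h2 with
    | [i, j, k], h2 =>
      simp only [List.map_cons, List.map_nil, List.cons.injEq, and_true] at h2
      obtain ⟨rfl, rfl, rfl⟩ := h2
      have := (List.pairwise_lt_finRange n).sublist h1
      simp only [List.pairwise_cons, List.mem_cons] at this
      exact m.cyc_vertex i j k (this.1 j (by simp)) (this.2.1 k (by simp))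

/-! ### Evaluation on decomposable tensors -/

section Tensors

variable {K : Type u} [Field K] {S : Type w} {B : GraphClass S → Type v}
  [∀ σ, AddCommGroup (B σ)] [∀ σ, Module K (B σ)]

theorem exists_isoMap_tprod {X Y : FilmSurface S} (φ : FilmSurface.Iso X Y)
    (x : ∀ q, B (X.cls q)) : ∃ z : ∀ q, B (Y.cls q),
      isoMap φ (PiTensorProduct.tprod K x) = PiTensorProduct.tprod K z ∧
        ∀ q, incl (z (φ.onV q)) = incl (x q) := by
  refine ⟨fun q => castB (K := K) (by rw [← φ.cls_eq, Equiv.apply_symm_apply]) (x (φ.onV.symm q)),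
    ?_, fun q => ?_⟩
  · rw [isoMap, LinearEquiv.trans_apply, PiTensorProduct.reindex_tprod, PiTensorProduct.congr_tprod]
  · rw [incl_castB]
    exact congrArg (fun p => incl (x p)) (φ.onV.symm_apply_apply q)

theorem exists_sumTensor_tprod {ι ι' : Type} (σ : ι ⊕ ι' → GraphClass S)
    (x : ∀ i, B (σ (.inl i))) (y : ∀ i, B (σ (.inr i))) : ∃ z : ∀ i, B (σ i),
      sumTensor σ (PiTensorProduct.tprod K x ⊗ₜ[K] PiTensorProduct.tprod K y) =
        PiTensorProduct.tprod K z ∧ (∀ i, z (.inl i) = x i) ∧ ∀ i, z (.inr i) = y i :=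
  ⟨_, PiTensorProduct.tmulEquivDep_apply (R := K) (N := fun i => B (σ i)) x y, fun _ => rfl,
    fun _ => rfl⟩

theorem exists_unionMap_tprod (X Y : FilmSurface S) (x : ∀ q, B (X.cls q)) (y : ∀ q, B (Y.cls q)) :
    ∃ z : ∀ q, B ((X.union Y).cls q),
      unionMap X Y (PiTensorProduct.tprod K x ⊗ₜ[K] PiTensorProduct.tprod K y) =
        PiTensorProduct.tprod K z ∧
      (∀ q, incl (z (Sum.inl q)) = incl (x q)) ∧ ∀ q, incl (z (Sum.inr q)) = incl (y q) := by
  obtain ⟨z, h, h1, h2⟩ := exists_sumTensor_tprod (K := K) (ι := X.V) (ι' := Y.V) (X.union Y).cls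
    (fun q => castB (K := K) (FilmSurface.union_cls_inl X Y q).symm (x q))
    (fun q => castB (K := K) (FilmSurface.union_cls_inr X Y q).symm (y q))
  refine ⟨z, ?_, fun q => ?_, fun q => ?_⟩
  · have e : ∀ t, unionMap (K := K) (B := B) X Y t =
        sumTensor (ι := X.V) (ι' := Y.V) (X.union Y).cls (TensorProduct.congr
          (PiTensorProduct.congr fun q => castB (FilmSurface.union_cls_inl X Y q).symm)
          (PiTensorProduct.congr fun q => castB (FilmSurface.union_cls_inr X Y q).symm) t) :=
      fun t => rfl
    refine (e _).trans (Eq.trans (congrArg _ ?_) h)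
    exact congrArg₂ (· ⊗ₜ[K] ·) (PiTensorProduct.congr_tprod _ _) (PiTensorProduct.congr_tprod _ _)
  · rw [h1, incl_castB]
  · rw [h2, incl_castB]

theorem exists_boolTensor_tmul (σ : Bool → GraphClass S) (x : B (σ true)) (y : B (σ false)) :
    ∃ z : ∀ b, B (σ b), boolTensor σ (x ⊗ₜ[K] y) = PiTensorProduct.tprod K z ∧
      z true = x ∧ z false = y :=
  ⟨_, by rw [boolTensor, TensorProduct.lift.tmul, LinearMap.mk₂_apply], rfl, rfl⟩

theorem form_ext {X : FilmSurface S} {f g : VSpace K B X →ₗ[K] K}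
    (h : ∀ x, f (PiTensorProduct.tprod K x) = g (PiTensorProduct.tprod K x)) : f = g :=
  PiTensorProduct.ext (MultilinearMap.ext h)

/-- The insertion of a tensor at the two new vertices of a cut surface. -/
noncomputable def cutInsert {X : FilmSurface S} (hX : X.Connected) (γ : X.GraphCut)
    (x : VSpace K B X) : B ((γ.cut hX).cls (Sum.inr true)) ⊗[K]
      B ((γ.cut hX).cls (Sum.inr true)).star →ₗ[K] VSpace K B (γ.cut hX) :=
  (sumTensor (ι := X.V) (ι' := Bool) (γ.cut hX).cls).toLinearMap ∘ₗ
    TensorProduct.mk K _ _ (PiTensorProduct.congr (fun q => castB (γ.cut_cls_inl hX q).symm) x) ∘ₗ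
      boolTensor (fun b => (γ.cut hX).cls (Sum.inr b)) ∘ₗ
        LinearMap.lTensor _ (castB (γ.cut_cls_inr hX).symm).toLinearMap

theorem cutMap_eq (k : ∀ σ : GraphClass S, B σ ⊗[K] B σ.star) {X : FilmSurface S}
    (hX : X.Connected) (γ : X.GraphCut) (x : VSpace K B X) :
    cutMap k hX γ x = cutInsert hX γ x (k _) := rfl

theorem exists_cutInsert_tprod {X : FilmSurface S} (hX : X.Connected) (γ : X.GraphCut)
    (x : ∀ q, B (X.cls q)) (p : B ((γ.cut hX).cls (Sum.inr true)))
    (q : B ((γ.cut hX).cls (Sum.inr true)).star) : ∃ z : ∀ v, B ((γ.cut hX).cls v),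
      cutInsert hX γ (PiTensorProduct.tprod K x) (p ⊗ₜ[K] q) = PiTensorProduct.tprod K z ∧
      (∀ v, incl (z (Sum.inl v)) = incl (x v)) ∧ incl (z (Sum.inr true)) = incl p ∧
        incl (z (Sum.inr false)) = incl q := by
  obtain ⟨y, hy, hy1, hy2⟩ := exists_boolTensor_tmul (K := K)
    (fun b => (γ.cut hX).cls (Sum.inr b)) p (castB (K := K) (γ.cut_cls_inr hX).symm q)
  obtain ⟨z, h, h1, h2⟩ := exists_sumTensor_tprod (K := K) (ι := X.V) (ι' := Bool) (γ.cut hX).cls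
    (fun q => castB (K := K) (γ.cut_cls_inl hX q).symm (x q)) y
  refine ⟨z, ?_, fun v => ?_, ?_, ?_⟩
  · have e : ∀ t, cutInsert (K := K) hX γ t (p ⊗ₜ[K] q) =
        sumTensor (ι := X.V) (ι' := Bool) (γ.cut hX).cls
          (PiTensorProduct.congr (fun q => castB (γ.cut_cls_inl hX q).symm) t ⊗ₜ[K]
            boolTensor (fun b => (γ.cut hX).cls (Sum.inr b))
              (p ⊗ₜ[K] castB (K := K) (γ.cut_cls_inr hX).symm q)) := fun t => rfl
    refine (e _).trans (Eq.trans (congrArg _ ?_) h)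
    exact congrArg₂ (· ⊗ₜ[K] ·) (PiTensorProduct.congr_tprod _ _) hy
  · rw [h1, incl_castB]
  · rw [h2, hy1]
  · rw [h2, hy2, incl_castB]

end Tensors

end Film

namespace Film

/-! ### The theory of a graph-Frobenius algebra -/

namespace GraphFrobenius

variable {K : Type u} [Field K] {S : Type w} {B : GraphClass S → Type v}
  [∀ σ, AddCommGroup (B σ)] [∀ σ, Module K (B σ)] [∀ σ, FiniteDimensional K (B σ)]
  (G : GraphFrobenius K B) {X Y : FilmSurface S}

/-- The value of the theory at a family of homogeneous elements: the product of the values of the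
components. -/
noncomputable def formVal (ξ : X.V → ⨁ σ, B σ) : K := ∏ᶠ κ : X.Component, G.val ξ κ.list

/-- The value can be computed with any family of cyclic lists that run through the components. -/
theorem formVal_eq {ι : Type} [Fintype ι] {ξ : X.V → ⨁ σ, B σ} (hξ : ∀ v, IsHom B (X.cls v) (ξ v))
    (L : ι → List X.V) (hL : ∀ i, X.IsCycle (L i)) (hex : ∀ v, ∃ i, v ∈ L i)
    (huniq : ∀ v i j, v ∈ L i → v ∈ L j → i = j) : G.formVal ξ = ∏ i, G.val ξ (L i) := by
  rw [← finprod_eq_prod_of_fintype]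
  choose a ha using fun i => List.exists_mem_of_ne_nil _ (hL i).ne_nil
  symm
  refine finprod_eq_of_bijective (fun i => Quotient.mk X.joinedSetoid (a i)) ⟨?_, ?_⟩ fun i => ?_
  · intro i j h
    have h1 : X.Joined (a i) (a j) := Quotient.exact h
    exact huniq (a j) i j (((hL i).joined _ (ha i) _).1 h1) (ha j)
  · intro κ
    obtain ⟨v, rfl⟩ := Quotient.exists_rep κ
    obtain ⟨i, hi⟩ := hex v
    exact ⟨i, Quotient.sound (((hL i).joined _ (ha i) _).2 hi)⟩
  · exact G.val_eq hξ (hL i) (FilmSurface.Component.isCycle _) (ha i)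
      ((FilmSurface.Component.mem_list _ _).2 rfl)

theorem formVal_of_isCycle {ξ : X.V → ⨁ σ, B σ} (hξ : ∀ v, IsHom B (X.cls v) (ξ v))
    (hX : X.Connected) {l : List X.V} (hl : X.IsCycle l) : G.formVal ξ = G.val ξ l := by
  obtain ⟨v, hv⟩ := List.exists_mem_of_ne_nil _ hl.ne_nil
  rw [G.formVal_eq hξ (fun _ : Unit => l) (fun _ => hl)
    (fun w => ⟨(), (hl.joined v hv w).1 (hX _ _)⟩) (fun _ _ _ _ _ => rfl)]
  simp

theorem exists_linear_formVal [DecidableEq X.V] (ξ : X.V → ⨁ σ, B σ) (v : X.V) :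
    ∃ L : (⨁ σ, B σ) →ₗ[K] K, ∀ x, G.formVal (Function.update ξ v x) = L x := by
  classical
  have : Fintype X.Component := Fintype.ofFinite _
  let κ₀ : X.Component := Quotient.mk X.joinedSetoid v
  obtain ⟨L, hL⟩ := G.exists_linear_val ξ κ₀.isCycle.nodup
    ((FilmSurface.Component.mem_list κ₀ v).2 rfl)
  refine ⟨(∏ κ ∈ Finset.univ.erase κ₀, G.val ξ κ.list) • L, fun x => ?_⟩
  rw [formVal, finprod_eq_prod_of_fintype, ← Finset.prod_erase_mul _ _ (Finset.mem_univ κ₀), hL,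
    LinearMap.smul_apply, smul_eq_mul]
  congr 1
  refine Finset.prod_congr rfl fun κ hκ => G.val_congr fun u hu => Function.update_of_ne ?_ _ _
  rintro rfl
  exact (Finset.mem_erase.1 hκ).1 ((FilmSurface.Component.mem_list κ u).1 hu).symm

variable (X) in
/-- The linear form of a film surface as a multilinear form. -/
noncomputable def multiForm : MultilinearMap K (fun q : X.V => B (X.cls q)) K where
  toFun x := G.formVal fun q => incl (x q)
  map_update_add' := by
    intro _ x i a b
    obtain ⟨L, hL⟩ := G.exists_linear_formVal (fun q => incl (x q)) i
    have h : ∀ a, G.formVal (fun q => incl (Function.update x i a q)) = L (incl a) := by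
      intro a
      rw [← hL]
      congr 1
      funext q
      by_cases hq : q = i
      · subst hq
        simp
      · simp [hq]
    simp only [h]
    exact (L ∘ₗ inclₗ K B _).map_add a b
  map_update_smul' := by
    intro _ x i c a
    obtain ⟨L, hL⟩ := G.exists_linear_formVal (fun q => incl (x q)) i
    have h : ∀ a, G.formVal (fun q => incl (Function.update x i a q)) = L (incl a) := by
      intro a
      rw [← hL]
      congr 1
      funext q
      by_cases hq : q = i
      · subst hq
        simp
      · simp [hq]
    simp only [h]
    exact (L ∘ₗ inclₗ K B _).map_smul c a

variable (X) in
/-- The linear form of a film surface. -/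
noncomputable def form : VSpace K B X →ₗ[K] K := PiTensorProduct.lift (G.multiForm X)

theorem form_tprod (x : ∀ q, B (X.cls q)) :
    G.form X (PiTensorProduct.tprod K x) = G.formVal fun q => incl (x q) :=
  PiTensorProduct.lift.tprod x

theorem val_emb (f : FilmSurface.Emb X Y) {ξ : X.V → ⨁ σ, B σ} {η : Y.V → ⨁ σ, B σ}
    (h : ∀ v, η (f.onV v) = ξ v) (l : List X.V) : G.val η (l.map f.onV) = G.val ξ l :=
  G.val_map f.onV (fun t _ _ => f.listRel_map t) fun v _ => h v

theorem form_iso (φ : FilmSurface.Iso X Y) (x : VSpace K B X) :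
    G.form Y (isoMap φ x) = G.form X x := by
  suffices G.form Y ∘ₗ (isoMap φ).toLinearMap = G.form X from LinearMap.congr_fun this x
  refine form_ext fun x => ?_
  obtain ⟨z, hz, hz'⟩ := exists_isoMap_tprod (K := K) φ x
  rw [LinearMap.comp_apply, LinearEquiv.coe_coe, hz, form_tprod, form_tprod]
  have : Fintype X.Component := Fintype.ofFinite _
  let f := FilmSurface.Emb.ofIso φ
  rw [G.formVal_eq (X := Y) (fun v => isHom_incl _)
    (fun κ : X.Component => κ.list.map f.onV) (fun κ => κ.isCycle.map f), formVal,
    finprod_eq_prod_of_fintype]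
  · exact Finset.prod_congr rfl fun κ _ => G.val_emb f hz' _
  · intro w
    obtain ⟨v, rfl⟩ := φ.onV.surjective w
    exact ⟨Quotient.mk X.joinedSetoid v,
      List.mem_map_of_mem ((FilmSurface.Component.mem_list _ _).2 rfl)⟩
  · intro w κ κ' h h'
    obtain ⟨v, hv, rfl⟩ := List.mem_map.1 h
    obtain ⟨v', hv', e⟩ := List.mem_map.1 h'
    obtain rfl := f.injective e
    exact ((FilmSurface.Component.mem_list _ _).1 hv).symm.trans
      ((FilmSurface.Component.mem_list _ _).1 hv')

theorem form_union (x : VSpace K B X) (y : VSpace K B Y) :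
    G.form (X.union Y) (unionMap X Y (x ⊗ₜ[K] y)) = G.form X x * G.form Y y := by
  have key : ∀ (x : ∀ q, B (X.cls q)) (y : ∀ q, B (Y.cls q)),
      G.form (X.union Y) (unionMap X Y (PiTensorProduct.tprod K x ⊗ₜ[K] PiTensorProduct.tprod K y)) =
        G.form X (PiTensorProduct.tprod K x) * G.form Y (PiTensorProduct.tprod K y) := by
    intro x y
    obtain ⟨z, hz, hz1, hz2⟩ := exists_unionMap_tprod (K := K) X Y x y
    rw [hz, form_tprod, form_tprod, form_tprod]
    have : Fintype X.Component := Fintype.ofFinite _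
    have : Fintype Y.Component := Fintype.ofFinite _
    let f := FilmSurface.Emb.inl X Y
    let g := FilmSurface.Emb.inr X Y
    rw [formVal_eq (X := X.union Y) G (fun v => isHom_incl _)
      (Sum.elim (fun κ : X.Component => κ.list.map f.onV) (fun κ : Y.Component => κ.list.map g.onV)),
      Fintype.prod_sum_type, formVal, formVal, finprod_eq_prod_of_fintype, finprod_eq_prod_of_fintype]
    · congr 1
      · exact Finset.prod_congr rfl fun κ _ => G.val_emb f hz1 _
      · exact Finset.prod_congr rfl fun κ _ => G.val_emb g hz2 _
    · rintro (κ | κ)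
      · exact κ.isCycle.map f
      · exact κ.isCycle.map g
    · rintro (v | v)
      · exact ⟨.inl (Quotient.mk X.joinedSetoid v),
          List.mem_map_of_mem ((FilmSurface.Component.mem_list _ _).2 rfl)⟩
      · exact ⟨.inr (Quotient.mk Y.joinedSetoid v),
          List.mem_map_of_mem ((FilmSurface.Component.mem_list _ _).2 rfl)⟩
    · rintro w (κ | κ) (κ' | κ') h h' <;> obtain ⟨v, hv, rfl⟩ := List.mem_map.1 h <;>
        obtain ⟨v', hv', e⟩ := List.mem_map.1 h'
      · obtain rfl := f.injective e
        exact congrArg _ (((FilmSurface.Component.mem_list _ _).1 hv).symm.trans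
          ((FilmSurface.Component.mem_list _ _).1 hv'))
      · cases e
      · cases e
      · obtain rfl := g.injective e
        exact congrArg _ (((FilmSurface.Component.mem_list _ _).1 hv).symm.trans
          ((FilmSurface.Component.mem_list _ _).1 hv'))
  induction x using PiTensorProduct.induction_on with
  | smul_tprod r x =>
    induction y using PiTensorProduct.induction_on with
    | smul_tprod r' y =>
      rw [TensorProduct.smul_tmul_smul, map_smul, map_smul, key, map_smul, map_smul, smul_eq_mul,
        smul_eq_mul, smul_eq_mul, mul_mul_mul_comm]
    | add y y' h h' => rw [TensorProduct.tmul_add, map_add, map_add, h, h', map_add, mul_add]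
  | add x x' h h' => rw [TensorProduct.add_tmul, map_add, map_add, h, h', map_add, add_mul]

/-- Cutting and inserting a tensor contracts it with the products along the two parts. -/
theorem form_cutInsert (hX : X.Connected) (γ : X.GraphCut) {m : Bool → List X.V}
    (hside : ∀ b v, v ∈ m b ↔ γ.side v = b)
    (hcut : ∀ b, (γ.cut hX).IsCycle (Sum.inr b :: (m b).map Sum.inl)) (x : ∀ q, B (X.cls q))
    (k : B ((γ.cut hX).cls (Sum.inr true)) ⊗[K] B ((γ.cut hX).cls (Sum.inr true)).star) :
    G.form (γ.cut hX) (cutInsert hX γ (PiTensorProduct.tprod K x) k) =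
      contract₂ (G.bil.flip (G.prod (fun q => incl (x q)) (m true)))
        (G.bil.flip (G.prod (fun q => incl (x q)) (m false))) k := by
  induction k using TensorProduct.induction_on with
  | zero => simp only [map_zero]
  | add k k' h h' => rw [map_add, map_add, h, h', map_add]
  | tmul p q =>
    obtain ⟨z, hz, hz1, hz2, hz3⟩ := exists_cutInsert_tprod (K := K) hX γ x p q
    rw [hz, form_tprod, G.formVal_eq (X := γ.cut hX) (fun v => isHom_incl _)
      (fun b => Sum.inr b :: (m b).map Sum.inl) hcut, Fintype.prod_bool, contract₂_tmul]
    · have key : ∀ b, G.prod (X := γ.cut hX) (fun q => incl (z q)) ((m b).map Sum.inl) =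
          G.prod (fun q => incl (x q)) (m b) := fun b =>
        G.prod_map (Y := γ.cut hX) Sum.inl (fun t ht _ => γ.listRel_cut hX
          fun v hv => (hside b v).1 (ht.subset hv)) (fun v _ => hz1 v)
      have hval : ∀ b, G.val (X := γ.cut hX) (fun q => incl (z q)) (Sum.inr b :: (m b).map Sum.inl) =
          G.bil (incl (z (Sum.inr b))) (G.prod (fun q => incl (x q)) (m b)) := fun b =>
        congrArg _ (key b)
      exact congrArg₂ (· * ·) ((hval true).trans (by rw [hz2]; rfl))
        ((hval false).trans (by rw [hz3]; rfl))
    · rintro (v | b)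
      · exact ⟨γ.side v, List.mem_cons_of_mem _ (List.mem_map_of_mem ((hside _ _).2 rfl))⟩
      · exact ⟨b, List.mem_cons_self⟩
    · intro v b b' h h'
      by_contra hbb
      have h1 := (γ.joined_iff hX).1 (((hcut b).joined _ List.mem_cons_self v).2 h)
      have h2 := (γ.joined_iff hX).1 (((hcut b').joined _ List.mem_cons_self v).2 h')
      exact hbb (h1.trans h2.symm)

/-- Both sides are the pairing of the products along the two parts: a contraction with the copairing
replaces its factors by the products, and the value of the surface splits along the cut. -/
theorem form_cut (hX : X.Connected) (γ : X.GraphCut) (x : VSpace K B X) :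
    G.form (γ.cut hX) (cutMap G.copairing hX γ x) = G.form X x := by
  suffices G.form (γ.cut hX) ∘ₗ cutMap G.copairing hX γ = G.form X from LinearMap.congr_fun this x
  refine form_ext fun x => ?_
  obtain ⟨m, hm, hside, hcut⟩ := γ.exists_isCycle_cut hX
  have hne : ∀ b, m b ≠ [] := fun b h => by
    obtain ⟨v, hv⟩ := γ.side_surjective b
    have := (hside b v).2 hv
    rw [h] at this
    cases this
  have hξ : ∀ v, IsHom B (X.cls v) (incl (x v)) := fun v => isHom_incl _
  rw [LinearMap.comp_apply, cutMap_eq, G.form_cutInsert hX γ hside hcut, contract₂_copairing]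
  · rw [form_tprod, G.formVal_of_isCycle hξ hX hm.rotate, G.val_append hξ hm.rotate (hne _) (hne _)]
    rfl
  · refine (G.homRel_prod hξ hm.rotate (hne false) (hne true)).isHom ?_
    rw [γ.incidence_cls_cut_inr hX true]
    refine congrArg X.sideRel (Set.ext fun v => ?_)
    simp [hside]

theorem form_tensor {n : ℕ} [NeZero n] {σ : Fin n → GraphClass S} (m : CompatibleSurface σ)
    (x : ∀ i, B (σ i)) : ∃ ξ : m.surface.V → ⨁ σ, B σ, (∀ v, IsHom B (m.surface.cls v) (ξ v)) ∧
      (∀ i, ξ (m.vertex i) = incl (x i)) ∧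
      G.form m.surface (m.tensor x) = G.val ξ (List.ofFn m.vertex) := by
  refine ⟨_, fun v => isHom_incl _, fun i => ?_, (G.form_tprod _).trans
    (G.formVal_of_isCycle (fun v => isHom_incl _) m.connected m.isCycle)⟩
  simp only [incl_castB]
  exact congrArg (fun j => incl (x j)) (m.vertex.symm_apply_apply i)

theorem form_pair {σ₁ σ₂ : GraphClass S} (m : CompatibleSurface ![σ₁, σ₂]) (x : B σ₁) (y : B σ₂) :
    G.form m.surface (m.tensor (pair x y)) = G.bil (incl x) (incl y) := by
  obtain ⟨ξ, -, h1, h2⟩ := G.form_tensor m (pair x y)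
  have e0 : ξ (m.vertex 0) = incl x := h1 0
  have e1 : ξ (m.vertex 1) = incl y := h1 1
  rw [h2, List.ofFn_succ, List.ofFn_succ, List.ofFn_zero, val, prod_singleton, e0]
  exact congrArg _ e1

theorem nondegenerate_left {σ₁ σ₂ : GraphClass S} (m : CompatibleSurface ![σ₁, σ₂]) (x : B σ₁)
    (h : ∀ y : B σ₂, G.form m.surface (m.tensor (pair x y)) = 0) : x = 0 := by
  obtain rfl := m.eq_star
  apply (castB (K := K) (B := B) (GraphClass.star_star σ₁).symm).injective
  rw [map_zero]
  refine (injective_iff_map_eq_zero _).1 (G.pairing_injective σ₁.star) _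
    (LinearMap.ext fun y => ?_)
  rw [G.pairing_apply, incl_castB, ← G.form_pair m, h]
  rfl

theorem nondegenerate_right {σ₁ σ₂ : GraphClass S} (m : CompatibleSurface ![σ₁, σ₂]) (y : B σ₂)
    (h : ∀ x : B σ₁, G.form m.surface (m.tensor (pair x y)) = 0) : y = 0 := by
  obtain rfl := m.eq_star
  refine (injective_iff_map_eq_zero _).1 (G.pairing_injective σ₁) _ (LinearMap.ext fun x => ?_)
  rw [G.pairing_apply, G.bil_symm, ← G.form_pair m, h]
  rfl

/-- The Film Topological Field Theory of a graph-Frobenius algebra. -/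
noncomputable def theory : FilmTFT K B where
  copairing := G.copairing
  form X := G.form X
  form_iso := G.form_iso
  nondegenerate_left := G.nondegenerate_left
  nondegenerate_right := G.nondegenerate_right
  form_cut := G.form_cut
  form_union _ _ := G.form_union

end GraphFrobenius

end Film

namespace Film

/-! ### The chain formula -/

namespace FilmSurface

variable {S : Type w} {X : FilmSurface S}

/-- A disk that crosses the border of a set of vertices has a vertex in this set. -/
theorem exists_mem_of_mem_colors {J : Set X.V} {σ : GraphClass S} (hσ : σ.incidence = X.sideRel J)
    {d : S} (hd : d ∈ σ.colors) : ∃ v ∈ J, d ∈ (X.cls v).colors := by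
  rw [GraphClass.mem_colors_iff _ _ true, hσ] at hd
  obtain ⟨c, -, h1, -, h2, -⟩ := hd
  exact ⟨X.src c, h1.1, HasSide.mem_colors (b := true) (p := X.tgt c) ⟨c, h2, rfl, rfl⟩⟩

/-- A disk with vertices on both sides of the border of a set of vertices crosses the border. -/
theorem mem_colors_of_mem {J : Set X.V} {σ : GraphClass S} (hσ : σ.incidence = X.sideRel J)
    {d : S} {u v : X.V} (hu : u ∈ J) (hv : v ∉ J) (huv : X.Joined u v) (h1 : d ∈ (X.cls u).colors)
    (h2 : d ∈ (X.cls v).colors) : d ∈ σ.colors := by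
  obtain ⟨c, e, rfl⟩ := exists_src_of_mem_colors h1
  obtain ⟨c', e', rfl⟩ := exists_src_of_mem_colors h2
  obtain ⟨a, ha, ha'⟩ := exists_crossing_of_disk (X.color_inj c c' huv (e.trans e'.symm)) hu hv true
  rw [GraphClass.mem_colors_iff _ _ true, hσ]
  have e2 : X.color (X.disk a) = d := by rw [ha, e']
  exact ⟨a, a, ha', ha', e2, e2, rfl⟩

end FilmSurface

theorem CompatibleSurface.mem_colors_or {S : Type w} {σ₁ σ₂ σ₃ : GraphClass S}
    (m : CompatibleSurface ![σ₁, σ₂, σ₃]) {d : S} :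
    (d ∈ σ₁.colors → d ∈ σ₂.colors ∨ d ∈ σ₃.colors) ∧
      (d ∈ σ₃.colors → d ∈ σ₁.colors ∨ d ∈ σ₂.colors) := by
  have e1 : m.surface.cls (m.vertex 0) = σ₁ := m.cls_vertex 0
  have e2 : m.surface.cls (m.vertex 1) = σ₂ := m.cls_vertex 1
  have e3 : m.surface.cls (m.vertex 2) = σ₃ := m.cls_vertex 2
  have h1 := m.isTriangle.mem_colors_or (d := d)
  have h2 := m.isTriangle.rotate.rotate.mem_colors_or (d := d)
  rw [e1, e2, e3] at h1 h2
  exact ⟨h1, h2⟩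

namespace GraphFrobenius

variable {K : Type u} [Field K] {S : Type w} {B : GraphClass S → Type v}
  [∀ σ, AddCommGroup (B σ)] [∀ σ, Module K (B σ)]
  (G : GraphFrobenius K B) {X : FilmSurface S}

theorem nonempty_of_tri_ne_zero {σ₁ σ₂ σ₃ : GraphClass S} {x y z : ⨁ σ, B σ} (hx : IsHom B σ₁ x)
    (hy : IsHom B σ₂ y) (hz : IsHom B σ₃ z) (h : G.tri x y z ≠ 0) :
    Nonempty (CompatibleSurface ![σ₁, σ₂, σ₃]) := by
  obtain ⟨x, rfl⟩ := hx
  obtain ⟨y, rfl⟩ := hy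
  obtain ⟨z, rfl⟩ := hz
  by_contra hno
  exact h (G.tri_eq_zero x y z (not_nonempty_iff.1 hno))

/-- If a chain does not vanish, then the colors of its first entry occur in the other entries. -/
theorem colors_of_chain_ne_zero {ξ : X.V → ⨁ σ, B σ} (hξ : ∀ v, IsHom B (X.cls v) (ξ v))
    (b : BasisFamily K B) (F : MatrixFamily K B) (l : List X.V) {τ : GraphClass S}
    {x : ⨁ σ, B σ} (hx : IsHom B τ x) (h : G.chain b F x (l.map ξ) ≠ 0) {d : S}
    (hd : d ∈ τ.colors) : ∃ u ∈ l, d ∈ (X.cls u).colors := by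
  induction l generalizing τ x with
  | nil => exact absurd (by rw [List.map_nil, chain]) h
  | cons v l ih =>
    match l with
    | [] =>
      rw [List.map_cons, List.map_nil, chain] at h
      obtain ⟨x, rfl⟩ := hx
      obtain ⟨y, hy⟩ := hξ v
      rw [← hy] at h
      have hτ : τ = (X.cls v).star := by
        by_contra hne
        exact h (G.bil_eq_zero x y hne)
      rw [hτ, GraphClass.colors_star] at hd
      exact ⟨v, by simp, hd⟩
    | [w] =>
      rw [List.map_cons, List.map_cons, List.map_nil, chain] at h
      obtain ⟨m⟩ := G.nonempty_of_tri_ne_zero hx (hξ v) (hξ w) h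
      rcases m.mem_colors_or.1 hd with h | h
      · exact ⟨v, by simp, h⟩
      · exact ⟨w, by simp, h⟩
    | w :: t :: l =>
      rw [List.map_cons, List.map_cons, List.map_cons, chain] at h
      have hs : ∃ s i j, G.tri x (ξ v) (incl (b s i)) ≠ 0 ∧
          G.chain b F (incl (b s.star j)) ((w :: t :: l).map ξ) ≠ 0 := by
        by_contra hno
        push Not at hno
        refine h ((finsum_congr fun s => ?_).trans finsum_zero)
        refine Finset.sum_eq_zero fun i _ => Finset.sum_eq_zero fun j _ => ?_
        by_cases h1 : G.tri x (ξ v) (incl (b s i)) = 0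
        · rw [h1, zero_mul, zero_mul]
        · have h2 := hno s i j h1
          simp only [List.map_cons] at h2
          rw [h2, mul_zero]
      obtain ⟨s, i, j, h1, h2⟩ := hs
      obtain ⟨m⟩ := G.nonempty_of_tri_ne_zero hx (hξ v) (isHom_incl _) h1
      rcases m.mem_colors_or.1 hd with h | h
      · exact ⟨v, by simp, h⟩
      · rw [← GraphClass.colors_star] at h
        obtain ⟨u, hu, hu'⟩ := ih (isHom_incl _) h2 h
        exact ⟨u, List.mem_cons_of_mem _ hu, hu'⟩

variable [∀ σ, FiniteDimensional K (B σ)]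

/-- The chain computes the pairing of products.  In each sum over all classes only the class of the
graph-cut of the surface contributes. -/
theorem chain_eq_bil {ξ : X.V → ⨁ σ, B σ} (hξ : ∀ v, IsHom B (X.cls v) (ξ v))
    {b : BasisFamily K B} {F : MatrixFamily K B} (hF : IsInverseGram K G.bil b F)
    {l₁ l₂ : List X.V} (h : X.IsCycle (l₁ ++ l₂)) (h1 : l₁ ≠ []) (h2 : l₂ ≠ []) {x : ⨁ σ, B σ}
    (hx : HomRel B (X.listRel l₁) x) : G.chain b F x (l₂.map ξ) = G.bil x (G.prod ξ l₂) := by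
  induction l₂ generalizing l₁ x with
  | nil => exact absurd rfl h2
  | cons v l ih =>
    by_cases hl : l = []
    · subst hl
      rw [List.map_cons, List.map_nil, chain, prod_singleton]
    have h' : X.IsCycle (l₁ ++ ([v] ++ l)) := h
    have r1 : X.IsCycle ((l₁ ++ [v]) ++ l) := by simpa using h
    have hrot : X.IsCycle (l ++ (l₁ ++ [v])) := r1.rotate
    have hl' := G.homRel_prod hξ hrot hl (by simp)
    obtain ⟨s, hs, hs'⟩ := hrot.exists_class hl (by simp)
    obtain ⟨τ, hτ, hx'⟩ := id hx
    have hR : G.bil x (G.prod ξ (v :: l)) = G.tri x (ξ v) (G.prod ξ l) := by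
      rw [prod_cons _ _ _ hl]
      refine (G.bil_mulRel h' h1 (by simp) hl hx hl').symm.trans ?_
      rw [G.mulRel_eq hs', G.bil_mul _ _ (hl'.isHom hs)]
    rw [hR]
    match l, hl with
    | [w], _ =>
      rw [List.map_cons, List.map_cons, List.map_nil, chain, prod_singleton]
    | w :: t :: l, hl =>
      have hterm : ∀ (s' : GraphClass S) i j, s' ≠ s → G.tri x (ξ v) (incl (b s' i)) * F s' i j *
          G.chain b F (incl (b s'.star j)) (ξ w :: ξ t :: l.map ξ) = 0 := by
        intro s' i j hne
        by_contra h0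
        have ht : G.tri x (ξ v) (incl (b s' i)) ≠ 0 := fun e => h0 (by rw [e, zero_mul, zero_mul])
        have hc : G.chain b F (incl (b s'.star j)) ((w :: t :: l).map ξ) ≠ 0 := fun e => by
          rw [List.map_cons, List.map_cons] at e
          exact h0 (by rw [e, mul_zero])
        obtain ⟨m'⟩ := G.nonempty_of_tri_ne_zero hx' (hξ v) (isHom_incl _) ht
        have e2 : (X.cls v).incidence = X.listRel [v] := (FilmSurface.listRel_singleton v).symm
        obtain ⟨m⟩ := h'.nonempty_compatibleSurface₃ h1 (by simp) hl hτ e2 hs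
        refine hne (third_class_unique m m' fun d hd => ?_)
        have hd' := hd
        rw [← GraphClass.colors_star] at hd'
        obtain ⟨u, hu, hdu⟩ := G.colors_of_chain_ne_zero hξ b F _ (isHom_incl _) hc hd'
        have hv : ∃ p ∈ l₁ ++ [v], d ∈ (X.cls p).colors := by
          rcases m'.mem_colors_or.2 hd with k | k
          · obtain ⟨p, hp, k⟩ := FilmSurface.exists_mem_of_mem_colors hτ k
            exact ⟨p, List.mem_append_left _ hp, k⟩
          · exact ⟨v, by simp, k⟩
        obtain ⟨p, hp, hdp⟩ := hv
        exact FilmSurface.mem_colors_of_mem hs hu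
          (fun k => (List.nodup_append.1 hrot.nodup).2.2 p k p hp rfl)
          ((hrot.joined u (List.mem_append_left _ hu) p).2 (List.mem_append_right _ hp)) hdu hdp
      have hstep : ∀ j, G.chain b F (incl (b s.star j)) (ξ w :: ξ t :: l.map ξ) =
          G.bil (incl (b s.star j)) (G.prod ξ (w :: t :: l)) := fun j =>
        ih r1 (by simp) hl ⟨s.star, hs', isHom_incl _⟩
      rw [List.map_cons, List.map_cons, List.map_cons, chain,
        finsum_eq_single _ s (fun s' hne => Finset.sum_eq_zero fun i _ =>
          Finset.sum_eq_zero fun j _ => hterm s' i j hne), ← G.bil_mul _ _ (hl'.isHom hs),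
        G.mul_eq_sum s hF]
      simp only [hstep, map_sum, map_smul, LinearMap.sum_apply, LinearMap.smul_apply, smul_eq_mul]

/-- The chain formula for the theory of a graph-Frobenius algebra. -/
theorem form_eq_chain {b : BasisFamily K B} {F : MatrixFamily K B} (hF : IsInverseGram K G.bil b F)
    {n : ℕ} {σ : Fin (n + 1) → GraphClass S} (m : CompatibleSurface σ) (x : ∀ i, B (σ i)) :
    G.form m.surface (m.tensor x) =
      G.chain b F (incl (x 0)) (List.ofFn fun i : Fin n => incl (x i.succ)) := by
  obtain ⟨ξ, hξ, h1, h2⟩ := G.form_tensor m x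
  have hm := m.isCycle
  rw [List.ofFn_succ] at hm
  have hc := G.chain_eq_bil hξ hF (l₁ := [m.vertex 0])
    (l₂ := List.ofFn fun i : Fin n => m.vertex i.succ) hm (by simp) hm.tail_ne_nil
    (x := incl (x 0)) ⟨σ 0, by rw [FilmSurface.listRel_singleton, m.cls_vertex], isHom_incl _⟩
  rw [h2, List.ofFn_succ, val, h1, ← hc, List.map_ofFn]
  congr 2
  funext i
  exact h1 i.succ

theorem theory_generates : G.theory.Generates G where
  bil_eq m x y := (G.form_pair m x y).symm
  tri_eq m x y z := by
    let b : BasisFamily K B := fun σ => Module.finBasis K (B σ)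
    obtain ⟨F, hF⟩ := G.exists_isInverseGram b
    refine Eq.trans ?_ (G.form_eq_chain hF m (triple x y z)).symm
    have : (List.ofFn fun i : Fin 2 => incl (B := B) (triple x y z i.succ)) = [incl y, incl z] := by
      rw [List.ofFn_succ, List.ofFn_succ, List.ofFn_zero]
      rfl
    rw [this, chain]
    rfl

end GraphFrobenius

end Film

namespace Film

/-! ### Decomposition of film surfaces -/

namespace FilmSurface

variable {S : Type w} {X : FilmSurface S}

open Classical in
/-- The graph-cut that separates a cyclic interval of vertices, the `+` side, from the others. -/
noncomputable def IsArc.graphCut {J : Set X.V} (hJ : X.IsArc J) : X.GraphCut where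
  side v := decide (v ∈ J)
  side_surjective := by
    obtain ⟨a, ha, b, hb, -⟩ := hJ.proper
    rintro (_ | _)
    · exact ⟨b, decide_eq_false hb⟩
    · exact ⟨a, decide_eq_true ha⟩
  compatible a b a' b' h1 h2 h3 := by
    simp only [decide_eq_decide, ne_eq] at h1 h2 h3
    exact hJ.not_alternate h1 h2 h3

theorem IsArc.side_graphCut {J : Set X.V} (hJ : X.IsArc J) (v : X.V) :
    hJ.graphCut.side v = true ↔ v ∈ J := by
  simp [graphCut]

namespace GraphCut

variable (γ : GraphCut X) (hX : X.Connected)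

theorem isClopen_compl_piece : (γ.cut hX).IsClopen {x | γ.sideOf x = true}ᶜ where
  nonempty := ⟨Sum.inr false, Bool.false_ne_true⟩
  closed h h' h'' := h' (((γ.joined_iff hX).1 h).trans h'')

/-- A piece of the cut surface has fewer vertices than the surface if the other piece contains at
least two of them. -/
theorem card_lt {b : Bool} {v w : X.V} (hvw : v ≠ w) (hv : γ.side v ≠ b) (hw : γ.side w ≠ b) :
    Nat.card {x : X.V ⊕ Bool // γ.sideOf x = b} < Nat.card X.V := by
  have := X.finV
  -- one of the two vertices does not represent the contracted part
  obtain ⟨u, hu, hu'⟩ : ∃ u, γ.side u ≠ b ∧ u ≠ γ.rep (!b) := by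
    by_cases h : v = γ.rep (!b)
    · exact ⟨w, hw, fun k => hvw (h.trans k.symm)⟩
    · exact ⟨v, hv, h⟩
  have hne : ∀ x, γ.sideOf x = b → γ.place x ≠ u := by
    rintro (x | b') hx rfl
    · exact hu hx
    · obtain rfl : b' = b := hx
      exact hu' rfl
  refine lt_of_le_of_lt (Nat.card_le_card_of_injective
    (fun x : {x : X.V ⊕ Bool // γ.sideOf x = b} => (⟨γ.place x.1, hne _ x.2⟩ : {x // x ≠ u}))
    fun x y h => Subtype.ext (γ.place_inj (x.2.trans y.2.symm) (congrArg Subtype.val h)))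
    (Finite.card_subtype_lt (p := fun x => x ≠ u) (x := u) (by simp))

end GraphCut

end FilmSurface

/-- A cyclic list of the vertices of a connected surface numbers the vertices. -/
noncomputable def FilmSurface.IsCycle.compatibleSurface {S : Type w} {X : FilmSurface S}
    (hX : X.Connected) {l : List X.V} (hl : X.IsCycle l) {σ : Fin l.length → GraphClass S}
    (hσ : ∀ i, X.cls (l.get i) = σ i) : CompatibleSurface σ where
  surface := X
  connected := hX
  vertex := Equiv.ofBijective l.get ⟨List.nodup_iff_injective_get.1 hl.nodup, fun v => by
    obtain ⟨w, hw⟩ := List.exists_mem_of_ne_nil _ hl.ne_nil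
    exact List.get_of_mem ((hl.joined w hw v).1 (hX _ _))⟩
  cyc_vertex i j k hij hjk := by
    refine hl.cyc _ _ _ ?_
    rw [List.sublist_iff_exists_fin_orderEmbedding_get_eq]
    refine ⟨OrderEmbedding.ofStrictMono ![i, j, k] ?_, ?_⟩
    · intro a b hab
      fin_cases a <;> fin_cases b <;> simp_all
      exact hij.trans hjk
    · intro a
      fin_cases a <;> rfl
  cls_vertex := hσ

section Theories

variable {K : Type u} [Field K] {S : Type w} {B : GraphClass S → Type v}
  [∀ σ, AddCommGroup (B σ)] [∀ σ, Module K (B σ)] {X : FilmSurface S}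

theorem CompatibleSurface.tensor_eq_tprod {n : ℕ} {σ : Fin n → GraphClass S}
    (m : CompatibleSurface σ) {x : ∀ i, B (σ i)} {y : ∀ q, B (m.surface.cls q)}
    (h : ∀ i, incl (x i) = incl (y (m.vertex i))) : m.tensor x = PiTensorProduct.tprod K y := by
  unfold CompatibleSurface.tensor
  refine congrArg (PiTensorProduct.tprod K) (funext fun q => ?_)
  obtain ⟨i, rfl⟩ := m.vertex.surjective q
  apply incl_injective
  rw [incl_castB, ← h]
  exact congrArg (fun j => incl (x j)) (m.vertex.symm_apply_apply i)

theorem exists_restrict_family {U : Set X.V} (hU : X.IsClopen U) (x : ∀ q, B (X.cls q)) :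
    ∃ y : ∀ q, B ((FilmSurface.restrict hU).cls q), ∀ q : U, incl (y q) = incl (x q.1) := by
  have h : ∀ {σ τ : GraphClass S} (_ : σ = τ) (a : B σ), ∃ y : B τ, incl y = incl a := by
    rintro σ _ rfl a
    exact ⟨a, rfl⟩
  choose y hy using fun q : (FilmSurface.restrict hU).V =>
    h ((FilmSurface.restrictEmb hU).cls_eq q) (x q.1)
  exact ⟨y, hy⟩

/-- A theory is multiplicative under decompositions into unions of components. -/
theorem FilmTFT.form_restrict (T : FilmTFT K B) {U : Set X.V} (hU : X.IsClopen U)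
    (hU' : X.IsClopen Uᶜ) {x : ∀ q, B (X.cls q)} {y : ∀ q, B ((FilmSurface.restrict hU).cls q)}
    {z : ∀ q, B ((FilmSurface.restrict hU').cls q)} (hy : ∀ q : U, incl (y q) = incl (x q.1))
    (hz : ∀ q : (Uᶜ : Set X.V), incl (z q) = incl (x q.1)) :
    T.form X (PiTensorProduct.tprod K x) =
      T.form _ (PiTensorProduct.tprod K y) * T.form _ (PiTensorProduct.tprod K z) := by
  rw [← T.form_union]
  obtain ⟨a, ha, ha1, ha2⟩ := exists_unionMap_tprod (K := K) _ _ y z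
  obtain ⟨b, hb, hb1⟩ := exists_isoMap_tprod (K := K) (FilmSurface.unionRestrictIso hU hU') a
  rw [ha, ← T.form_iso (FilmSurface.unionRestrictIso hU hU'), hb]
  refine congrArg (fun x => T.form X (PiTensorProduct.tprod K x)) (funext fun q => ?_)
  apply incl_injective
  by_cases hq : q ∈ U
  · exact (hy ⟨q, hq⟩).symm.trans ((ha1 ⟨q, hq⟩).symm.trans (hb1 (Sum.inl ⟨q, hq⟩)).symm)
  · exact (hz ⟨q, hq⟩).symm.trans ((ha2 ⟨q, hq⟩).symm.trans (hb1 (Sum.inr ⟨q, hq⟩)).symm)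

/-- Theories that agree on two complementary unions of components of a surface agree on the surface. -/
theorem FilmTFT.form_eq_of_restrict {T T' : FilmTFT K B} {U : Set X.V} (hU : X.IsClopen U)
    (hU' : X.IsClopen Uᶜ)
    (h : T.form (FilmSurface.restrict hU) = T'.form (FilmSurface.restrict hU))
    (h' : T.form (FilmSurface.restrict hU') = T'.form (FilmSurface.restrict hU')) :
    T.form X = T'.form X := by
  refine form_ext fun x => ?_
  obtain ⟨y, hy⟩ := exists_restrict_family hU x
  obtain ⟨z, hz⟩ := exists_restrict_family hU' x
  rw [T.form_restrict hU hU' hy hz, T'.form_restrict hU hU' hy hz, h, h']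

/-! ### Surfaces with at most three vertices -/

variable {T : FilmTFT K B} {G : GraphFrobenius K B}

theorem FilmTFT.Generates.form_eq_of_card_le {T' : FilmTFT K B} (h : T.Generates G)
    (h' : T'.Generates G) (hX : X.Connected) (hc : Nat.card X.V ≤ 3) : T.form X = T'.form X := by
  obtain ⟨v⟩ := X.nonemptyV
  obtain ⟨l, hl, hv⟩ := FilmSurface.exists_isCycle v
  have hlen : l.length ≤ 3 := by
    have := X.finV
    have : Fintype X.V := Fintype.ofFinite _
    rw [Nat.card_eq_fintype_card] at hc
    exact hl.nodup.length_le_card.trans hc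
  refine form_ext fun x => ?_
  match l, hlen with
  | [], _ => exact absurd rfl hl.ne_nil
  | [_], _ => exact absurd rfl hl.tail_ne_nil
  | [p, q], _ =>
    let m : CompatibleSurface ![X.cls p, X.cls q] := hl.compatibleSurface hX (fun i => by
      fin_cases i <;> rfl)
    have e : m.tensor (pair (x p) (x q)) = PiTensorProduct.tprod K x :=
      m.tensor_eq_tprod fun i => by fin_cases i <;> rfl
    rw [← e]
    exact (h.bil_eq m (x p) (x q)).symm.trans (h'.bil_eq m (x p) (x q))
  | [p, q, r], _ =>
    let m : CompatibleSurface ![X.cls p, X.cls q, X.cls r] := hl.compatibleSurface hX (fun i => by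
      fin_cases i <;> rfl)
    have e : m.tensor (triple (x p) (x q) (x r)) = PiTensorProduct.tprod K x :=
      m.tensor_eq_tprod fun i => by fin_cases i <;> rfl
    rw [← e]
    exact (h.tri_eq m (x p) (x q) (x r)).symm.trans (h'.tri_eq m (x p) (x q) (x r))
  | _ :: _ :: _ :: _ :: _, hlen =>
    simp only [List.length_cons] at hlen
    omega

theorem CompatibleSurface.isCycle_pair {σ₁ σ₂ : GraphClass S} (m : CompatibleSurface ![σ₁, σ₂]) :
    m.surface.IsCycle [m.vertex 0, m.vertex 1] := by
  have := m.isCycle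
  rwa [List.ofFn_succ, List.ofFn_succ, List.ofFn_zero] at this

end Theories

end Film

namespace Film

/-! ### The forms of a theory -/

section Multilinear

variable {K : Type u} [Field K] {S : Type w} {B : GraphClass S → Type v}
  [∀ σ, AddCommGroup (B σ)] [∀ σ, Module K (B σ)]

/-- A multilinear form in two variables as a bilinear form. -/
noncomputable def bilinear {σ₁ σ₂ : GraphClass S} (f : MultilinearMap K (fun i => B (![σ₁, σ₂] i)) K) :
    B σ₁ →ₗ[K] B σ₂ →ₗ[K] K :=
  LinearMap.mk₂ K (fun x y => f (pair x y)) (fun x x' _ => f.cons_add _ x x')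
    (fun c x _ => f.cons_smul _ c x) (fun x y y' => (f.curryLeft x).cons_add _ y y')
    (fun c x y => (f.curryLeft x).cons_smul _ c y)

/-- A multilinear form in three variables as a trilinear form. -/
noncomputable def trilinear {σ₁ σ₂ σ₃ : GraphClass S}
    (f : MultilinearMap K (fun i => B (![σ₁, σ₂, σ₃] i)) K) :
    B σ₁ →ₗ[K] B σ₂ →ₗ[K] B σ₃ →ₗ[K] K where
  toFun x := bilinear (σ₁ := σ₂) (σ₂ := σ₃) (f.curryLeft x)
  map_add' x x' := LinearMap.ext₂ fun _ _ => f.cons_add _ x x'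
  map_smul' c x := LinearMap.ext₂ fun _ _ => f.cons_smul _ c x

/-- The bilinear form on the direct sum with given values on the homogeneous components. -/
noncomputable def directSumBil (f : ∀ σ τ, B σ →ₗ[K] B τ →ₗ[K] K) :
    (⨁ σ, B σ) →ₗ[K] (⨁ σ, B σ) →ₗ[K] K :=
  DirectSum.toModule K _ _ fun σ => (DirectSum.toModule K _ _ fun τ => (f σ τ).flip).flip

theorem directSumBil_incl (f : ∀ σ τ, B σ →ₗ[K] B τ →ₗ[K] K) {σ τ : GraphClass S} (x : B σ)
    (y : B τ) : directSumBil f (incl x) (incl y) = f σ τ x y := by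
  rw [directSumBil, ← inclₗ_apply (K := K), ← inclₗ_apply (K := K), inclₗ, inclₗ,
    DirectSum.toModule_lof, LinearMap.flip_apply, DirectSum.toModule_lof, LinearMap.flip_apply]

/-- The trilinear form on the direct sum with given values on the homogeneous components. -/
noncomputable def directSumTri (f : ∀ σ τ ρ, B σ →ₗ[K] B τ →ₗ[K] B ρ →ₗ[K] K) :
    (⨁ σ, B σ) →ₗ[K] (⨁ σ, B σ) →ₗ[K] (⨁ σ, B σ) →ₗ[K] K :=
  DirectSum.toModule K _ _ fun σ => LinearMap.flip <| DirectSum.toModule K _ _ fun τ =>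
    LinearMap.flip <| LinearMap.lflip.toLinearMap ∘ₗ LinearMap.flip
      (DirectSum.toModule K _ _ fun ρ => LinearMap.flip (LinearMap.lflip.toLinearMap ∘ₗ f σ τ ρ))

theorem directSumTri_incl (f : ∀ σ τ ρ, B σ →ₗ[K] B τ →ₗ[K] B ρ →ₗ[K] K) {σ τ ρ : GraphClass S}
    (x : B σ) (y : B τ) (z : B ρ) :
    directSumTri f (incl x) (incl y) (incl z) = f σ τ ρ x y z := by
  rw [directSumTri, ← inclₗ_apply (K := K), ← inclₗ_apply (K := K), ← inclₗ_apply (K := K), inclₗ,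
    inclₗ, inclₗ, DirectSum.toModule_lof, LinearMap.flip_apply, DirectSum.toModule_lof,
    LinearMap.flip_apply, LinearMap.comp_apply]
  change DirectSum.toModule K _ (B σ →ₗ[K] B τ →ₗ[K] K) (fun ρ => LinearMap.flip
    (LinearMap.lflip.toLinearMap ∘ₗ f σ τ ρ)) (DirectSum.lof K _ B ρ z) x y = _
  rw [DirectSum.toModule_lof]
  rfl

end Multilinear

section Theories

variable {K : Type u} [Field K] {S : Type w} {B : GraphClass S → Type v}
  [∀ σ, AddCommGroup (B σ)] [∀ σ, Module K (B σ)]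

namespace CompatibleSurface

variable {n : ℕ} {σ : Fin n → GraphClass S} (m : CompatibleSurface σ)

/-- The family of factors of the tensor `m.tensor x`. -/
def family (K : Type u) [Field K] {B : GraphClass S → Type v} [∀ σ, AddCommGroup (B σ)]
    [∀ σ, Module K (B σ)] (x : ∀ i, B (σ i)) : ∀ q, B (m.surface.cls q) := fun q =>
  castB (K := K) (by rw [← m.cls_vertex, Equiv.apply_symm_apply]) (x (m.vertex.symm q))

theorem tensor_eq_family (x : ∀ i, B (σ i)) :
    m.tensor x = PiTensorProduct.tprod K (m.family K x) := rfl

theorem incl_family (x : ∀ i, B (σ i)) (i : Fin n) :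
    incl (m.family K x (m.vertex i)) = incl (x i) := by
  rw [family, incl_castB]
  exact congrArg (fun j => incl (x j)) (m.vertex.symm_apply_apply i)

variable (K B) in
/-- The tensors `x_1 ⊗ ⋯ ⊗ x_n` as a multilinear map. -/
noncomputable def multiTensor : MultilinearMap K (fun i => B (σ i)) (VSpace K B m.surface) :=
  ((PiTensorProduct.reindex K (fun i => B (σ i)) m.vertex).trans
    (PiTensorProduct.congr fun q => castB (by
      rw [← m.cls_vertex, Equiv.apply_symm_apply]))).toLinearMap.compMultilinearMap
    (PiTensorProduct.tprod K)

theorem multiTensor_apply (x : ∀ i, B (σ i)) : m.multiTensor K B x = m.tensor x := by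
  rw [multiTensor, LinearMap.compMultilinearMap_apply, LinearEquiv.coe_coe, LinearEquiv.trans_apply,
    PiTensorProduct.reindex_tprod, PiTensorProduct.congr_tprod]
  rfl

end CompatibleSurface

namespace FilmTFT

variable (T : FilmTFT K B)

theorem form_tensor_eq {n : ℕ} {σ : Fin n → GraphClass S} (m m' : CompatibleSurface σ)
    (x : ∀ i, B (σ i)) : T.form m.surface (m.tensor x) = T.form m'.surface (m'.tensor x) := by
  obtain ⟨φ, hφ⟩ := m.exists_iso m'
  obtain ⟨z, hz, hz'⟩ := exists_isoMap_tprod (K := K) φ (m.family K x)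
  rw [m.tensor_eq_family, ← T.form_iso φ, hz, m'.tensor_eq_tprod (K := K) (y := z)]
  intro i
  rw [← hφ, hz', m.incl_family]

/-- The values of a theory on the surfaces with given classes of vertices. -/
noncomputable def multiForm {n : ℕ} (σ : Fin n → GraphClass S) :
    MultilinearMap K (fun i => B (σ i)) K :=
  open Classical in
  if h : Nonempty (CompatibleSurface σ) then
    (T.form h.some.surface).compMultilinearMap (h.some.multiTensor K B)
  else 0

theorem multiForm_apply {n : ℕ} {σ : Fin n → GraphClass S} (m : CompatibleSurface σ)
    (x : ∀ i, B (σ i)) : T.multiForm σ x = T.form m.surface (m.tensor x) := by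
  have h : Nonempty (CompatibleSurface σ) := ⟨m⟩
  rw [multiForm, dif_pos h, LinearMap.compMultilinearMap_apply, CompatibleSurface.multiTensor_apply]
  exact T.form_tensor_eq _ _ x

theorem multiForm_eq_zero {n : ℕ} {σ : Fin n → GraphClass S} (h : IsEmpty (CompatibleSurface σ)) :
    T.multiForm σ = 0 := by
  rw [multiForm, dif_neg (not_nonempty_iff.2 h)]

/-- The bilinear form of a theory. -/
noncomputable def bil : (⨁ σ, B σ) →ₗ[K] (⨁ σ, B σ) →ₗ[K] K :=
  directSumBil fun σ τ => bilinear (T.multiForm ![σ, τ])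

/-- The trilinear form of a theory. -/
noncomputable def tri : (⨁ σ, B σ) →ₗ[K] (⨁ σ, B σ) →ₗ[K] (⨁ σ, B σ) →ₗ[K] K :=
  directSumTri fun σ τ ρ => trilinear (T.multiForm ![σ, τ, ρ])

theorem bil_incl {σ τ : GraphClass S} (x : B σ) (y : B τ) :
    T.bil (incl x) (incl y) = T.multiForm ![σ, τ] (pair x y) :=
  directSumBil_incl _ x y

theorem tri_incl {σ τ ρ : GraphClass S} (x : B σ) (y : B τ) (z : B ρ) :
    T.tri (incl x) (incl y) (incl z) = T.multiForm ![σ, τ, ρ] (triple x y z) :=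
  directSumTri_incl _ x y z

variable {X : FilmSurface S}

/-- The value of a theory at a connected surface with two vertices. -/
theorem form_eq_bil (hX : X.Connected) {p q : X.V} (h : X.IsCycle [p, q]) (x : ∀ q, B (X.cls q)) :
    T.form X (PiTensorProduct.tprod K x) = T.bil (incl (x p)) (incl (x q)) := by
  let m : CompatibleSurface ![X.cls p, X.cls q] := h.compatibleSurface hX (fun i => by
    fin_cases i <;> rfl)
  rw [bil_incl, T.multiForm_apply m]
  exact congrArg (T.form X) (m.tensor_eq_tprod fun i => by fin_cases i <;> rfl).symm

/-- The value of a theory at a connected surface with three vertices. -/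
theorem form_eq_tri (hX : X.Connected) {p q r : X.V} (h : X.IsCycle [p, q, r])
    (x : ∀ q, B (X.cls q)) :
    T.form X (PiTensorProduct.tprod K x) = T.tri (incl (x p)) (incl (x q)) (incl (x r)) := by
  let m : CompatibleSurface ![X.cls p, X.cls q, X.cls r] := h.compatibleSurface hX (fun i => by
    fin_cases i <;> rfl)
  rw [tri_incl, T.multiForm_apply m]
  exact congrArg (T.form X) (m.tensor_eq_tprod fun i => by fin_cases i <;> rfl).symm

theorem bil_symm (x y : ⨁ σ, B σ) : T.bil x y = T.bil y x := by
  have key : ∀ {σ τ : GraphClass S} (x : B σ) (y : B τ),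
      Nonempty (CompatibleSurface ![σ, τ]) → T.bil (incl x) (incl y) = T.bil (incl y) (incl x) := by
    rintro σ τ x y ⟨m⟩
    have e0 : incl (m.family K (pair x y) (m.vertex 0)) = incl x := m.incl_family _ 0
    have e1 : incl (m.family K (pair x y) (m.vertex 1)) = incl y := m.incl_family _ 1
    rw [← e0, ← e1, ← T.form_eq_bil m.connected m.isCycle_pair,
      ← T.form_eq_bil m.connected m.isCycle_pair.rotate_one]
  suffices T.bil = T.bil.flip from LinearMap.congr_fun₂ this x y
  refine linearMap_ext_incl fun σ x => linearMap_ext_incl fun τ y => ?_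
  rw [LinearMap.flip_apply]
  by_cases h : Nonempty (CompatibleSurface ![σ, τ])
  · exact key x y h
  by_cases h' : Nonempty (CompatibleSurface ![τ, σ])
  · exact (key y x h').symm
  rw [bil_incl, bil_incl, T.multiForm_eq_zero (not_nonempty_iff.1 h),
    T.multiForm_eq_zero (not_nonempty_iff.1 h')]
  rfl

theorem bil_eq_zero {σ₁ σ₂ : GraphClass S} (x : B σ₁) (y : B σ₂) (h : σ₁ ≠ σ₂.star) :
    T.bil (incl x) (incl y) = 0 := by
  rw [bil_incl, T.multiForm_eq_zero]
  · rfl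
  · refine ⟨fun m => h ?_⟩
    rw [m.eq_star, GraphClass.star_star]

theorem tri_eq_zero {σ₁ σ₂ σ₃ : GraphClass S} (x : B σ₁) (y : B σ₂) (z : B σ₃)
    (h : IsEmpty (CompatibleSurface ![σ₁, σ₂, σ₃])) : T.tri (incl x) (incl y) (incl z) = 0 := by
  rw [tri_incl, T.multiForm_eq_zero h]
  rfl

end FilmTFT

theorem CompatibleSurface.isCycle_triple {σ₁ σ₂ σ₃ : GraphClass S}
    (m : CompatibleSurface ![σ₁, σ₂, σ₃]) :
    m.surface.IsCycle [m.vertex 0, m.vertex 1, m.vertex 2] := by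
  have := m.isCycle
  rwa [List.ofFn_succ, List.ofFn_succ, List.ofFn_succ, List.ofFn_zero] at this

theorem CompatibleSurface.rotate {σ₁ σ₂ σ₃ : GraphClass S}
    (m : CompatibleSurface ![σ₁, σ₂, σ₃]) : Nonempty (CompatibleSurface ![σ₂, σ₃, σ₁]) := by
  refine ⟨m.isCycle_triple.rotate_one.compatibleSurface m.connected fun i => ?_⟩
  fin_cases i
  · exact m.cls_vertex 1
  · exact m.cls_vertex 2
  · exact m.cls_vertex 0

namespace FilmTFT

variable (T : FilmTFT K B)

theorem tri_cyclic (x y z : ⨁ σ, B σ) : T.tri x y z = T.tri y z x := by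
  have key : ∀ {σ τ ρ : GraphClass S} (x : B σ) (y : B τ) (z : B ρ),
      Nonempty (CompatibleSurface ![σ, τ, ρ]) →
      T.tri (incl x) (incl y) (incl z) = T.tri (incl y) (incl z) (incl x) := by
    rintro σ τ ρ x y z ⟨m⟩
    have e0 : incl (m.family K (triple x y z) (m.vertex 0)) = incl x := m.incl_family _ 0
    have e1 : incl (m.family K (triple x y z) (m.vertex 1)) = incl y := m.incl_family _ 1
    have e2 : incl (m.family K (triple x y z) (m.vertex 2)) = incl z := m.incl_family _ 2
    rw [← e0, ← e1, ← e2, ← T.form_eq_tri m.connected m.isCycle_triple,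
      ← T.form_eq_tri m.connected m.isCycle_triple.rotate_one]
  have hor : ∀ {σ τ ρ : GraphClass S} (x : B σ) (y : B τ) (z : B ρ),
      T.tri (incl x) (incl y) (incl z) = T.tri (incl y) (incl z) (incl x) := by
    intro σ τ ρ x y z
    by_cases h : Nonempty (CompatibleSurface ![σ, τ, ρ])
    · exact key x y z h
    · have h' : IsEmpty (CompatibleSurface ![τ, ρ, σ]) :=
        ⟨fun m => h (m.rotate.elim fun m' => m'.rotate)⟩
      rw [T.tri_eq_zero _ _ _ (not_nonempty_iff.1 h), T.tri_eq_zero _ _ _ h']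
  induction x using DirectSum.induction_on with
  | zero => simp
  | add x x' h h' => simp only [map_add, LinearMap.add_apply, h, h']
  | of σ x =>
    induction y using DirectSum.induction_on with
    | zero => simp
    | add y y' h h' => simp only [map_add, LinearMap.add_apply, h, h']
    | of τ y =>
      induction z using DirectSum.induction_on with
      | zero => simp
      | add z z' h h' => simp only [map_add, LinearMap.add_apply, h, h']
      | of ρ z => exact hor x y z

/-- The form is non-degenerate since it pairs `B σ` and `B σ*` by the non-degenerate form of the surface
with two vertices. -/
theorem bil_nondegenerate : T.bil.Nondegenerate := by
  have key : ∀ x : ⨁ σ, B σ, (∀ y, T.bil x y = 0) → x = 0 := by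
    intro x hx
    refine DFinsupp.ext fun σ => ?_
    obtain ⟨m⟩ := nonempty_compatibleSurface_star σ
    refine T.nondegenerate_left m _ fun y => ?_
    rw [← T.multiForm_apply m, ← bil_incl, ← hx (incl y)]
    -- only the component of degree `σ` pairs with elements of degree `σ*`
    suffices (T.bil.flip (incl y)) ∘ₗ inclₗ K B σ ∘ₗ DirectSum.component K _ B σ =
      T.bil.flip (incl y) from LinearMap.congr_fun this x
    refine linearMap_ext_incl fun τ z => ?_
    rw [LinearMap.comp_apply, LinearMap.comp_apply]
    by_cases h : τ = σ
    · subst h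
      rw [← inclₗ_apply (K := K) z, inclₗ, DirectSum.component.lof_self]
    · have h1 : DirectSum.component K _ B σ (incl z) = 0 := DirectSum.of_eq_of_ne _ _ _ (Ne.symm h)
      rw [h1, map_zero, map_zero, LinearMap.flip_apply, T.bil_eq_zero]
      rwa [GraphClass.star_star]
  exact ⟨key, fun y hy => key y fun x => by rw [T.bil_symm, hy]⟩

end FilmTFT

end Theories

end Film

namespace Film

/-! ### Contractions along cuts -/

namespace FilmSurface

variable {S : Type w} {X Y : FilmSurface S}

theorem IsCycle.of_map (f : Emb X Y) {l : List X.V} (h : Y.IsCycle (l.map f.onV)) : X.IsCycle l where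
  ne_nil := by simpa using h.ne_nil
  nodup := h.nodup.of_map
  joined v hv w := by
    rw [← f.joined_iff, h.joined _ (List.mem_map_of_mem hv), List.mem_map_of_injective f.injective]
  cyc a b c hs := (f.cyc_iff _ _ _).1 (h.cyc _ _ _ (hs.map f.onV))

/-- The part of a cyclic list on one side of a cut gives a cyclic list of a piece of the cut surface. -/
theorem GraphCut.isCycle_cut (γ : GraphCut X) (hX : X.Connected) {l l' : List X.V}
    (h : X.IsCycle (l ++ l')) (hl' : l' ≠ []) {b : Bool} (h1 : ∀ v ∈ l, γ.side v = b)
    (h2 : ∀ v ∈ l', γ.side v ≠ b) : (γ.cut hX).IsCycle (Sum.inr b :: l.map Sum.inl) where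
  ne_nil := List.cons_ne_nil _ _
  nodup := by
    refine List.nodup_cons.2 ⟨fun hb => ?_, (List.nodup_append.1 h.nodup).1.map Sum.inl_injective⟩
    obtain ⟨v, -, hv⟩ := List.mem_map.1 hb
    cases hv
  joined x hx y := by
    have hmem : ∀ y : X.V ⊕ Bool, y ∈ (Sum.inr b :: l.map Sum.inl : List (X.V ⊕ Bool)) ↔
        γ.sideOf y = b := by
      have hl : ∀ v, v ∈ l ↔ γ.side v = b := fun v => by
        refine ⟨h1 v, fun hv => ?_⟩
        obtain ⟨w, hw⟩ := List.exists_mem_of_ne_nil _ hl'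
        rcases List.mem_append.1 ((h.joined w (List.mem_append_right _ hw) v).1 (hX _ _)) with k | k
        · exact k
        · exact absurd hv (h2 v k)
      rintro (v | b')
      · simpa [GraphCut.sideOf] using hl v
      · simp [GraphCut.sideOf]
    exact ((γ.joined_iff hX).trans (by rw [(hmem x).1 hx, eq_comm])).trans (hmem y).symm
  cyc x y z hs := by
    have hcyc : ∀ {u v w : X.V}, X.cyc u v w → γ.contract b u ≠ γ.contract b v →
      γ.contract b v ≠ γ.contract b w → γ.contract b u ≠ γ.contract b w →
      (γ.cut hX).cyc (γ.contract b u) (γ.contract b v) (γ.contract b w) := γ.contract_cyc hX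
    have hsub : ∀ l₀ : List (γ.cut hX).V, List.Sublist l₀ (l.map Sum.inl) → ∃ t,
        List.Sublist t l ∧ l₀ = t.map Sum.inl := fun _ hs => List.sublist_map_iff.1 hs
    rcases List.sublist_cons_iff.1 hs with hs | ⟨t', hcons, hs⟩
    · obtain ⟨t, ht, e⟩ := hsub _ hs
      match t, e with
      | [u, v, w], e =>
        simp only [List.map_cons, List.map_nil] at e
        cases e
        have k := h.cyc u v w (ht.trans (List.sublist_append_left _ _))
        have e1 := γ.contract_of_eq (h1 u (ht.subset (by simp)))
        have e2 := γ.contract_of_eq (h1 v (ht.subset (by simp)))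
        have e3 := γ.contract_of_eq (h1 w (ht.subset (by simp)))
        have := hcyc k
        rw [e1, e2, e3] at this
        exact this (fun e => cyc_ne₁ k (Sum.inl.inj e)) (fun e => cyc_ne₂ k (Sum.inl.inj e))
          (fun e => cyc_ne₃ k (Sum.inl.inj e))
    · obtain ⟨rfl, rfl⟩ := List.cons.inj hcons
      obtain ⟨t, ht, e⟩ := hsub _ hs
      match t, e with
      | [u, v], e =>
        simp only [List.map_cons, List.map_nil] at e
        cases e
        obtain ⟨w, hw⟩ := List.exists_mem_of_ne_nil _ hl'
        have k := h.cyc_of_sublist_pair ht hw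
        have e1 := γ.contract_of_eq (h1 u (ht.subset (by simp)))
        have e2 := γ.contract_of_eq (h1 v (ht.subset (by simp)))
        have e3 := γ.contract_of_ne (h2 w hw)
        have := hcyc k
        rw [e1, e2, e3] at this
        exact cyc_rotate₂ (X := γ.cut hX) (this (fun e => cyc_ne₁ k (Sum.inl.inj e))
          Sum.inl_ne_inr Sum.inl_ne_inr)

end FilmSurface

section Theories

variable {K : Type u} [Field K] {S : Type w} {B : GraphClass S → Type v}
  [∀ σ, AddCommGroup (B σ)] [∀ σ, Module K (B σ)] {X : FilmSurface S}

namespace FilmTFT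

variable (T : FilmTFT K B)

/-- The value of a theory at a cut surface, in terms of its values at the two pieces. -/
theorem form_cutInsert (hX : X.Connected) (γ : X.GraphCut) (x : ∀ q, B (X.cls q))
    (f : Bool → (⨁ σ, B σ) →ₗ[K] K)
    (hf : ∀ b (U : Set (γ.cut hX).V) (hU : (γ.cut hX).IsClopen U)
      (hb : ∀ q, q ∈ U ↔ γ.sideOf q = b) (z : ∀ q, B ((FilmSurface.restrict hU).cls q)),
      (FilmSurface.restrict hU).Connected →
      (∀ v (hv : γ.side v = b), incl (z ⟨Sum.inl v, (hb (Sum.inl v)).2 hv⟩) = incl (x v)) →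
      T.form _ (PiTensorProduct.tprod K z) = f b (incl (z ⟨Sum.inr b, (hb (Sum.inr b)).2 rfl⟩)))
    (k : B ((γ.cut hX).cls (Sum.inr true)) ⊗[K] B ((γ.cut hX).cls (Sum.inr true)).star) :
    T.form (γ.cut hX) (cutInsert hX γ (PiTensorProduct.tprod K x) k) =
      contract₂ (f true) (f false) k := by
  induction k using TensorProduct.induction_on with
  | zero => simp only [map_zero]
  | add k k' h h' => rw [map_add, map_add, h, h', map_add]
  | tmul p q =>
    obtain ⟨z, hz, hz1, hz2, hz3⟩ := exists_cutInsert_tprod (K := K) hX γ x p q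
    have hU := γ.isClopen_piece hX true
    have hU' := γ.isClopen_compl_piece hX
    obtain ⟨y, hy⟩ := exists_restrict_family hU z
    obtain ⟨y', hy'⟩ := exists_restrict_family hU' z
    rw [hz, T.form_restrict hU hU' hy hy', contract₂_tmul, hf true _ hU (fun _ => Iff.rfl),
      hf false _ hU' (fun _ => Iff.of_eq (Bool.not_eq_true _))]
    · exact congrArg₂ (fun a b => f true a * f false b) ((hy _).trans hz2) ((hy' _).trans hz3)
    · intro v w
      refine (FilmSurface.restrict_joined hU').2 ((γ.joined_iff hX).2 ?_)
      exact (Bool.eq_false_of_not_eq_true v.2).trans (Bool.eq_false_of_not_eq_true w.2).symm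
    · exact fun v hv => (hy' _).trans (hz1 v)
    · exact γ.piece_connected hX true
    · exact fun v hv => (hy _).trans (hz1 v)

/-- The value of a theory at a connected surface, cut between the parts `l₁` and `l₂` of a cyclic list
of its vertices.  The forms `f true` and `f false` are the values of the two pieces as functions of the
factor at the new vertex. -/
theorem form_eq_contract₂ (hX : X.Connected) {l₁ l₂ : List X.V} (h : X.IsCycle (l₁ ++ l₂))
    (h1 : l₁ ≠ []) (h2 : l₂ ≠ []) (x : ∀ q, B (X.cls q)) (f : Bool → (⨁ σ, B σ) →ₗ[K] K)
    (hf : ∀ b (Y : FilmSurface S), Y.Connected → ∀ (g : X.V → Y.V) (q : Y.V)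
      (z : ∀ q, B (Y.cls q)), (∀ v ∈ bif b then l₁ else l₂, incl (z (g v)) = incl (x v)) →
      Y.IsCycle (q :: (bif b then l₁ else l₂).map g) →
      T.form Y (PiTensorProduct.tprod K z) = f b (incl (z q)))
    {τ : GraphClass S} (hτ : τ.incidence = X.listRel l₂) :
    T.form X (PiTensorProduct.tprod K x) = contract₂ (f true) (f false) (T.copairing τ) := by
  classical
  have hJ := h.isArc h1 h2
  have hside : ∀ b v, v ∈ (bif b then l₁ else l₂) → hJ.graphCut.side v = b := by
    rintro (_ | _) v hv
    · rw [Bool.eq_false_iff, ne_eq, hJ.side_graphCut]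
      exact fun hv' => (List.nodup_append.1 h.nodup).2.2 v hv' v hv rfl
    · exact (hJ.side_graphCut v).2 hv
  have hcut : ∀ b, (hJ.graphCut.cut hX).IsCycle
      (Sum.inr b :: (bif b then l₁ else l₂).map Sum.inl) := by
    have hne : ∀ b v, v ∈ (bif b then l₁ else l₂) → hJ.graphCut.side v ≠ !b := fun b v hv => by
      rw [hside b v hv]
      cases b <;> simp
    rintro (_ | _)
    · exact hJ.graphCut.isCycle_cut hX h.rotate h1 (hside false) (hne true)
    · exact hJ.graphCut.isCycle_cut hX h h2 (hside true) (hne false)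
  have hcls : (hJ.graphCut.cut hX).cls (Sum.inr true) = τ := by
    apply GraphClass.incidence_injective
    refine (hJ.graphCut.incidence_cls_cut_inr hX true).trans ?_
    rw [hτ]
    refine congrArg X.sideRel (Set.ext fun v => ?_)
    change hJ.graphCut.side v ≠ true ↔ v ∈ l₂
    refine ⟨fun hv => ?_, fun hv => ?_⟩
    · rw [ne_eq, hJ.side_graphCut] at hv
      obtain ⟨u, hu⟩ := List.exists_mem_of_ne_nil _ h1
      exact (List.mem_append.1 ((h.joined u (List.mem_append_left _ hu) v).1 (hX _ _))).resolve_left hv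
    · rw [hside false v hv]
      exact Bool.false_ne_true
  rw [← T.form_cut hX hJ.graphCut, cutMap_eq, T.form_cutInsert hX hJ.graphCut x f, hcls]
  intro b U hU hb z hconn hz
  let g : X.V → (FilmSurface.restrict hU).V := fun v =>
    if hv : hJ.graphCut.side v = b then ⟨Sum.inl v, (hb (Sum.inl v)).2 hv⟩
    else ⟨Sum.inr b, (hb (Sum.inr b)).2 rfl⟩
  have hg : ∀ v (hv : hJ.graphCut.side v = b), g v = ⟨Sum.inl v, (hb (Sum.inl v)).2 hv⟩ :=
    fun v hv => dif_pos hv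
  refine hf b _ hconn g _ z (fun v hv => ?_)
    (FilmSurface.IsCycle.of_map (FilmSurface.restrictEmb hU) ?_)
  · rw [hg v (hside b v hv), hz v (hside b v hv)]
  · have e : ((bif b then l₁ else l₂).map g).map (FilmSurface.restrictEmb hU).onV =
        (bif b then l₁ else l₂).map Sum.inl := by
      rw [List.map_map]
      refine List.map_congr_left fun v hv => ?_
      exact congrArg Subtype.val (hg v (hside b v hv))
    exact Eq.mpr (congrArg (hJ.graphCut.cut hX).IsCycle (congrArg (List.cons (Sum.inr b)) e)) (hcut b)

/-- The tensors of a theory are inverse to its bilinear form, by cut invariance for the surface with two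
vertices. -/
theorem contract₂_copairing (σ : GraphClass S) (a : B σ.star) (c : B σ) :
    contract₂ (T.bil.flip (incl a)) (T.bil.flip (incl c)) (T.copairing σ) =
      T.bil (incl c) (incl a) := by
  obtain ⟨m⟩ := nonempty_compatibleSurface_star σ
  have h : m.surface.IsCycle ([m.vertex 1] ++ [m.vertex 0]) := m.isCycle_pair.rotate_one
  have e0 : incl (m.family K (pair c a) (m.vertex 0)) = incl c := m.incl_family _ 0
  have e1 : incl (m.family K (pair c a) (m.vertex 1)) = incl a := m.incl_family _ 1
  rw [← e0, ← e1, ← T.form_eq_bil m.connected m.isCycle_pair]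
  symm
  refine T.form_eq_contract₂ m.connected h (by simp) (by simp) _
    (fun b => bif b then _ else _) ?_ ?_
  · rintro (_ | _) Y hY g q z hz hl
    · rw [T.form_eq_bil hY hl, hz _ (by simp)]
      rfl
    · rw [T.form_eq_bil hY hl, hz _ (by simp)]
      rfl
  · rw [FilmSurface.listRel_singleton]
    exact congrArg _ (m.cls_vertex 0).symm

theorem copairing_eq_sum [∀ σ, FiniteDimensional K (B σ)] {b : BasisFamily K B}
    {F : MatrixFamily K B} (hF : IsInverseGram K T.bil b F) (σ : GraphClass S) :
    T.copairing σ = ∑ i, ∑ j, F σ i j • (b σ i ⊗ₜ[K] b σ.star j) := by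
  let M := Matrix.of (fun j i => T.bil (incl (b σ.star j)) (incl (b σ i)))
  let R : Matrix _ _ K := Matrix.of fun i j =>
    ((b σ).tensorProduct (b σ.star)).repr (T.copairing σ) (i, j)
  have hR : T.copairing σ = ∑ i, ∑ j, R i j • (b σ i ⊗ₜ[K] b σ.star j) := by
    rw [← ((b σ).tensorProduct (b σ.star)).sum_repr (T.copairing σ), Fintype.sum_prod_type]
    simp only [Module.Basis.tensorProduct_apply]
    rfl
  have hM : M * R * M = M := by
    ext l m
    have h := T.contract₂_copairing σ (b σ.star l) (b σ m)
    rw [hR] at h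
    simp only [map_sum, map_smul, contract₂_tmul, LinearMap.flip_apply, smul_eq_mul] at h
    rw [Matrix.mul_assoc, Matrix.mul_apply]
    simp only [Matrix.mul_apply, Finset.mul_sum]
    refine Eq.trans ?_ (h.trans (T.bil_symm _ _))
    refine Finset.sum_congr rfl fun i _ => Finset.sum_congr rfl fun j _ => ?_
    rw [T.bil_symm (incl (b σ i))]
    change T.bil (incl (b σ.star l)) (incl (b σ i)) *
      (R i j * T.bil (incl (b σ.star j)) (incl (b σ m))) = _
    ring
  -- `M R M = M` forces `R` to be the inverse of the invertible matrix `M`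
  have hRF : R = F σ := by
    obtain ⟨h1, h2⟩ := hF σ
    calc R = (F σ * M) * R * (M * F σ) := by rw [h1, h2, Matrix.one_mul, Matrix.mul_one]
      _ = F σ * (M * R * M) * F σ := by simp only [Matrix.mul_assoc]
      _ = F σ := by rw [hM, h1, Matrix.one_mul]
  rw [hR, hRF]

/-- The value at a surface with four vertices as a contraction of trilinear forms. -/
theorem form_eq_sum [∀ σ, FiniteDimensional K (B σ)] (hX : X.Connected) {p q r t : X.V}
    (h : X.IsCycle [p, q, r, t]) {s : GraphClass S}
    (h1 : Nonempty (CompatibleSurface ![X.cls p, X.cls q, s]))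
    (h2 : Nonempty (CompatibleSurface ![s.star, X.cls r, X.cls t]))
    {b : BasisFamily K B} {F : MatrixFamily K B} (hF : IsInverseGram K T.bil b F)
    (x : ∀ q, B (X.cls q)) :
    T.form X (PiTensorProduct.tprod K x) =
      ∑ i, ∑ j, T.tri (incl (x p)) (incl (x q)) (incl (b s i)) * F s i j *
        T.tri (incl (b s.star j)) (incl (x r)) (incl (x t)) := by
  have h' : X.IsCycle ([p, q] ++ [r, t]) := h
  have h3 : X.IsCycle ([p] ++ ([q] ++ [r, t])) := h
  -- the class `s` is the class of the graph-cut
  have hs : s.incidence = X.listRel [r, t] := by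
    obtain ⟨τ, hτ, -⟩ := h'.rotate.exists_class (by simp) (by simp)
    rw [← hτ]
    obtain ⟨m⟩ := h3.nonempty_compatibleSurface₃ (by simp) (by simp) (by simp)
      (FilmSurface.listRel_singleton p).symm (FilmSurface.listRel_singleton q).symm hτ
    obtain ⟨m1⟩ := h1
    obtain ⟨m2⟩ := h2
    refine congrArg _ (third_class_unique m m1 fun d hd => ?_)
    obtain ⟨u, hu, hdu⟩ : ∃ u ∈ [p, q], d ∈ (X.cls u).colors := by
      rcases m1.mem_colors_or.2 hd with k | k
      · exact ⟨p, by simp, k⟩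
      · exact ⟨q, by simp, k⟩
    rw [← GraphClass.colors_star] at hd
    obtain ⟨w, hw, hdw⟩ : ∃ w ∈ [r, t], d ∈ (X.cls w).colors := by
      rcases m2.mem_colors_or.1 hd with k | k
      · exact ⟨r, by simp, k⟩
      · exact ⟨t, by simp, k⟩
    exact FilmSurface.mem_colors_of_mem hτ hw
      (fun k => (List.nodup_append.1 h'.nodup).2.2 u hu u k rfl) (hX _ _) hdw hdu
  rw [T.form_eq_contract₂ hX h' (by simp) (by simp) x
    (fun c => bif c then (T.tri.flip (incl (x p))).flip (incl (x q))
      else (T.tri.flip (incl (x r))).flip (incl (x t))) ?_ hs, T.copairing_eq_sum hF]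
  · simp only [map_sum, map_smul, cond_true, cond_false, contract₂_tmul, LinearMap.flip_apply,
      smul_eq_mul]
    refine Finset.sum_congr rfl fun i _ => Finset.sum_congr rfl fun j _ => ?_
    rw [T.tri_cyclic (incl (b s i)), ← mul_assoc, mul_comm (F s i j)]
  · rintro (_ | _) Y hY g c z hz hl
    · rw [T.form_eq_tri hY hl, hz _ (by simp), hz _ (by simp)]
      rfl
    · rw [T.form_eq_tri hY hl, hz _ (by simp), hz _ (by simp)]
      rfl

/-- The graph-Frobenius algebra of a Film Topological Field Theory. -/
noncomputable def algebra [∀ σ, FiniteDimensional K (B σ)] : GraphFrobenius K B where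
  bil := T.bil
  tri := T.tri
  bil_symm := T.bil_symm
  tri_cyclic := T.tri_cyclic
  bil_eq_zero := T.bil_eq_zero
  nondegenerate := T.bil_nondegenerate
  tri_eq_zero := T.tri_eq_zero
  assoc := by
    rintro σ₁ σ₂ σ₃ σ₄ s t ⟨m⟩ h1 h2 h3 h4 b F hF x₁ x₂ x₃ x₄
    have hm : m.surface.IsCycle [m.vertex 0, m.vertex 1, m.vertex 2, m.vertex 3] := by
      have := m.isCycle
      rwa [List.ofFn_succ, List.ofFn_succ, List.ofFn_succ, List.ofFn_succ, List.ofFn_zero] at this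
    have hm' : m.surface.IsCycle [m.vertex 3, m.vertex 0, m.vertex 1, m.vertex 2] :=
      hm.rotate_one.rotate_one.rotate_one
    let y := m.family K (B := B) (Fin.cons (α := fun i => B (![σ₁, σ₂, σ₃, σ₄] i)) x₁
      (triple x₂ x₃ x₄))
    have e0 : incl (y (m.vertex 0)) = incl x₁ := m.incl_family _ 0
    have e1 : incl (y (m.vertex 1)) = incl x₂ := m.incl_family _ 1
    have e2 : incl (y (m.vertex 2)) = incl x₃ := m.incl_family _ 2
    have e3 : incl (y (m.vertex 3)) = incl x₄ := m.incl_family _ 3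
    have c0 : m.surface.cls (m.vertex 0) = σ₁ := m.cls_vertex 0
    have c1 : m.surface.cls (m.vertex 1) = σ₂ := m.cls_vertex 1
    have c2 : m.surface.cls (m.vertex 2) = σ₃ := m.cls_vertex 2
    have c3 : m.surface.cls (m.vertex 3) = σ₄ := m.cls_vertex 3
    rw [← e0, ← e1, ← e2, ← e3]
    refine (T.form_eq_sum m.connected hm ?_ ?_ hF y).symm.trans
      (T.form_eq_sum m.connected hm' ?_ ?_ hF y)
    · rwa [c0, c1]
    · rwa [c2, c3]
    · rwa [c3, c0]
    · rwa [c1, c2]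

theorem generates_algebra [∀ σ, FiniteDimensional K (B σ)] : T.Generates T.algebra where
  bil_eq m x y := (T.bil_incl x y).trans (T.multiForm_apply m _)
  tri_eq m x y z := (T.tri_incl x y z).trans (T.multiForm_apply m _)

variable {T}

theorem Generates.bil_eq_bil {G : GraphFrobenius K B} (h : T.Generates G) : G.bil = T.bil := by
  refine linearMap_ext_incl fun σ x => linearMap_ext_incl fun τ y => ?_
  by_cases hστ : σ = τ.star
  · subst hστ
    obtain ⟨m⟩ := nonempty_compatibleSurface_star τ.star
    rw [GraphClass.star_star] at m
    rw [h.bil_eq m, T.bil_incl, T.multiForm_apply m]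
  · rw [G.bil_eq_zero x y hστ, T.bil_eq_zero x y hστ]

theorem Generates.tri_eq_tri {G : GraphFrobenius K B} (h : T.Generates G) : G.tri = T.tri := by
  refine linearMap_ext_incl fun σ x => linearMap_ext_incl fun τ y => linearMap_ext_incl fun ρ z => ?_
  by_cases hm : Nonempty (CompatibleSurface ![σ, τ, ρ])
  · obtain ⟨m⟩ := hm
    rw [h.tri_eq m, T.tri_incl, T.multiForm_apply m]
  · rw [not_nonempty_iff] at hm
    rw [G.tri_eq_zero x y z hm, T.tri_eq_zero x y z hm]

variable [∀ σ, FiniteDimensional K (B σ)]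

theorem Generates.eq_algebra {G : GraphFrobenius K B} (h : T.Generates G) : G = T.algebra := by
  have h1 := h.bil_eq_bil
  have h2 := h.tri_eq_tri
  obtain ⟨p, t⟩ := G
  obtain rfl : p = T.bil := h1
  obtain rfl : t = T.tri := h2
  rfl

end FilmTFT

/-! ### Uniqueness of the generated theory -/

variable {T : FilmTFT K B} {G : GraphFrobenius K B} [∀ σ, FiniteDimensional K (B σ)]

theorem FilmTFT.Generates.copairing_eq (h : T.Generates G) : T.copairing = G.copairing := by
  funext σ
  refine G.eq_copairing _ fun a c => ?_
  rw [h.bil_eq_bil]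
  exact T.contract₂_copairing σ a c

/-- Induction on the number of vertices: a disconnected surface is decomposed into unions of
components, and a connected surface with at least four vertices is cut into two surfaces with fewer
vertices. -/
theorem FilmTFT.Generates.form_eq (h : T.Generates G) (X : FilmSurface S) :
    T.form X = G.theory.form X := by
  obtain ⟨n, hn⟩ : ∃ n, Nat.card X.V = n := ⟨_, rfl⟩
  induction n using Nat.strong_induction_on generalizing X with | _ n ih
  subst hn
  have := X.finV
  by_cases hX : X.Connected
  · by_cases hc : Nat.card X.V ≤ 3
    · exact h.form_eq_of_card_le G.theory_generates hX hc
    obtain ⟨v⟩ := X.nonemptyV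
    obtain ⟨l, hl, hv⟩ := FilmSurface.exists_isCycle v
    have hlen : Nat.card X.V ≤ l.length := by
      rw [← Nat.card_fin l.length]
      refine Nat.card_le_card_of_surjective l.get fun w => ?_
      exact List.get_of_mem ((hl.joined v hv w).1 (hX _ _))
    replace hlen : 4 ≤ l.length := by omega
    match l, hlen with
    | [], h | [_], h | [_, _], h | [_, _, _], h =>
      simp only [List.length_cons, List.length_nil] at h
      omega
    | p :: q :: r :: t :: l, _ =>
      have hl' : X.IsCycle ([p, q] ++ (r :: t :: l)) := hl
      have hJ := hl'.isArc (by simp) (by simp)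
      have hnd := hl.nodup
      simp only [List.nodup_cons, List.mem_cons, not_or] at hnd
      have hform : T.form (hJ.graphCut.cut hX) = G.theory.form (hJ.graphCut.cut hX) := by
        refine FilmTFT.form_eq_of_restrict (hJ.graphCut.isClopen_piece hX true)
          (hJ.graphCut.isClopen_compl_piece hX) (ih _ ?_ _ rfl) (ih _ ?_ _ rfl)
        · refine hJ.graphCut.card_lt (v := r) (w := t) hnd.2.2.1.1 ?_ ?_
          · rw [ne_eq, hJ.side_graphCut]
            simp only [Set.mem_ofPred_eq, List.mem_cons, List.not_mem_nil, or_false, not_or]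
            exact ⟨Ne.symm hnd.1.2.1, Ne.symm hnd.2.1.1⟩
          · rw [ne_eq, hJ.side_graphCut]
            simp only [Set.mem_ofPred_eq, List.mem_cons, List.not_mem_nil, or_false, not_or]
            exact ⟨Ne.symm hnd.1.2.2.1, Ne.symm hnd.2.1.2.1⟩
        · refine lt_of_le_of_lt (le_of_eq (Nat.card_congr (Equiv.subtypeEquivRight fun x => ?_)))
            (hJ.graphCut.card_lt (b := false) (v := p) (w := q) hnd.1.1 ?_ ?_)
          · exact Iff.of_eq (Bool.not_eq_true _)
          · rw [ne_eq, Bool.not_eq_false, hJ.side_graphCut]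
            simp
          · rw [ne_eq, Bool.not_eq_false, hJ.side_graphCut]
            simp
      ext1
      refine MultilinearMap.ext fun x => ?_
      have h1 := T.form_cut hX hJ.graphCut (PiTensorProduct.tprod K x)
      have h2 := G.theory.form_cut hX hJ.graphCut (PiTensorProduct.tprod K x)
      rw [hform, h.copairing_eq] at h1
      exact h1.symm.trans h2
  · obtain ⟨v, w, hvw⟩ : ∃ v w, ¬ X.Joined v w := by
      by_contra hno
      push Not at hno
      exact hX hno
    have hU : X.IsClopen {p | X.Joined v p} :=
      ⟨⟨v, FilmSurface.joined_refl v⟩, fun h h' => FilmSurface.Joined.trans h' h⟩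
    have hU' : X.IsClopen {p | X.Joined v p}ᶜ :=
      ⟨⟨w, hvw⟩, fun h h' h'' => h' (FilmSurface.Joined.trans h'' h.symm)⟩
    exact FilmTFT.form_eq_of_restrict hU hU' (ih _ (Finite.card_subtype_lt (x := w) hvw) _ rfl)
      (ih _ (Finite.card_subtype_lt (x := v) (not_not.2 (FilmSurface.joined_refl v))) _ rfl)

theorem FilmTFT.Generates.eq_theory (h : T.Generates G) : T = G.theory := by
  have h1 := h.copairing_eq
  have h2 : @T.form = @G.theory.form := funext h.form_eq
  obtain ⟨c, f⟩ := T
  obtain rfl : c = G.copairing := h1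
  obtain rfl : f = _ := h2
  rfl

end Theories

end Film

namespace Film

/-! ### Isomorphism classes -/

section Isomorphisms

variable {K : Type u} [Field K] {S : Type w} {B B' : GraphClass S → Type v}
  [∀ σ, AddCommGroup (B σ)] [∀ σ, Module K (B σ)] [∀ σ, AddCommGroup (B' σ)]
  [∀ σ, Module K (B' σ)]

theorem lmap_incl (f : ∀ σ, B σ →ₗ[K] B' σ) {σ : GraphClass S} (x : B σ) :
    DirectSum.lmap f (incl x) = incl (f σ x) :=
  DirectSum.lmap_lof f σ x

theorem IsHom.map (f : ∀ σ, B σ →ₗ[K] B' σ) {σ : GraphClass S} {x : ⨁ σ, B σ}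
    (h : IsHom B σ x) : IsHom B' σ (DirectSum.lmap f x) := by
  obtain ⟨z, rfl⟩ := h
  exact ⟨f σ z, (lmap_incl f z).symm⟩

end Isomorphisms

variable {K : Type u} [Field K] {S : Type w}

namespace BundledTFT.Iso

variable {T T' : BundledTFT.{u, v, w} K S} (f : Iso T T') {X : FilmSurface S}

theorem form_tprod (x : ∀ q, T.B (X.cls q)) :
    T'.theory.form X (PiTensorProduct.tprod K fun q => f.map _ (x q)) =
      T.theory.form X (PiTensorProduct.tprod K x) := by
  rw [← f.form_map, PiTensorProduct.congr_tprod]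

theorem incl_map_family {n : ℕ} [NeZero n] {σ : Fin n → GraphClass S} (m : CompatibleSurface σ)
    (x : ∀ i, T.B (σ i)) (i : Fin n) :
    incl (f.map _ (m.family K x (m.vertex i))) = incl (f.map _ (x i)) := by
  have h := congrArg (DirectSum.lmap fun σ => (f.map σ).toLinearMap) (m.incl_family (K := K) x i)
  rwa [lmap_incl, lmap_incl] at h

/-- An isomorphism of theories is an isomorphism of their graph-Frobenius algebras. -/
def algebra : BundledGF.Iso ⟨T.B, T.theory.algebra⟩ ⟨T'.B, T'.theory.algebra⟩ where
  map := f.map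
  bil_map {σ τ} x y := by
    change T'.theory.bil _ _ = T.theory.bil _ _
    by_cases hm : Nonempty (CompatibleSurface ![σ, τ])
    · obtain ⟨m⟩ := hm
      have e0 : incl (m.family K (pair x y) (m.vertex 0)) = incl x := m.incl_family _ 0
      have e1 : incl (m.family K (pair x y) (m.vertex 1)) = incl y := m.incl_family _ 1
      have k0 : incl (f.map _ (m.family K (pair x y) (m.vertex 0))) = incl (f.map _ x) :=
        f.incl_map_family m _ 0
      have k1 : incl (f.map _ (m.family K (pair x y) (m.vertex 1))) = incl (f.map _ y) :=
        f.incl_map_family m _ 1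
      rw [← e0, ← e1, ← k0, ← k1, ← T.theory.form_eq_bil m.connected m.isCycle_pair, ← f.form_tprod,
        T'.theory.form_eq_bil m.connected m.isCycle_pair]
    · rw [not_nonempty_iff] at hm
      rw [FilmTFT.bil_incl, FilmTFT.bil_incl, FilmTFT.multiForm_eq_zero _ hm,
        FilmTFT.multiForm_eq_zero _ hm]
      rfl
  tri_map {σ τ ρ} x y z := by
    change T'.theory.tri _ _ _ = T.theory.tri _ _ _
    by_cases hm : Nonempty (CompatibleSurface ![σ, τ, ρ])
    · obtain ⟨m⟩ := hm
      let t := m.family K (triple x y z)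
      have e0 : incl (t (m.vertex 0)) = incl x := m.incl_family _ 0
      have e1 : incl (t (m.vertex 1)) = incl y := m.incl_family _ 1
      have e2 : incl (t (m.vertex 2)) = incl z := m.incl_family _ 2
      have k0 : incl (f.map _ (t (m.vertex 0))) = incl (f.map _ x) := f.incl_map_family m _ 0
      have k1 : incl (f.map _ (t (m.vertex 1))) = incl (f.map _ y) := f.incl_map_family m _ 1
      have k2 : incl (f.map _ (t (m.vertex 2))) = incl (f.map _ z) := f.incl_map_family m _ 2
      rw [← e0, ← e1, ← e2, ← k0, ← k1, ← k2,
        ← T.theory.form_eq_tri m.connected m.isCycle_triple, ← f.form_tprod,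
        T'.theory.form_eq_tri m.connected m.isCycle_triple]
    · rw [not_nonempty_iff] at hm
      rw [FilmTFT.tri_eq_zero _ _ _ _ hm, FilmTFT.tri_eq_zero _ _ _ _ hm]

end BundledTFT.Iso

namespace BundledGF.Iso

variable {G G' : BundledGF.{u, v, w} K S} (f : Iso G G') {X : FilmSurface S}

/-- The graded linear map of an isomorphism. -/
noncomputable def directSumMap : (⨁ σ, G.B σ) →ₗ[K] ⨁ σ, G'.B σ :=
  DirectSum.lmap fun σ => (f.map σ).toLinearMap

theorem directSumMap_incl {σ : GraphClass S} (x : G.B σ) :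
    f.directSumMap (incl x) = incl (f.map σ x) :=
  lmap_incl _ x

theorem bil_directSumMap (x y : ⨁ σ, G.B σ) :
    G'.algebra.bil (f.directSumMap x) (f.directSumMap y) = G.algebra.bil x y := by
  suffices G'.algebra.bil.compl₁₂ f.directSumMap f.directSumMap = G.algebra.bil from
    LinearMap.congr_fun₂ this x y
  refine linearMap_ext_incl fun σ x => linearMap_ext_incl fun τ y => ?_
  rw [LinearMap.compl₁₂_apply, directSumMap_incl, directSumMap_incl, f.bil_map]

theorem tri_directSumMap (x y : ⨁ σ, G.B σ) {ρ : GraphClass S} (z : G.B ρ) :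
    G'.algebra.tri (f.directSumMap x) (f.directSumMap y) (incl (f.map ρ z)) =
      G.algebra.tri x y (incl z) := by
  suffices (G'.algebra.tri.compl₁₂ f.directSumMap f.directSumMap).compr₂
      (LinearMap.applyₗ (incl (f.map ρ z))) = G.algebra.tri.compr₂ (LinearMap.applyₗ (incl z)) from
    LinearMap.congr_fun₂ this x y
  refine linearMap_ext_incl fun σ x => linearMap_ext_incl fun τ y => ?_
  rw [LinearMap.compr₂_apply, LinearMap.compr₂_apply, LinearMap.compl₁₂_apply, directSumMap_incl,
    directSumMap_incl]
  exact f.tri_map x y z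

theorem mul_directSumMap (σ : GraphClass S) (x y : ⨁ σ, G.B σ) :
    G'.algebra.mul σ (f.directSumMap x) (f.directSumMap y) =
      f.directSumMap (G.algebra.mul σ x y) := by
  refine G'.algebra.eq_of_bil_eq (G'.algebra.isHom_mul _ _ _) ((G.algebra.isHom_mul _ _ _).map _)
    fun z => ?_
  obtain ⟨z, rfl⟩ := (f.map σ).surjective z
  rw [G'.algebra.bil_mul _ _ (isHom_incl _), f.tri_directSumMap, ← f.directSumMap_incl,
    f.bil_directSumMap, G.algebra.bil_mul _ _ (isHom_incl _)]

theorem mulRel_directSumMap (R : S × Bool → S × Bool → Prop) (x y : ⨁ σ, G.B σ) :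
    G'.algebra.mulRel R (f.directSumMap x) (f.directSumMap y) =
      f.directSumMap (G.algebra.mulRel R x y) := by
  by_cases h : ∃ s : GraphClass S, s.star.incidence = R
  · obtain ⟨s, hs⟩ := h
    rw [GraphFrobenius.mulRel_eq _ hs, GraphFrobenius.mulRel_eq _ hs, f.mul_directSumMap]
  · rw [GraphFrobenius.mulRel, GraphFrobenius.mulRel, dif_neg h, dif_neg h]
    exact (map_zero _).symm

theorem prod_directSumMap (ξ : X.V → ⨁ σ, G.B σ) (l : List X.V) :
    G'.algebra.prod (fun q => f.directSumMap (ξ q)) l = f.directSumMap (G.algebra.prod ξ l) := by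
  induction l with
  | nil => exact (map_zero _).symm
  | cons v l ih =>
    by_cases hl : l = []
    · rw [hl, GraphFrobenius.prod_singleton, GraphFrobenius.prod_singleton]
    · rw [GraphFrobenius.prod_cons _ _ _ hl, GraphFrobenius.prod_cons _ _ _ hl, ih,
        f.mulRel_directSumMap]

theorem val_directSumMap (ξ : X.V → ⨁ σ, G.B σ) (l : List X.V) :
    G'.algebra.val (fun q => f.directSumMap (ξ q)) l = G.algebra.val ξ l := by
  cases l with
  | nil => rfl
  | cons v l => rw [GraphFrobenius.val, GraphFrobenius.val, f.prod_directSumMap, f.bil_directSumMap]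

theorem contract₂_congr {σ τ : GraphClass S} (p q : (⨁ σ, G'.B σ) →ₗ[K] K)
    (k : G.B σ ⊗[K] G.B τ) : contract₂ p q (TensorProduct.congr (f.map σ) (f.map τ) k) =
      contract₂ (p ∘ₗ f.directSumMap) (q ∘ₗ f.directSumMap) k := by
  induction k using TensorProduct.induction_on with
  | zero => simp only [map_zero]
  | add k k' h h' => rw [map_add, map_add, h, h', map_add]
  | tmul x y =>
    rw [TensorProduct.congr_tmul, contract₂_tmul, contract₂_tmul, LinearMap.comp_apply,
      LinearMap.comp_apply, f.directSumMap_incl, f.directSumMap_incl]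

/-- An isomorphism of graph-Frobenius algebras is an isomorphism of their theories. -/
def theory : BundledTFT.Iso ⟨G.B, G.algebra.theory⟩ ⟨G'.B, G'.algebra.theory⟩ where
  map := f.map
  form_map X x := by
    suffices G'.algebra.form X ∘ₗ (PiTensorProduct.congr fun q => f.map (X.cls q)).toLinearMap =
      G.algebra.form X from LinearMap.congr_fun this x
    refine form_ext fun x => ?_
    rw [LinearMap.comp_apply, LinearEquiv.coe_coe, PiTensorProduct.congr_tprod,
      GraphFrobenius.form_tprod, GraphFrobenius.form_tprod, GraphFrobenius.formVal,
      GraphFrobenius.formVal]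
    refine finprod_congr fun κ => ?_
    simp only [← f.directSumMap_incl]
    exact f.val_directSumMap _ _
  copairing_map σ := by
    refine G'.algebra.eq_copairing _ fun a c => ?_
    obtain ⟨a, rfl⟩ := (f.map σ.star).surjective a
    obtain ⟨c, rfl⟩ := (f.map σ).surjective c
    have h : ∀ {τ : GraphClass S} (a : G.B τ), G'.algebra.bil.flip (incl (f.map τ a)) ∘ₗ
        f.directSumMap = G.algebra.bil.flip (incl a) := fun a => LinearMap.ext fun x => by
      rw [LinearMap.comp_apply, LinearMap.flip_apply, ← f.directSumMap_incl, f.bil_directSumMap,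
        LinearMap.flip_apply]
    rw [f.contract₂_congr, h, h, f.bil_map]
    exact G.algebra.contract₂_copairing _ (isHom_incl c)

end BundledGF.Iso

theorem FilmTFT.theory_algebra {B : GraphClass S → Type v} [∀ σ, AddCommGroup (B σ)]
    [∀ σ, Module K (B σ)] [∀ σ, FiniteDimensional K (B σ)] (T : FilmTFT K B) :
    T.algebra.theory = T :=
  T.generates_algebra.eq_theory.symm

theorem GraphFrobenius.algebra_theory {B : GraphClass S → Type v} [∀ σ, AddCommGroup (B σ)]
    [∀ σ, Module K (B σ)] [∀ σ, FiniteDimensional K (B σ)] (G : GraphFrobenius K B) :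
    G.theory.algebra = G :=
  G.theory_generates.eq_algebra.symm

variable (K S) in
/-- The bijection of isomorphism classes that sends a theory to its graph-Frobenius algebra. -/
noncomputable def quotientEquiv : Quotient (BundledTFT.setoid.{u, v, w} K S) ≃
    Quotient (BundledGF.setoid.{u, v, w} K S) where
  toFun := Quotient.map (fun T => ⟨T.B, T.theory.algebra⟩) fun _ _ ⟨f⟩ => ⟨f.algebra⟩
  invFun := Quotient.map (fun G => ⟨G.B, G.algebra.theory⟩) fun _ _ ⟨f⟩ => ⟨f.theory⟩
  left_inv T := by
    induction T using Quotient.inductionOn with | _ T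
    exact congrArg (fun t => Quotient.mk _ (BundledTFT.mk T.B t)) T.theory.theory_algebra
  right_inv G := by
    induction G using Quotient.inductionOn with | _ G
    exact congrArg (fun t => Quotient.mk _ (BundledGF.mk G.B t)) G.algebra.algebra_theory

end Film

theorem theorem3p2 {K : Type u} [Field K] [CharZero K] {S : Type w} :
    (∀ (B : Film.GraphClass S → Type v) [∀ σ, AddCommGroup (B σ)] [∀ σ, Module K (B σ)]
        [∀ σ, FiniteDimensional K (B σ)],
      -- every graph-Frobenius algebra generates a unique theory, given by the chain formula
      (∀ G : Film.GraphFrobenius K B, ∃ T : Film.FilmTFT K B, T.Generates G ∧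
        (∀ (b : Film.BasisFamily K B) (F : Film.MatrixFamily K B), Film.IsInverseGram K G.bil b F →
          ∀ (n : ℕ) (σ : Fin (n + 1) → Film.GraphClass S) (m : Film.CompatibleSurface σ)
            (x : ∀ i, B (σ i)),
            T.form m.surface (m.tensor x) =
              G.chain b F (Film.incl (x 0)) (List.ofFn fun i : Fin n => Film.incl (x i.succ))) ∧
        ∀ T' : Film.FilmTFT K B, T'.Generates G → T' = T) ∧
      -- every theory generates a unique graph-Frobenius algebra
      (∀ T : Film.FilmTFT K B, ∃! G : Film.GraphFrobenius K B, T.Generates G)) ∧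
    -- hence the correspondence of isomorphism classes
    ∃ e : Quotient (Film.BundledTFT.setoid.{u, v, w} K S) ≃
        Quotient (Film.BundledGF.setoid.{u, v, w} K S),
      ∀ (B : Film.GraphClass S → Type v) [∀ σ, AddCommGroup (B σ)] [∀ σ, Module K (B σ)]
        [∀ σ, FiniteDimensional K (B σ)] (T : Film.FilmTFT K B) (G : Film.GraphFrobenius K B),
        T.Generates G →
          e (Quotient.mk _ (Film.BundledTFT.mk B T)) = Quotient.mk _ (Film.BundledGF.mk B G) := by
  refine ⟨fun B _ _ _ => ⟨fun G => ⟨G.theory, G.theory_generates,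
    fun b F hF n σ m x => G.form_eq_chain hF m x, fun T h => h.eq_theory⟩,
    fun T => ⟨T.algebra, T.generates_algebra, fun G h => h.eq_algebra⟩⟩,
    Film.quotientEquiv K S, fun B _ _ _ T G h => ?_⟩
  rw [h.eq_algebra]
  rfl
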